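/- **Setting.** For each $T\ge 1$ let $(x_t,\varepsilon_t)_{1\le t\le T}$ (the row index $T$ is suppressed; the data form a triangular array) be random with $x_t\in\mathbb R^p$, $\varepsilon_t\in\mathbb R$. Let $R$ be a $p\times q$ matrix of rank $q$, $z_t=R'x_t$, $0<\alpha<\tfrac12$, $\rho_0\in[\alpha,1-\alpha]$, $k_0=[\rho_0T]$, and $$y_t=x_t'\beta+\mathbf 1\{t>k_0\}\,z_t'\delta_T+\varepsilon_t,\qquad 1\le t\le T .$$ Let $X=(x_1,\dots,x_T)'$, $X_k=(0,\dots,0,x_{k+1},\dots,x_T)'$, $Z_k=X_kR$, $Z_0=Z_{k_0}$, $M=I-X(X'X)^{-1}X'$, $Y=(y_1,\dots,y_T)'$. For $q\times q$ matrices $\Omega_k=\Omega_{T,k}$ put $$\hat\delta_k=(Z_k'MZ_k)^{-1}Z_k'MY,\qquad Q_T(k)^2=\hat\delta_k'(Z_k'MZ_k)^{1/2}\,\Omega_k\,(Z_k'MZ_k)^{1/2}\hat\delta_k ,$$ and let $\hat k$ be a maximizer of $Q_T(k)^2$ over the $k\in\{1,\dots,T-1\}$ for which $Z_k'MZ_k$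 is invertible; $\hat\rho=\hat k/T$. Vectors carry the Euclidean norm and matrices the operator norm. **Assumptions.** 1. Each of the four families $j^{-1}\sum_{t=1}^{j}x_tx_t'$ ($j\le T$), $j^{-1}\sum_{t=T-j+1}^{T}x_tx_t'$ ($j\le T$), $j^{-1}\sum_{t=k_0-j+1}^{k_0}x_tx_t'$ ($j\le k_0$), $j^{-1}\sum_{t=k_0+1}^{k_0+j}x_tx_t'$ ($j\le T-k_0$) has the following properties. For every $\eta>0$ there are $\lambda>0$ and $J$ such that, for all large $T$, with probability at least $1-\eta$ the smallest eigenvalue is at least $\lambda$ for all $j\ge J$; the matrices are almost surely invertible for $j\ge p$; and the supremum over $j\ge1$ of their norms is stochastically bounded. 2. For some $\gamma>0$, the coordinates of $x_t$ that are random have absolute $(4+\gamma)$-th moments bounded uniformly in $t\le T$ and $T$ (nonrandom coordinates are allowed). 3. $X'X/T$ converges in probability to a nonrandom positive definite matrix. 4. $E[\varepsilon_t\mid\mathcal F_{t-1}]=0$ for $\mathcal F_t=\sigma(\varepsilon_s,x_{s+1}:s\le t)$, and for some $\gamma>0$, $E|\varepsilon_t|^{4+\gamma}$ is bounded uniformly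 in $t\le T$ and $T$. 5. The $\Omega_k$ ($1\le k\le T-1$) are nonrandom and positive definite, and there is a function $\bar\Omega$, differentiable element-wise on $[0,1]$, such that $\Omega_{k}\to\bar\Omega(\rho)$ whenever $k/T\to\rho\in[0,1]$ as $T\to\infty$. 6. (Norm inequality, uniform form.) For $c\in\mathbb R^q$ write $a(c)=(Z_0'MZ_0)^{1/2}c$ and $b_k(c)=(Z_k'MZ_k)^{-1/2}(Z_k'MZ_0)c$. For every $\eta>0$ there are $\kappa>0$ and $J$ such that, for all large $T$, with probability at least $1-\eta$, $$\|\Omega_{k_0}^{1/2}a(c)\|^2-\|\Omega_k^{1/2}b_k(c)\|^2\ \ge\ \kappa\left(\|a(c)\|^2-\|b_k(c)\|^2\right)$$ for all $c\in\mathbb R^q$ and all $k\in\{1,\dots,T-1\}$ with $|k-k_0|\ge J$ and $Z_k'MZ_k$ invertible. 7. Either $\delta_T=\delta\ne0$ is fixed, or $\delta_T\to0$ and $T^{1/2-\gamma}\|\delta_T\|\to\infty$ for some $\gamma\in(0,\tfrac12)$. **Theorem.** Under these assumptions $\hat k=k_0+O_p(\|\delta_T\|^{-2})$, and $\hat\rho$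 is consistent, with $$|\hat\rho-\rho_0|=O_p\!\left(T^{-1}\|\delta_T\|^{-2}\right)=o_p(1).$$ -/

import Mathlib

open MeasureTheory Filter Topology Matrix
open scoped Matrix.Norms.L2Operator MatrixOrder

noncomputable section

namespace BreakPoint

/-! ### Finite-sample objects

A sample of size `T` is a design matrix `X` whose row `i : Fin T` holds the regressors of
period `i + 1`, and a vector `Y` of responses. -/

/-- `X_k`: the rows of `X` of the periods `t ≤ k` are replaced by zero. -/
def after {T p : ℕ} (X : Matrix (Fin T) (Fin p) ℝ) (k : ℕ) : Matrix (Fin T) (Fin p) ℝ :=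
  Matrix.of fun t i => if k < (t : ℕ) + 1 then X t i else 0

/-- `Z_k = X_k R`. -/
def Zmat {T p q : ℕ} (X : Matrix (Fin T) (Fin p) ℝ) (R : Matrix (Fin p) (Fin q) ℝ) (k : ℕ) :
    Matrix (Fin T) (Fin q) ℝ :=
  after X k * R

/-- `M = I - X (X'X)⁻¹ X'`. -/
def annihilator {T p : ℕ} (X : Matrix (Fin T) (Fin p) ℝ) : Matrix (Fin T) (Fin T) ℝ :=
  1 - X * (Xᵀ * X)⁻¹ * Xᵀ

/-- `Z_k' M Z_l`. -/
def ZMZ {T p q : ℕ} (X : Matrix (Fin T) (Fin p) ℝ) (R : Matrix (Fin p) (Fin q) ℝ) (k l : ℕ) :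
    Matrix (Fin q) (Fin q) ℝ :=
  (Zmat X R k)ᵀ * annihilator X * Zmat X R l

/-- `(Z_k' M Z_k)^{1/2}`, the symmetric positive semidefinite square root. -/
def rootZMZ {T p q : ℕ} (X : Matrix (Fin T) (Fin p) ℝ) (R : Matrix (Fin p) (Fin q) ℝ) (k : ℕ) :
    Matrix (Fin q) (Fin q) ℝ :=
  CFC.sqrt (ZMZ X R k k)

/-- The least squares estimate of the break magnitude when `k` is taken as the break date:
`(Z_k' M Z_k)⁻¹ Z_k' M Y`. -/
def deltaHat {T p q : ℕ} (X : Matrix (Fin T) (Fin p) ℝ) (R : Matrix (Fin p) (Fin q) ℝ)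
    (Y : Fin T → ℝ) (k : ℕ) : Fin q → ℝ :=
  (ZMZ X R k k)⁻¹ *ᵥ ((Zmat X R k)ᵀ *ᵥ (annihilator X *ᵥ Y))

/-- `v' W v`, that is `‖W^{1/2} v‖²` for a positive semidefinite `W`. -/
def quad {q : ℕ} (W : Matrix (Fin q) (Fin q) ℝ) (v : Fin q → ℝ) : ℝ :=
  v ⬝ᵥ (W *ᵥ v)

/-- `Q_T(k)² = δ̂_k' (Z_k'MZ_k)^{1/2} Ω_k (Z_k'MZ_k)^{1/2} δ̂_k`, with `W k` in the place of
`Ω_k`. -/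
def objective {T p q : ℕ} (X : Matrix (Fin T) (Fin p) ℝ) (R : Matrix (Fin p) (Fin q) ℝ)
    (Y : Fin T → ℝ) (W : ℕ → Matrix (Fin q) (Fin q) ℝ) (k : ℕ) : ℝ :=
  quad (W k) (rootZMZ X R k *ᵥ deltaHat X R Y k)

/-- The dates `1 ≤ k ≤ T - 1` at which `δ̂_k`, and hence `Q_T(k)²`, is defined. -/
def Admissible {T p q : ℕ} (X : Matrix (Fin T) (Fin p) ℝ) (R : Matrix (Fin p) (Fin q) ℝ)
    (k : ℕ) : Prop :=
  1 ≤ k ∧ k < T ∧ IsUnit (ZMZ X R k k).det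

/-- `k` maximizes `Q_T(·)²` over the admissible dates. -/
def IsArgmax {T p q : ℕ} (X : Matrix (Fin T) (Fin p) ℝ) (R : Matrix (Fin p) (Fin q) ℝ)
    (Y : Fin T → ℝ) (W : ℕ → Matrix (Fin q) (Fin q) ℝ) (k : ℕ) : Prop :=
  Admissible X R k ∧ ∀ l, Admissible X R l → objective X R Y W l ≤ objective X R Y W k

/-- The norm inequality at the date `k`, with margin `κ` (`k₀` is the true break date):
`‖Ω_{k₀}^{1/2} a‖² - ‖Ω_k^{1/2} b‖² ≥ κ (‖a‖² - ‖b‖²)` for every `c`, where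
`a = (Z_0'MZ_0)^{1/2} c` and `b = (Z_k'MZ_k)^{-1/2} (Z_k'MZ_0) c`. -/
def NormIneq {T p q : ℕ} (X : Matrix (Fin T) (Fin p) ℝ) (R : Matrix (Fin p) (Fin q) ℝ)
    (W : ℕ → Matrix (Fin q) (Fin q) ℝ) (k₀ : ℕ) (κ : ℝ) (k : ℕ) : Prop :=
  ∀ c : Fin q → ℝ,
    κ * (quad 1 (rootZMZ X R k₀ *ᵥ c) - quad 1 ((rootZMZ X R k)⁻¹ *ᵥ (ZMZ X R k k₀ *ᵥ c))) ≤
      quad (W k₀) (rootZMZ X R k₀ *ᵥ c) -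
        quad (W k) ((rootZMZ X R k)⁻¹ *ᵥ (ZMZ X R k k₀ *ᵥ c))

/-! ### Triangular arrays -/

/-- `k₀ = [ρ₀ T]`. -/
def breakDate (ρ₀ : ℝ) (T : ℕ) : ℕ := ⌊ρ₀ * (T : ℝ)⌋₊

/-- The `T × p` design matrix of row `T` of the array (periods `1, …, T`). -/
def design {S : Type*} {p : ℕ} (x : ℕ → ℕ → S → Fin p → ℝ) (T : ℕ) (s : S) :
    Matrix (Fin T) (Fin p) ℝ :=
  Matrix.of fun t i => x T ((t : ℕ) + 1) s i

/-- The responses of row `T` of the array. -/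
def response {S : Type*} (y : ℕ → ℕ → S → ℝ) (T : ℕ) (s : S) : Fin T → ℝ :=
  fun t => y T ((t : ℕ) + 1) s

/-- `j⁻¹ ∑_{t = a+1}^{a+j} x_t x_t'`. -/
def gram {S : Type*} {p : ℕ} (x : ℕ → ℕ → S → Fin p → ℝ) (T a j : ℕ) (s : S) :
    Matrix (Fin p) (Fin p) ℝ :=
  (j : ℝ)⁻¹ • ∑ t ∈ Finset.Ioc a (a + j), Matrix.vecMulVec (x T t s) (x T t s)

/-- The σ-field generated by `ε_s`, `s < t`, and `x_s`, `s ≤ t` (periods `s ≥ 1`): this is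
`𝓕_{t-1}` for `𝓕_t = σ(ε_s, x_{s+1} : s ≤ t)`. -/
abbrev past {S : Type*} {p : ℕ} (ε : ℕ → ℕ → S → ℝ) (x : ℕ → ℕ → S → Fin p → ℝ) (T t : ℕ) :
    MeasurableSpace S :=
  (⨆ s ∈ Finset.Ico 1 t, MeasurableSpace.comap (ε T s) inferInstance) ⊔
    ⨆ s ∈ Finset.Icc 1 t, MeasurableSpace.comap (x T s) inferInstance

/-- `U_T = O_p(r_T)`. -/
def IsBigOp {S : Type*} [MeasurableSpace S] (P : Measure S) (U : ℕ → S → ℝ) (r : ℕ → ℝ) : Prop :=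
  ∀ η : ℝ, 0 < η → ∃ C : ℝ, 0 < C ∧ ∀ᶠ T in atTop,
    P {s | C * r T < |U T s|} ≤ ENNReal.ofReal η

/-- The eigenvalue and norm conditions on a family `G T j`, `1 ≤ j ≤ n T`, of random symmetric
matrices: uniformly over all large `j` the smallest eigenvalue is bounded away from zero in
probability; `G T j` is invertible when `j ≥ p`; and `sup_j ‖G T j‖` (operator norm) is
stochastically bounded. -/
structure WellConditioned {S : Type*} [MeasurableSpace S] (P : Measure S) {p : ℕ} (n : ℕ → ℕ)
    (G : ℕ → ℕ → S → Matrix (Fin p) (Fin p) ℝ) : Prop where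
  eigenvalue : ∀ η : ℝ, 0 < η → ∃ l : ℝ, 0 < l ∧ ∃ J : ℕ, ∀ᶠ T in atTop,
    P {s | ∃ j, J ≤ j ∧ 1 ≤ j ∧ j ≤ n T ∧ ∃ e ∈ spectrum ℝ (G T j s), e < l} ≤ ENNReal.ofReal η
  invertible : ∀ T j, 1 ≤ j → p ≤ j → j ≤ n T → ∀ᵐ s ∂P, IsUnit (G T j s).det
  bounded : ∀ η : ℝ, 0 < η → ∃ B : ℝ, ∀ᶠ T in atTop,
    P {s | ∃ j, 1 ≤ j ∧ j ≤ n T ∧ B < ‖G T j s‖} ≤ ENNReal.ofReal η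

/-- `sup_{t,T} E |u_t|^r < ∞` over the periods `1 ≤ t ≤ T`. -/
def BoundedMoment {S : Type*} [MeasurableSpace S] (P : Measure S) (r : ℝ)
    (u : ℕ → ℕ → S → ℝ) : Prop :=
  ∃ K : ℝ, ∀ T t, 1 ≤ t → t ≤ T → ∫⁻ s, ENNReal.ofReal (|u T t s| ^ r) ∂P ≤ ENNReal.ofReal K

/-- The array `u` consists of (almost surely) nonrandom numbers. -/
def Nonrandom {S : Type*} [MeasurableSpace S] (P : Measure S) (u : ℕ → ℕ → S → ℝ) : Prop :=
  ∃ a : ℕ → ℕ → ℝ, ∀ T t, 1 ≤ t → t ≤ T → ∀ᵐ s ∂P, u T t s = a T t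

/-- `δ_T` is fixed and nonzero, or `δ_T → 0` and `T^{1/2-γ} ‖δ_T‖ → ∞` for some
`γ ∈ (0, 1/2)`. -/
def BreakMagnitude {q : ℕ} (δ : ℕ → EuclideanSpace ℝ (Fin q)) : Prop :=
  (∃ d : EuclideanSpace ℝ (Fin q), d ≠ 0 ∧ ∀ T, δ T = d) ∨
    (Tendsto δ atTop (𝓝 0) ∧ ∃ γ : ℝ, 0 < γ ∧ γ < 1 / 2 ∧
      Tendsto (fun T : ℕ => (T : ℝ) ^ (1 / 2 - γ) * ‖δ T‖) atTop atTop)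

end BreakPoint

end

/-! Write `h = |k - k₀|`, `d = ‖δ_T‖²`, `c = δ̂_{k₀}` and `u = c - δ_T`. Since `M` kills `Xβ`, `MY =
M Z₀ c + M (ε - Z₀ u)`, and the normal equations at `k₀` make the second term orthogonal to `Z₀`.
Expanding around the estimated break `c` rather than the true one therefore leaves no noise at `k₀`:
`Q_T(k₀)² = ‖Ω_{k₀}^{1/2} a(c)‖²`, while `Q_T(k)² = ‖Ω_k^{1/2} (b_k(c) + f)‖²` with `f =
(Z_k'MZ_k)^{-1/2} Z_k'M (ε - Z₀ u)`.

Signal. The norm inequality bounds the loss from using `b_k(c)` below by `κ (‖a‖² - ‖b‖²)`. This gap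
is the squared distance of `M Z₀ c` from the columns of `M Z_k` (`quad_rootZMZ_sub`), hence at least
a constant times `h ‖Rc‖²` (`le_break_distance`), and `‖Rc‖²` is at least a constant times `d`.

Noise. Orthogonality to `Z₀` reduces `Z_k'M (ε - Z₀ u)` to a sum over the `h` periods between `k`
and `k₀`. If sums of `x_t ε_t` over such blocks are at most `h √(σ d)` in norm, then `‖f‖²` is at
most a constant times `σ d h² / T` (`residual_noise_sq_le`); near the ends of the sample `h` is
comparable to `T` and a global bound suffices. As `‖b‖²` is at most of order `T ‖Rc‖²`, the cross
term is at most of order `√σ h ‖Rc‖²`, so for small `σ` the signal wins. This is the deterministic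
statement `objective_lt_of_regular`.

Probability. Kolmogorov's inequality, summed over dyadic blocks (`measure_weighted_max_le`), bounds
the block sums for all `h ≥ C / d` at once, with failure probability of order `1 / (σ C)`
(`MaximalBound.near`), and the sums from the sample ends with vanishing failure probability
(`MaximalBound.far`). For `C` large no date with `h > C / d` maximizes the criterion, up to
probability `η`. The constants are chosen in the order `κ, l, B`, then `σ`, then `C`. -/

namespace BreakPoint

/-! ### Maximal inequalities for square integrable martingale differences -/

section Maximal

variable {S : Type*} {m0 : MeasurableSpace S} {P : Measure S}

theorem stronglyMeasurable_partialSum (F : Filtration ℕ m0) {ξ : ℕ → S → ℝ}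
    (hadp : ∀ n, StronglyMeasurable[F (n + 1)] (ξ n)) (n : ℕ) :
    StronglyMeasurable[F n] (fun s => ∑ i ∈ Finset.range n, ξ i s) := by
  refine Finset.stronglyMeasurable_fun_sum _ fun i hi => ?_
  exact (hadp i).mono (F.mono (Finset.mem_range.mp hi))

theorem memLp_partialSum {ξ : ℕ → S → ℝ} (hL2 : ∀ n, MemLp (ξ n) 2 P) (n : ℕ) :
    MemLp (fun s => ∑ i ∈ Finset.range n, ξ i s) 2 P :=
  memLp_finsetSum _ fun i _ => hL2 i

variable [IsProbabilityMeasure P]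

theorem condExp_partialSum_mul (F : Filtration ℕ m0) {ξ : ℕ → S → ℝ}
    (hadp : ∀ n, StronglyMeasurable[F (n + 1)] (ξ n)) (hL2 : ∀ n, MemLp (ξ n) 2 P)
    (hmds : ∀ n, P[ξ n | F n] =ᵐ[P] 0) (n : ℕ) :
    P[(fun s => ∑ i ∈ Finset.range n, ξ i s) * ξ n | F n] =ᵐ[P] 0 := by
  have h := condExp_mul_of_stronglyMeasurable_left (μ := P)
    (stronglyMeasurable_partialSum F hadp n)
    ((memLp_partialSum hL2 n).integrable_mul (hL2 n)) ((hL2 n).integrable (by norm_num))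
  filter_upwards [h, hmds n] with s h1 h2
  rw [h1, Pi.mul_apply, h2]
  simp

/-- With `S_n` the partial sum, the increment of the square is `2 S_n ξ_n + ξ_n²`; the first term
has conditional mean zero and the second is nonnegative. -/
theorem submartingale_partialSum_sq (F : Filtration ℕ m0) {ξ : ℕ → S → ℝ}
    (hadp : ∀ n, StronglyMeasurable[F (n + 1)] (ξ n)) (hL2 : ∀ n, MemLp (ξ n) 2 P)
    (hmds : ∀ n, P[ξ n | F n] =ᵐ[P] 0) :
    Submartingale (fun n s => (∑ i ∈ Finset.range n, ξ i s) ^ 2) F P := by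
  refine submartingale_of_condExp_sub_nonneg_nat
    (fun n => (stronglyMeasurable_partialSum F hadp n).pow 2)
    (fun n => (memLp_partialSum hL2 n).integrable_sq) fun n => ?_
  have hmul := (memLp_partialSum hL2 n).integrable_mul (hL2 n)
  have hsq := (hL2 n).integrable_sq
  have hdecomp : (fun s => (∑ i ∈ Finset.range (n + 1), ξ i s) ^ 2)
      - (fun s => (∑ i ∈ Finset.range n, ξ i s) ^ 2)
      = (2 : ℝ) • ((fun s => ∑ i ∈ Finset.range n, ξ i s) * ξ n) + fun s => ξ n s ^ 2 := by
    funext s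
    simp only [Pi.sub_apply, Finset.sum_range_succ, Pi.add_apply, Pi.smul_apply, Pi.mul_apply,
      smul_eq_mul]
    ring
  rw [hdecomp]
  have hnn : 0 ≤ᵐ[P] P[fun s => ξ n s ^ 2 | F n] :=
    condExp_nonneg (ae_of_all _ fun s => sq_nonneg _)
  filter_upwards [condExp_add (hmul.smul (2 : ℝ)) hsq (F n),
    condExp_smul (2 : ℝ) ((fun s => ∑ i ∈ Finset.range n, ξ i s) * ξ n) (F n) (μ := P),
    condExp_partialSum_mul F hadp hL2 hmds n, hnn] with s h1 h2 h3 h4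
  rw [h1, Pi.add_apply, h2, Pi.smul_apply, h3]
  simpa using h4

theorem integral_partialSum_sq (F : Filtration ℕ m0) {ξ : ℕ → S → ℝ}
    (hadp : ∀ n, StronglyMeasurable[F (n + 1)] (ξ n)) (hL2 : ∀ n, MemLp (ξ n) 2 P)
    (hmds : ∀ n, P[ξ n | F n] =ᵐ[P] 0) (n : ℕ) :
    ∫ s, (∑ i ∈ Finset.range n, ξ i s) ^ 2 ∂P = ∑ i ∈ Finset.range n, ∫ s, ξ i s ^ 2 ∂P := by
  induction n with
  | zero => simp
  | succ n ih =>
    have hmul := (memLp_partialSum hL2 n).integrable_mul (hL2 n)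
    have hzero : ∫ s, ((fun s => ∑ i ∈ Finset.range n, ξ i s) * ξ n) s ∂P = 0 := by
      rw [← integral_condExp (F.le n), integral_congr_ae (condExp_partialSum_mul F hadp hL2 hmds n)]
      simp
    have hexp : ∀ s, (∑ i ∈ Finset.range (n + 1), ξ i s) ^ 2
        = (∑ i ∈ Finset.range n, ξ i s) ^ 2
          + (2 * ((fun s => ∑ i ∈ Finset.range n, ξ i s) * ξ n) s + ξ n s ^ 2) := by
      intro s
      simp only [Finset.sum_range_succ, Pi.mul_apply]
      ring
    simp_rw [hexp]
    rw [integral_add (memLp_partialSum hL2 n).integrable_sq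
        (g := fun s => 2 * ((fun s => ∑ i ∈ Finset.range n, ξ i s) * ξ n) s + ξ n s ^ 2)
        ((hmul.const_mul 2).add (hL2 n).integrable_sq),
      integral_add (hmul.const_mul 2) (hL2 n).integrable_sq, integral_const_mul, hzero, ih,
      Finset.sum_range_succ]
    ring

/-- Kolmogorov's inequality for martingale differences. -/
theorem measure_partialSum_le (F : Filtration ℕ m0) {ξ : ℕ → S → ℝ}
    (hadp : ∀ n, StronglyMeasurable[F (n + 1)] (ξ n)) (hL2 : ∀ n, MemLp (ξ n) 2 P)
    (hmds : ∀ n, P[ξ n | F n] =ᵐ[P] 0) (n : ℕ) {x : ℝ} (hx : 0 < x) :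
    P {s | ∃ j ≤ n, x ≤ |∑ i ∈ Finset.range j, ξ i s|} ≤
      ENNReal.ofReal ((∑ i ∈ Finset.range n, ∫ s, ξ i s ^ 2 ∂P) / x ^ 2) := by
  have hsub := submartingale_partialSum_sq F hadp hL2 hmds
  have hx2 : 0 < x ^ 2 := by positivity
  have hcast : ((x ^ 2).toNNReal : ℝ) = x ^ 2 := Real.coe_toNNReal _ hx2.le
  -- Doob's inequality for the squared sums, at level `x²`.
  have hmax := maximal_ineq hsub (fun n s => sq_nonneg _) (ε := (x ^ 2).toNNReal) n
  set E : Set S := {s | ((x ^ 2).toNNReal : ℝ) ≤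
    (Finset.range (n + 1)).sup' Finset.nonempty_range_add_one
      fun k => (∑ i ∈ Finset.range k, ξ i s) ^ 2} with hE
  have hsubset : {s | ∃ j ≤ n, x ≤ |∑ i ∈ Finset.range j, ξ i s|} ⊆ E := by
    rintro s ⟨j, hj, hxj⟩
    have hmem : j ∈ Finset.range (n + 1) := Finset.mem_range.2 (by omega)
    refine le_trans ?_ (Finset.le_sup' (fun k => (∑ i ∈ Finset.range k, ξ i s) ^ 2) hmem)
    change ((x ^ 2).toNNReal : ℝ) ≤ _
    rw [hcast, ← sq_abs (∑ i ∈ Finset.range j, ξ i s)]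
    gcongr
  have hint : ∫ s in E, (∑ i ∈ Finset.range n, ξ i s) ^ 2 ∂P ≤
      ∑ i ∈ Finset.range n, ∫ s, ξ i s ^ 2 ∂P := by
    rw [← integral_partialSum_sq F hadp hL2 hmds n]
    exact setIntegral_le_integral (memLp_partialSum hL2 n).integrable_sq
      (ae_of_all _ fun s => sq_nonneg _)
  change ENNReal.ofReal (x ^ 2) * P E ≤ _ at hmax
  rw [ENNReal.ofReal_div_of_pos hx2,
    ENNReal.le_div_iff_mul_le (Or.inl (by simpa using hx2.ne')) (Or.inl ENNReal.ofReal_ne_top),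
    mul_comm]
  calc ENNReal.ofReal (x ^ 2) * P {s | ∃ j ≤ n, x ≤ |∑ i ∈ Finset.range j, ξ i s|}
      ≤ ENNReal.ofReal (x ^ 2) * P E := by gcongr
    _ ≤ _ := hmax
    _ ≤ _ := ENNReal.ofReal_le_ofReal hint

theorem sum_Ioc_add_eq_sum_range {M : Type*} [AddCommMonoid M] (f : ℕ → M) (a j : ℕ) :
    ∑ t ∈ Finset.Ioc a (a + j), f t = ∑ i ∈ Finset.range j, f (a + 1 + i) := by
  have h : Finset.Ioc a (a + j) = Finset.Ico (a + 1) (a + 1 + j) := by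
    ext t
    simp only [Finset.mem_Ioc, Finset.mem_Ico]
    omega
  rw [h, Finset.sum_Ico_eq_sum_range]
  congr 2
  omega

/-- Kolmogorov's inequality for the partial sums of a block of periods. -/
theorem measure_forwardSum_le (G : ℕ → MeasurableSpace S) (hGle : ∀ t, G t ≤ m0)
    (hGmono : Monotone G) {ξ : ℕ → S → ℝ}
    (hadp : ∀ t, StronglyMeasurable[G (t + 1)] (ξ t)) (hL2 : ∀ t, MemLp (ξ t) 2 P)
    (hmds : ∀ t, P[ξ t | G t] =ᵐ[P] 0) (a n : ℕ) {x : ℝ} (hx : 0 < x) :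
    P {s | ∃ j ≤ n, x ≤ |∑ t ∈ Finset.Ioc a (a + j), ξ t s|} ≤
      ENNReal.ofReal ((∑ t ∈ Finset.Ioc a (a + n), ∫ s, ξ t s ^ 2 ∂P) / x ^ 2) := by
  let F : Filtration ℕ m0 :=
    ⟨fun n => G (a + 1 + n), fun i j hij => hGmono (by omega), fun n => hGle _⟩
  have h := measure_partialSum_le (P := P) F (ξ := fun n => ξ (a + 1 + n))
    (fun n => hadp _) (fun n => hL2 _) (fun n => hmds _) n hx
  simp_rw [sum_Ioc_add_eq_sum_range]
  exact h

/-- Kolmogorov's inequality for the sums over the final segments of a block of periods. -/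
theorem measure_backwardSum_le (G : ℕ → MeasurableSpace S) (hGle : ∀ t, G t ≤ m0)
    (hGmono : Monotone G) {ξ : ℕ → S → ℝ}
    (hadp : ∀ t, StronglyMeasurable[G (t + 1)] (ξ t)) (hL2 : ∀ t, MemLp (ξ t) 2 P)
    (hmds : ∀ t, P[ξ t | G t] =ᵐ[P] 0) (b n : ℕ) (hn : n ≤ b) {x : ℝ} (hx : 0 < x) :
    P {s | ∃ j ≤ n, x ≤ |∑ t ∈ Finset.Ioc (b - j) b, ξ t s|} ≤
      ENNReal.ofReal (4 * (∑ t ∈ Finset.Ioc (b - n) b, ∫ s, ξ t s ^ 2 ∂P) / x ^ 2) := by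
  have h := measure_forwardSum_le (P := P) G hGle hGmono hadp hL2 hmds (b - n) n (half_pos hx)
  rw [Nat.sub_add_cancel hn] at h
  have heq : (∑ t ∈ Finset.Ioc (b - n) b, ∫ s, ξ t s ^ 2 ∂P) / (x / 2) ^ 2
      = 4 * (∑ t ∈ Finset.Ioc (b - n) b, ∫ s, ξ t s ^ 2 ∂P) / x ^ 2 := by
    field_simp
    ring
  rw [heq] at h
  refine (measure_mono ?_).trans h
  rintro s ⟨j, hj, hxj⟩
  have hsplit : ∑ t ∈ Finset.Ioc (b - n) (b - j), ξ t s + ∑ t ∈ Finset.Ioc (b - j) b, ξ t s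
      = ∑ t ∈ Finset.Ioc (b - n) b, ξ t s :=
    Finset.sum_Ioc_consecutive _ (by omega) (by omega)
  -- A final segment is the whole block minus an initial segment, so one of these two sums reaches
  -- `x / 2`. Halving the level costs the factor 4.
  by_cases hfull : x / 2 ≤ |∑ t ∈ Finset.Ioc (b - n) b, ξ t s|
  · exact ⟨n, le_rfl, by rwa [Nat.sub_add_cancel hn]⟩
  · refine ⟨n - j, Nat.sub_le _ _, ?_⟩
    have hnj : b - n + (n - j) = b - j := by omega
    rw [hnj]
    push Not at hfull
    have h1 := abs_sub_abs_le_abs_sub (∑ t ∈ Finset.Ioc (b - j) b, ξ t s)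
      (∑ t ∈ Finset.Ioc (b - n) b, ξ t s)
    rw [← hsplit, sub_add_cancel_right, abs_neg, hsplit] at h1
    linarith

end Maximal

/-- A weighted maximal inequality from maximal inequalities over blocks, by summation over dyadic
blocks. -/
theorem measure_weighted_max_le {S : Type*} [MeasurableSpace S] (P : Measure S) {ν : ℝ}
    (hν : 0 < ν) : ∃ C : ℝ, 0 < C ∧ ∀ (U : ℕ → S → ℝ) (N : ℕ) (K : ℝ), 0 ≤ K →
      (∀ n ≤ N, ∀ x : ℝ, 0 < x → P {s | ∃ j ≤ n, x ≤ U j s} ≤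
        ENNReal.ofReal (K * n / x ^ 2)) →
      ∀ m : ℕ, 1 ≤ m → ∀ x : ℝ, 0 < x →
        P {s | ∃ j, m ≤ j ∧ j ≤ N ∧ x * (j : ℝ) ^ (1 / 2 + ν) ≤ U j s} ≤
          ENNReal.ofReal (C * K * (m : ℝ) ^ (-(2 * ν)) / x ^ 2) := by
  have hr0 : (0 : ℝ) ≤ (2 : ℝ) ^ (-(2 * ν)) := by positivity
  have hr1 : (2 : ℝ) ^ (-(2 * ν)) < 1 := Real.rpow_lt_one_of_one_lt_of_neg (by norm_num) (by linarith)
  set r : ℝ := (2 : ℝ) ^ (-(2 * ν)) with hr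
  refine ⟨2 * (1 - r)⁻¹, by have := sub_pos.2 hr1; positivity, ?_⟩
  intro U N K hK hblock m hm x hx
  have hm0 : (0 : ℝ) < m := by exact_mod_cast hm
  -- Dyadic blocks `m 2^i ≤ j < m 2^(i+1)`, with the weight `j^(1/2+ν)` replaced by its value at the
  -- left end.
  have hcover : {s | ∃ j, m ≤ j ∧ j ≤ N ∧ x * (j : ℝ) ^ (1 / 2 + ν) ≤ U j s} ⊆
      ⋃ i : ℕ, {s | ∃ j ≤ min (m * 2 ^ (i + 1)) N,
        x * ((m : ℝ) * 2 ^ i) ^ (1 / 2 + ν) ≤ U j s} := by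
    rintro s ⟨j, hmj, hjN, hU⟩
    have hjm : 1 ≤ j / m := (Nat.one_le_div_iff (by omega)).2 hmj
    refine Set.mem_iUnion.2 ⟨Nat.log 2 (j / m), j, le_min ?_ hjN, le_trans ?_ hU⟩
    · have := Nat.lt_pow_succ_log_self (b := 2) (by norm_num) (j / m)
      rw [Nat.div_lt_iff_lt_mul (by omega)] at this
      rw [mul_comm]
      exact this.le
    · have h1 : 2 ^ Nat.log 2 (j / m) ≤ j / m := Nat.pow_log_le_self 2 (by omega)
      have h2 : m * 2 ^ Nat.log 2 (j / m) ≤ j :=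
        (Nat.mul_le_mul_left m h1).trans (Nat.mul_div_le j m)
      have h3 : (m : ℝ) * 2 ^ Nat.log 2 (j / m) ≤ j := by exact_mod_cast h2
      gcongr
  -- The variance is at most `2 K m 2^i` and the squared level is `x² (m 2^i)^(1+2ν)`; the quotient
  -- decays like `r^i`.
  have hterm : ∀ i : ℕ, P {s | ∃ j ≤ min (m * 2 ^ (i + 1)) N,
        x * ((m : ℝ) * 2 ^ i) ^ (1 / 2 + ν) ≤ U j s} ≤
      ENNReal.ofReal (2 * K * (m : ℝ) ^ (-(2 * ν)) / x ^ 2 * r ^ i) := by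
    intro i
    have hb : (0 : ℝ) < (m : ℝ) * 2 ^ i := by positivity
    refine (hblock _ (min_le_right _ _) _ (by positivity)).trans (ENNReal.ofReal_le_ofReal ?_)
    have hpow : (((m : ℝ) * 2 ^ i) ^ (1 / 2 + ν)) ^ 2
        = ((m : ℝ) * 2 ^ i) * ((m : ℝ) ^ (-(2 * ν)) * r ^ i)⁻¹ := by
      rw [← Real.rpow_natCast (((m : ℝ) * 2 ^ i) ^ (1 / 2 + ν)) 2, ← Real.rpow_mul hb.le]
      have : (1 / 2 + ν) * ((2 : ℕ) : ℝ) = 1 + 2 * ν := by push_cast; ring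
      rw [this, Real.rpow_add hb, Real.rpow_one]
      congr 1
      have hri : r ^ i = ((2 : ℝ) ^ i) ^ (-(2 * ν)) := by
        rw [hr, ← Real.rpow_natCast, ← Real.rpow_natCast, ← Real.rpow_mul (by norm_num),
          ← Real.rpow_mul (by norm_num), mul_comm]
      rw [hri, ← Real.mul_rpow hm0.le (by positivity), Real.rpow_neg hb.le, inv_inv]
    have hmin : ((min (m * 2 ^ (i + 1)) N : ℕ) : ℝ) ≤ 2 * ((m : ℝ) * 2 ^ i) := by
      have : ((min (m * 2 ^ (i + 1)) N : ℕ) : ℝ) ≤ ((m * 2 ^ (i + 1) : ℕ) : ℝ) := by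
        exact_mod_cast min_le_left _ _
      refine this.trans (le_of_eq ?_)
      push_cast
      ring
    rw [mul_pow, hpow]
    have hq : 0 < (m : ℝ) ^ (-(2 * ν)) * r ^ i := by positivity
    calc K * ((min (m * 2 ^ (i + 1)) N : ℕ) : ℝ) /
          (x ^ 2 * (((m : ℝ) * 2 ^ i) * ((m : ℝ) ^ (-(2 * ν)) * r ^ i)⁻¹))
        ≤ K * (2 * ((m : ℝ) * 2 ^ i)) /
          (x ^ 2 * (((m : ℝ) * 2 ^ i) * ((m : ℝ) ^ (-(2 * ν)) * r ^ i)⁻¹)) := by gcongr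
      _ = _ := by
        field_simp
  calc P {s | ∃ j, m ≤ j ∧ j ≤ N ∧ x * (j : ℝ) ^ (1 / 2 + ν) ≤ U j s}
      ≤ ∑' i : ℕ, P {s | ∃ j ≤ min (m * 2 ^ (i + 1)) N,
        x * ((m : ℝ) * 2 ^ i) ^ (1 / 2 + ν) ≤ U j s} :=
        (measure_mono hcover).trans (measure_iUnion_le _)
    _ ≤ ∑' i : ℕ, ENNReal.ofReal (2 * K * (m : ℝ) ^ (-(2 * ν)) / x ^ 2 * r ^ i) :=
        ENNReal.tsum_le_tsum hterm
    _ = ENNReal.ofReal (∑' i : ℕ, 2 * K * (m : ℝ) ^ (-(2 * ν)) / x ^ 2 * r ^ i) := by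
        rw [ENNReal.ofReal_tsum_of_nonneg]
        · intro i; positivity
        · exact (summable_geometric_of_lt_one hr0 hr1).mul_left _
    _ = _ := by
        rw [tsum_mul_left, tsum_geometric_of_lt_one hr0 hr1]
        congr 1
        ring

/-! ### Elementary inequalities for dot products -/

section DotProduct

variable {ι : Type*} [Fintype ι]

theorem dotProduct_self_nonneg' (v : ι → ℝ) : 0 ≤ v ⬝ᵥ v :=
  Finset.sum_nonneg fun i _ => mul_self_nonneg (v i)

theorem dotProduct_sq_le (u v : ι → ℝ) : (u ⬝ᵥ v) ^ 2 ≤ (u ⬝ᵥ u) * (v ⬝ᵥ v) := by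
  have h := Finset.sum_mul_sq_le_sq_mul_sq Finset.univ u v
  simpa only [dotProduct, sq] using h

theorem dotProduct_self_add_le (u v : ι → ℝ) :
    (u + v) ⬝ᵥ (u + v) ≤ 2 * (u ⬝ᵥ u) + 2 * (v ⬝ᵥ v) := by
  have h := dotProduct_self_nonneg' (u - v)
  simp only [add_dotProduct, dotProduct_add, sub_dotProduct, dotProduct_sub] at h ⊢
  linarith [dotProduct_comm u v]

theorem dotProduct_self_sub_le (u v : ι → ℝ) :
    (u - v) ⬝ᵥ (u - v) ≤ 2 * (u ⬝ᵥ u) + 2 * (v ⬝ᵥ v) := by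
  have h := dotProduct_self_nonneg' (u + v)
  simp only [add_dotProduct, dotProduct_add, sub_dotProduct, dotProduct_sub] at h ⊢
  linarith [dotProduct_comm u v]

theorem dotProduct_mulVec_transpose {κ : Type*} [Fintype κ] (A : Matrix ι κ ℝ) (u : κ → ℝ)
    (v : ι → ℝ) : u ⬝ᵥ (Aᵀ *ᵥ v) = (A *ᵥ u) ⬝ᵥ v := by
  rw [mulVec_transpose, dotProduct_comm, ← dotProduct_mulVec, dotProduct_comm]

end DotProduct

/-! ### Least squares -/

section LeastSquares

variable {T p q : ℕ} (X : Matrix (Fin T) (Fin p) ℝ) (R : Matrix (Fin p) (Fin q) ℝ)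

/-- The least squares coefficient `(X'X)⁻¹ X'g`. -/
noncomputable def coef (g : Fin T → ℝ) : Fin p → ℝ := (Xᵀ * X)⁻¹ *ᵥ (Xᵀ *ᵥ g)

theorem annihilator_mulVec (g : Fin T → ℝ) :
    annihilator X *ᵥ g = g - X *ᵥ coef X g := by
  simp only [annihilator, coef, sub_mulVec, one_mulVec, mulVec_mulVec, Matrix.mul_assoc]

theorem annihilator_transpose : (annihilator X)ᵀ = annihilator X := by
  simp only [annihilator, transpose_sub, transpose_one, transpose_mul, transpose_transpose,
    transpose_nonsing_inv, Matrix.mul_assoc]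

theorem coef_sub (g h : Fin T → ℝ) : coef X (g - h) = coef X g - coef X h := by
  simp only [coef, mulVec_sub]

variable {X} (hX : IsUnit (Xᵀ * X).det)

include hX

theorem annihilator_mul_self : annihilator X * X = 0 := by
  rw [annihilator, Matrix.sub_mul, Matrix.one_mul, Matrix.mul_assoc, Matrix.mul_assoc,
    nonsing_inv_mul _ hX, Matrix.mul_one, sub_self]

theorem annihilator_mul_annihilator : annihilator X * annihilator X = annihilator X := by
  conv_lhs => enter [2]; rw [annihilator]
  rw [Matrix.mul_sub, Matrix.mul_one, ← Matrix.mul_assoc, ← Matrix.mul_assoc, annihilator_mul_self hX]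
  simp

theorem annihilator_dotProduct (g h : Fin T → ℝ) :
    (annihilator X *ᵥ g) ⬝ᵥ (annihilator X *ᵥ h) = g ⬝ᵥ (annihilator X *ᵥ h) := by
  conv_lhs => rw [← dotProduct_mulVec_transpose, annihilator_transpose, mulVec_mulVec,
    annihilator_mul_annihilator hX]

theorem annihilator_mulVec_mulVec (w : Fin p → ℝ) : annihilator X *ᵥ (X *ᵥ w) = 0 := by
  rw [mulVec_mulVec, annihilator_mul_self hX, zero_mulVec]

theorem fitted_dotProduct_fitted (g : Fin T → ℝ) :
    (X *ᵥ coef X g) ⬝ᵥ (X *ᵥ coef X g) = coef X g ⬝ᵥ (Xᵀ *ᵥ g) := by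
  rw [← dotProduct_mulVec_transpose, mulVec_mulVec]
  conv_lhs => enter [2, 2]; rw [coef]
  rw [mulVec_mulVec, mul_nonsing_inv _ hX, one_mulVec]

theorem dotProduct_self_eq_annihilator_add_fitted (g : Fin T → ℝ) :
    g ⬝ᵥ g = (annihilator X *ᵥ g) ⬝ᵥ (annihilator X *ᵥ g) +
      (X *ᵥ coef X g) ⬝ᵥ (X *ᵥ coef X g) := by
  rw [annihilator_dotProduct hX, fitted_dotProduct_fitted hX, dotProduct_mulVec_transpose,
    annihilator_mulVec, dotProduct_sub, dotProduct_comm (X *ᵥ coef X g) g]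
  ring

theorem annihilator_dotProduct_self_le (g : Fin T → ℝ) :
    (annihilator X *ᵥ g) ⬝ᵥ (annihilator X *ᵥ g) ≤ g ⬝ᵥ g := by
  rw [dotProduct_self_eq_annihilator_add_fitted hX g]
  linarith [dotProduct_self_nonneg' (X *ᵥ coef X g)]

theorem fitted_dotProduct_self_le (g : Fin T → ℝ) :
    (X *ᵥ coef X g) ⬝ᵥ (X *ᵥ coef X g) ≤ g ⬝ᵥ g := by
  conv_rhs => rw [dotProduct_self_eq_annihilator_add_fitted hX g]
  linarith [dotProduct_self_nonneg' (annihilator X *ᵥ g)]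

theorem ZMZ_bilin (k l : ℕ) (u v : Fin q → ℝ) :
    u ⬝ᵥ (ZMZ X R k l *ᵥ v) =
      (annihilator X *ᵥ (Zmat X R k *ᵥ u)) ⬝ᵥ (annihilator X *ᵥ (Zmat X R l *ᵥ v)) := by
  rw [annihilator_dotProduct hX, ← dotProduct_mulVec_transpose]
  simp only [ZMZ, mulVec_mulVec, Matrix.mul_assoc]

theorem quad_ZMZ (k : ℕ) (u : Fin q → ℝ) :
    quad (ZMZ X R k k) u =
      (annihilator X *ᵥ (Zmat X R k *ᵥ u)) ⬝ᵥ (annihilator X *ᵥ (Zmat X R k *ᵥ u)) :=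
  ZMZ_bilin R hX k k u u

theorem quad_ZMZ_nonneg (k : ℕ) (u : Fin q → ℝ) : 0 ≤ quad (ZMZ X R k k) u := by
  rw [quad_ZMZ R hX]
  exact dotProduct_self_nonneg' _

end LeastSquares

/-! ### The square root of `Z_k'MZ_k` and the projection onto the columns of `M Z_k`. -/

section Root

variable {T p q : ℕ} {X : Matrix (Fin T) (Fin p) ℝ} (R : Matrix (Fin p) (Fin q) ℝ)

theorem ZMZ_posSemidef (hX : IsUnit (Xᵀ * X).det) (k : ℕ) : (ZMZ X R k k).PosSemidef := by
  have h : ZMZ X R k k = (annihilator X * Zmat X R k)ᴴ * (annihilator X * Zmat X R k) := by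
    rw [conjTranspose_eq_transpose_of_trivial, transpose_mul, annihilator_transpose,
      Matrix.mul_assoc, ← Matrix.mul_assoc (annihilator X), annihilator_mul_annihilator hX,
      ← Matrix.mul_assoc]
    rfl
  rw [h]
  exact posSemidef_conjTranspose_mul_self _

variable (hX : IsUnit (Xᵀ * X).det) (k : ℕ)

include hX

theorem rootZMZ_mul_self : rootZMZ X R k * rootZMZ X R k = ZMZ X R k k :=
  CFC.sqrt_mul_sqrt_self _ (ZMZ_posSemidef R hX k).nonneg

omit hX in
theorem rootZMZ_transpose : (rootZMZ X R k)ᵀ = rootZMZ X R k := by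
  have h : (rootZMZ X R k).IsHermitian :=
    (Matrix.nonneg_iff_posSemidef.1 (CFC.sqrt_nonneg (ZMZ X R k k))).1
  rw [← conjTranspose_eq_transpose_of_trivial]
  exact h

theorem quad_one_rootZMZ (c : Fin q → ℝ) :
    quad 1 (rootZMZ X R k *ᵥ c) = quad (ZMZ X R k k) c := by
  rw [quad, one_mulVec, ← dotProduct_mulVec_transpose, rootZMZ_transpose, mulVec_mulVec,
    rootZMZ_mul_self R hX, quad]

variable (hk : IsUnit (ZMZ X R k k).det)

include hk

theorem isUnit_det_rootZMZ : IsUnit (rootZMZ X R k).det := by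
  rw [← rootZMZ_mul_self R hX, det_mul] at hk
  exact isUnit_of_mul_isUnit_left hk

theorem rootZMZ_mulVec_inv (z : Fin q → ℝ) :
    rootZMZ X R k *ᵥ ((ZMZ X R k k)⁻¹ *ᵥ z) = (rootZMZ X R k)⁻¹ *ᵥ z := by
  rw [mulVec_mulVec, ← rootZMZ_mul_self R hX, Matrix.mul_inv_rev, ← Matrix.mul_assoc,
    mul_nonsing_inv _ (isUnit_det_rootZMZ R hX k hk), Matrix.one_mul]

theorem rootZMZ_inv_dotProduct_self (z : Fin q → ℝ) :
    ((rootZMZ X R k)⁻¹ *ᵥ z) ⬝ᵥ ((rootZMZ X R k)⁻¹ *ᵥ z) =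
      quad (ZMZ X R k k) ((ZMZ X R k k)⁻¹ *ᵥ z) := by
  rw [← rootZMZ_mulVec_inv R hX k hk, ← quad_one_rootZMZ R hX, quad, one_mulVec]

omit hX in
theorem quad_ZMZ_inv (z : Fin q → ℝ) :
    quad (ZMZ X R k k) ((ZMZ X R k k)⁻¹ *ᵥ z) = ((ZMZ X R k k)⁻¹ *ᵥ z) ⬝ᵥ z := by
  rw [quad, mulVec_mulVec, mul_nonsing_inv _ hk, one_mulVec]

omit hk in
-- Duality: a bound on the functional `u ↦ u'z` relative to `A = Z_k'MZ_k`, tested at a solution of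
-- `A u = z`, bounds `z'A⁻¹z`. Noise terms can thus be estimated one direction at a time.
theorem quad_le_of_dotProduct_sq_le {D : ℝ} (hD : 0 ≤ D) {u z : Fin q → ℝ}
    (hu : u ⬝ᵥ z = quad (ZMZ X R k k) u)
    (h : (u ⬝ᵥ z) ^ 2 ≤ D * quad (ZMZ X R k k) u) : quad (ZMZ X R k k) u ≤ D := by
  rw [hu] at h
  have h0 := quad_ZMZ_nonneg R hX k u
  rcases h0.eq_or_lt with h1 | h1
  · rw [← h1]; exact hD
  · rw [sq] at h
    exact le_of_mul_le_mul_right h h1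

theorem rootZMZ_inv_dotProduct_self_le {D : ℝ} (hD : 0 ≤ D) (z : Fin q → ℝ)
    (h : ∀ u, (u ⬝ᵥ z) ^ 2 ≤ D * quad (ZMZ X R k k) u) :
    ((rootZMZ X R k)⁻¹ *ᵥ z) ⬝ᵥ ((rootZMZ X R k)⁻¹ *ᵥ z) ≤ D := by
  rw [rootZMZ_inv_dotProduct_self R hX k hk]
  exact quad_le_of_dotProduct_sq_le R hX k hD (quad_ZMZ_inv R k hk z).symm (h _)

theorem objective_eq (Y : Fin T → ℝ) (W : ℕ → Matrix (Fin q) (Fin q) ℝ) :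
    objective X R Y W k =
      quad (W k) ((rootZMZ X R k)⁻¹ *ᵥ ((Zmat X R k)ᵀ *ᵥ (annihilator X *ᵥ Y))) := by
  rw [objective, deltaHat, rootZMZ_mulVec_inv R hX k hk]

/-- The gap between the two norms is a squared distance. -/
theorem quad_rootZMZ_sub (k₀ : ℕ) (c : Fin q → ℝ) :
    ∃ u : Fin q → ℝ, ∃ w : Fin p → ℝ,
      quad 1 (rootZMZ X R k₀ *ᵥ c) - quad 1 ((rootZMZ X R k)⁻¹ *ᵥ (ZMZ X R k k₀ *ᵥ c)) =
        (Zmat X R k₀ *ᵥ c - Zmat X R k *ᵥ u - X *ᵥ w) ⬝ᵥ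
          (Zmat X R k₀ *ᵥ c - Zmat X R k *ᵥ u - X *ᵥ w) := by
  -- `M Z_k u` is the orthogonal projection of `M Z₀ c` onto the columns of `M Z_k`, and `‖b‖` is
  -- its length; the gap is Pythagoras.
  set u := (ZMZ X R k k)⁻¹ *ᵥ (ZMZ X R k k₀ *ᵥ c) with hu
  refine ⟨u, coef X (Zmat X R k₀ *ᵥ c - Zmat X R k *ᵥ u), ?_⟩
  rw [← annihilator_mulVec, mulVec_sub, sub_dotProduct, dotProduct_sub, dotProduct_sub,
    ← quad_ZMZ R hX, ← quad_ZMZ R hX, dotProduct_comm, ← ZMZ_bilin R hX, quad_one_rootZMZ R hX,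
    show quad 1 ((rootZMZ X R k)⁻¹ *ᵥ (ZMZ X R k k₀ *ᵥ c)) = quad (ZMZ X R k k) u by
      rw [quad, one_mulVec, rootZMZ_inv_dotProduct_self R hX k hk],
    show u ⬝ᵥ (ZMZ X R k k₀ *ᵥ c) = quad (ZMZ X R k k) u from (quad_ZMZ_inv R k hk _).symm]
  ring

end Root

/-! ### Blocks of rows -/

section Blocks

variable {T p q : ℕ}

/-- The rows of the periods `a < t ≤ b`. -/
def blk (T a b : ℕ) : Finset (Fin T) :=
  Finset.univ.filter fun t => a < (t : ℕ) + 1 ∧ (t : ℕ) + 1 ≤ b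

@[simp]
theorem mem_blk {a b : ℕ} {t : Fin T} : t ∈ blk T a b ↔ a < (t : ℕ) + 1 ∧ (t : ℕ) + 1 ≤ b := by
  simp [blk]

theorem blk_univ : blk T 0 T = Finset.univ := by
  ext t
  simp only [mem_blk, Finset.mem_univ, iff_true]
  omega

theorem compl_blk_first (k : ℕ) : (blk T 0 k)ᶜ = blk T k T := by
  ext t
  simp only [Finset.mem_compl, mem_blk]
  omega

theorem compl_blk_last (k : ℕ) : (blk T k T)ᶜ = blk T 0 k := by
  rw [← compl_blk_first, compl_compl]

/-- `v' (∑_{t ∈ I} x_t x_t') v`. -/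
noncomputable def energy (X : Matrix (Fin T) (Fin p) ℝ) (I : Finset (Fin T)) (v : Fin p → ℝ) : ℝ :=
  ∑ t ∈ I, (X t ⬝ᵥ v) ^ 2

/-- `∑_{t ∈ I} e_t x_t`. -/
noncomputable def score (X : Matrix (Fin T) (Fin p) ℝ) (I : Finset (Fin T)) (e : Fin T → ℝ) :
    Fin p → ℝ :=
  ∑ t ∈ I, e t • X t

/-- The vector `g` with the entries outside `I` replaced by zero. -/
noncomputable def masked (I : Finset (Fin T)) (g : Fin T → ℝ) : Fin T → ℝ :=
  fun t => if t ∈ I then g t else 0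

variable (X : Matrix (Fin T) (Fin p) ℝ) (R : Matrix (Fin p) (Fin q) ℝ) (I : Finset (Fin T))

theorem energy_nonneg (v : Fin p → ℝ) : 0 ≤ energy X I v :=
  Finset.sum_nonneg fun _ _ => sq_nonneg _

theorem energy_le_two_mul (v w : Fin p → ℝ) :
    energy X I v ≤ 2 * energy X I (v - w) + 2 * energy X I w := by
  simp only [energy, Finset.mul_sum, ← Finset.sum_add_distrib]
  refine Finset.sum_le_sum fun t _ => ?_
  rw [dotProduct_sub]
  nlinarith [sq_nonneg (X t ⬝ᵥ v - 2 * (X t ⬝ᵥ w))]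

theorem energy_univ (v : Fin p → ℝ) : energy X Finset.univ v = (X *ᵥ v) ⬝ᵥ (X *ᵥ v) := by
  simp only [energy, dotProduct, mulVec, sq]

theorem dotProduct_score (y : Fin p → ℝ) (e : Fin T → ℝ) :
    y ⬝ᵥ score X I e = ∑ t ∈ I, (X t ⬝ᵥ y) * e t := by
  rw [score, dotProduct_sum]
  refine Finset.sum_congr rfl fun t _ => ?_
  rw [dotProduct_smul, smul_eq_mul, dotProduct_comm, mul_comm]

theorem score_univ (e : Fin T → ℝ) : score X Finset.univ e = Xᵀ *ᵥ e := by
  funext i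
  simp [score, mulVec, dotProduct, Finset.sum_apply, mul_comm]

theorem sum_mul_sq_le_energy (y : Fin p → ℝ) (e : Fin T → ℝ) :
    (∑ t ∈ I, (X t ⬝ᵥ y) * e t) ^ 2 ≤ energy X I y * ∑ t ∈ I, e t ^ 2 :=
  Finset.sum_mul_sq_le_sq_mul_sq I _ _

theorem masked_dotProduct (y : Fin p → ℝ) (g : Fin T → ℝ) :
    masked I (X *ᵥ y) ⬝ᵥ g = ∑ t ∈ I, (X t ⬝ᵥ y) * g t := by
  simp [dotProduct, masked, ite_mul, mulVec]

theorem masked_add_compl (g : Fin T → ℝ) : masked I g + masked Iᶜ g = g := by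
  funext t
  by_cases ht : t ∈ I <;> simp [masked, ht]

theorem masked_sub_dotProduct_self (y w : Fin p → ℝ) :
    (masked I (X *ᵥ y) - X *ᵥ w) ⬝ᵥ (masked I (X *ᵥ y) - X *ᵥ w) =
      energy X I (y - w) + energy X Iᶜ w := by
  rw [dotProduct, ← Finset.sum_add_sum_compl I, energy, energy]
  congr 1
  · refine Finset.sum_congr rfl fun t ht => ?_
    simp only [masked, ht, if_true, Pi.sub_apply, mulVec, dotProduct_sub, sq]
  · refine Finset.sum_congr rfl fun t ht => ?_
    rw [Finset.mem_compl] at ht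
    simp only [masked, ht, if_false, Pi.sub_apply, mulVec, sq]
    ring

theorem masked_dotProduct_self (y : Fin p → ℝ) :
    masked I (X *ᵥ y) ⬝ᵥ masked I (X *ᵥ y) = energy X I y := by
  have h := masked_sub_dotProduct_self X I y 0
  simpa [energy] using h

theorem Zmat_mulVec (k : ℕ) (u : Fin q → ℝ) :
    Zmat X R k *ᵥ u = masked (blk T k T) (X *ᵥ (R *ᵥ u)) := by
  rw [Zmat, ← mulVec_mulVec]
  funext t
  simp only [masked, mem_blk, mulVec, after]
  by_cases h : k < (t : ℕ) + 1
  · have h' : k < (t : ℕ) + 1 ∧ (t : ℕ) + 1 ≤ T := ⟨h, t.2⟩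
    simp only [h', and_self, if_true]
    congr 1
    funext i
    rw [Matrix.of_apply, if_pos h]
  · have h' : ¬ (k < (t : ℕ) + 1 ∧ (t : ℕ) + 1 ≤ T) := fun h'' => h h''.1
    simp only [h', if_false]
    simp only [dotProduct, Matrix.of_apply, h, if_false, zero_mul, Finset.sum_const_zero]

theorem sum_sq_add_sum_sq_le {I₁ I₂ : Finset (Fin T)} (hd : Disjoint I₁ I₂) (g : Fin T → ℝ) :
    ∑ t ∈ I₁, g t ^ 2 + ∑ t ∈ I₂, g t ^ 2 ≤ g ⬝ᵥ g := by
  rw [← Finset.sum_union hd, dotProduct]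
  simp only [← sq]
  exact Finset.sum_le_sum_of_subset_of_nonneg (Finset.subset_univ _) fun _ _ _ => sq_nonneg _

variable {X}

/-- The vector `w` is the regression coefficient of the masked vector: the fit errs by `y - w` on
the block and by `w` off it. The bounds derived from this hold for every `w`, so its value is
immaterial. -/
theorem annihilator_masked_dotProduct_self (y : Fin p → ℝ) : ∃ w : Fin p → ℝ,
    (annihilator X *ᵥ masked I (X *ᵥ y)) ⬝ᵥ (annihilator X *ᵥ masked I (X *ᵥ y)) =
      energy X I (y - w) + energy X Iᶜ w :=
  ⟨_, by rw [annihilator_mulVec, masked_sub_dotProduct_self]⟩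

/-- If the complement carries a fixed share of the energy, partialling out `X` cannot remove the
block: `w` cannot be close to `y` and to zero at once. -/
theorem mul_energy_le_annihilator_masked {τ : ℝ} (hτ : 0 ≤ τ) (hτ1 : τ ≤ 1)
    (h : ∀ z, τ * energy X I z ≤ energy X Iᶜ z) (y : Fin p → ℝ) :
    τ / 2 * energy X I y ≤
      (annihilator X *ᵥ masked I (X *ᵥ y)) ⬝ᵥ (annihilator X *ᵥ masked I (X *ᵥ y)) := by
  obtain ⟨w, hw⟩ := annihilator_masked_dotProduct_self (X := X) I y
  rw [hw]
  have h1 := energy_le_two_mul X I y w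
  have h2 := h w
  have h3 := energy_nonneg X I (y - w)
  nlinarith [mul_le_mul_of_nonneg_left h1 hτ, mul_le_mul_of_nonneg_right hτ1 h3]

/-- A bound for the noise projected on the regressors of a block. -/
theorem annihilator_masked_dotProduct_sq_le {τ D : ℝ} (hτ : 0 < τ) (hτ1 : τ ≤ 1) (hD : 0 ≤ D)
    (h : ∀ z, τ * energy X I z ≤ energy X Iᶜ z) (e : Fin T → ℝ) (y : Fin p → ℝ)
    (hs : (y ⬝ᵥ score X I e) ^ 2 ≤ D * energy X I y)
    (hf : (X *ᵥ coef X e) ⬝ᵥ (X *ᵥ coef X e) ≤ D) :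
    ((annihilator X *ᵥ masked I (X *ᵥ y)) ⬝ᵥ e) ^ 2 ≤ 8 * D / τ *
      ((annihilator X *ᵥ masked I (X *ᵥ y)) ⬝ᵥ (annihilator X *ᵥ masked I (X *ᵥ y))) := by
  have hE := mul_energy_le_annihilator_masked (X := X) I hτ.le hτ1 h y
  set E := energy X I y with hEdef
  set N := (annihilator X *ᵥ masked I (X *ᵥ y)) ⬝ᵥ (annihilator X *ᵥ masked I (X *ᵥ y))
  have hE0 : 0 ≤ E := energy_nonneg X I y
  -- Moving `M` onto `e` leaves the raw score of the block minus its inner product with the fitted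
  -- values of the noise.
  have hdec : (annihilator X *ᵥ masked I (X *ᵥ y)) ⬝ᵥ e =
      y ⬝ᵥ score X I e - ∑ t ∈ I, (X t ⬝ᵥ y) * (X *ᵥ coef X e) t := by
    rw [← dotProduct_mulVec_transpose, annihilator_transpose, annihilator_mulVec, dotProduct_sub,
      masked_dotProduct, masked_dotProduct, dotProduct_score]
  have hb : (∑ t ∈ I, (X t ⬝ᵥ y) * (X *ᵥ coef X e) t) ^ 2 ≤ D * E := by
    refine (sum_mul_sq_le_energy X I y _).trans ?_
    rw [mul_comm]
    refine mul_le_mul_of_nonneg_right (le_trans ?_ hf) hE0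
    have := sum_sq_add_sum_sq_le (Finset.disjoint_empty_right I) (X *ᵥ coef X e)
    simpa using this
  rw [hdec]
  have h4 : E ≤ 2 / τ * N := by
    rw [div_mul_eq_mul_div, le_div_iff₀ hτ]
    linarith
  calc (y ⬝ᵥ score X I e - ∑ t ∈ I, (X t ⬝ᵥ y) * (X *ᵥ coef X e) t) ^ 2
      ≤ 2 * (y ⬝ᵥ score X I e) ^ 2 + 2 * (∑ t ∈ I, (X t ⬝ᵥ y) * (X *ᵥ coef X e) t) ^ 2 := by
        nlinarith [sq_nonneg (y ⬝ᵥ score X I e + ∑ t ∈ I, (X t ⬝ᵥ y) * (X *ᵥ coef X e) t)]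
    _ ≤ 4 * D * E := by linarith
    _ ≤ 4 * D * (2 / τ * N) := by gcongr
    _ = 8 * D / τ * N := by ring

/-- For the regressors after `k`, the annihilated block may be replaced by its complement. -/
theorem annihilator_masked_compl (hX : IsUnit (Xᵀ * X).det) (y : Fin p → ℝ) :
    annihilator X *ᵥ masked Iᶜ (X *ᵥ y) = -(annihilator X *ᵥ masked I (X *ᵥ y)) := by
  have h := annihilator_mulVec_mulVec hX y
  rw [← masked_add_compl I (X *ᵥ y), mulVec_add] at h
  exact (neg_eq_of_add_eq_zero_right h).symm

end Blocks

/-! ### Finite-sample bounds -/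

/-- Upper and lower bounds for the second moments of the regressors over the blocks of periods that
start or end at an end of the sample or at the date `k₀`. -/
structure RegularDesign {T p : ℕ} (X : Matrix (Fin T) (Fin p) ℝ) (k₀ J : ℕ) (l B : ℝ) : Prop where
  le_first : ∀ j, J ≤ j → j ≤ T → ∀ v, l * j * (v ⬝ᵥ v) ≤ energy X (blk T 0 j) v
  le_last : ∀ j, J ≤ j → j ≤ T → ∀ v, l * j * (v ⬝ᵥ v) ≤ energy X (blk T (T - j) T) v
  le_before : ∀ j, J ≤ j → j ≤ k₀ → ∀ v, l * j * (v ⬝ᵥ v) ≤ energy X (blk T (k₀ - j) k₀) v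
  le_after : ∀ j, J ≤ j → j ≤ T - k₀ → ∀ v, l * j * (v ⬝ᵥ v) ≤ energy X (blk T k₀ (k₀ + j)) v
  first_le : ∀ j, 1 ≤ j → j ≤ T → ∀ v, energy X (blk T 0 j) v ≤ B * j * (v ⬝ᵥ v)
  last_le : ∀ j, 1 ≤ j → j ≤ T → ∀ v, energy X (blk T (T - j) T) v ≤ B * j * (v ⬝ᵥ v)
  before_le : ∀ j, 1 ≤ j → j ≤ k₀ → ∀ v, energy X (blk T (k₀ - j) k₀) v ≤ B * j * (v ⬝ᵥ v)
  after_le : ∀ j, 1 ≤ j → j ≤ T - k₀ → ∀ v, energy X (blk T k₀ (k₀ + j)) v ≤ B * j * (v ⬝ᵥ v)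

/-- Bounds for the sums of the errors and of the regressors times the errors. -/
structure SmallNoise {T p : ℕ} (X : Matrix (Fin T) (Fin p) ℝ) (e : Fin T → ℝ) (k₀ J m : ℕ)
    (σ d : ℝ) : Prop where
  first : ∀ j, 1 ≤ j → j ≤ T →
    score X (blk T 0 j) e ⬝ᵥ score X (blk T 0 j) e ≤ σ * T * d * j
  last : ∀ j, 1 ≤ j → j ≤ T →
    score X (blk T (T - j) T) e ⬝ᵥ score X (blk T (T - j) T) e ≤ σ * T * d * j
  before : ∀ j, m ≤ j → j ≤ k₀ →
    score X (blk T (k₀ - j) k₀) e ⬝ᵥ score X (blk T (k₀ - j) k₀) e ≤ σ * (j : ℝ) ^ 2 * d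
  after : ∀ j, m ≤ j → j ≤ T - k₀ →
    score X (blk T k₀ (k₀ + j)) e ⬝ᵥ score X (blk T k₀ (k₀ + j)) e ≤ σ * (j : ℝ) ^ 2 * d
  head : ∑ t ∈ blk T 0 J, e t ^ 2 ≤ σ * T * d
  tail : ∑ t ∈ blk T (T - J) T, e t ^ 2 ≤ σ * T * d

/-- The location of the break and the constants of the design bounds. -/
structure Scale (T k₀ J : ℕ) (l B a : ℝ) : Prop where
  l_pos : 0 < l
  l_le_one : l ≤ 1
  one_le_B : 1 ≤ B
  a_pos : 0 < a
  a_le_one : a ≤ 1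
  one_le_J : 1 ≤ J
  two_mul_J_le : 2 * J ≤ T
  J_le : (J : ℝ) ≤ a / 2 * T
  k₀_le : k₀ ≤ T
  le_k₀ : a * T ≤ k₀
  k₀_add_le : a * T + k₀ ≤ T

section FiniteSample

variable {T p q k₀ J m : ℕ} {X : Matrix (Fin T) (Fin p) ℝ} (R : Matrix (Fin p) (Fin q) ℝ)
  {l B a σ d : ℝ} {e : Fin T → ℝ}

theorem Scale.T_pos (hs : Scale T k₀ J l B a) : (0 : ℝ) < T := by
  have h1 := hs.one_le_J
  have h2 := hs.two_mul_J_le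
  have : 0 < T := by omega
  exact_mod_cast this

theorem RegularDesign.le_univ (hs : Scale T k₀ J l B a) (hr : RegularDesign X k₀ J l B)
    (v : Fin p → ℝ) : l * T * (v ⬝ᵥ v) ≤ (X *ᵥ v) ⬝ᵥ (X *ᵥ v) := by
  have h := hr.le_first T (by have := hs.two_mul_J_le; omega) le_rfl v
  rwa [blk_univ, energy_univ] at h

theorem RegularDesign.isUnit_det (hs : Scale T k₀ J l B a) (hr : RegularDesign X k₀ J l B) :
    IsUnit (Xᵀ * X).det := by
  rw [isUnit_iff_ne_zero]
  intro h0
  obtain ⟨v, hv, hXv⟩ := Matrix.exists_mulVec_eq_zero_iff.2 h0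
  have h := hr.le_univ hs v
  rw [← dotProduct_mulVec_transpose, mulVec_mulVec, hXv, dotProduct_zero] at h
  have hlT := mul_pos hs.l_pos hs.T_pos
  have hvv : v ⬝ᵥ v ≤ 0 := by
    by_contra hcon
    push Not at hcon
    linarith [mul_pos hlT hcon]
  exact hv (dotProduct_self_eq_zero.1 (le_antisymm hvv (dotProduct_self_nonneg' v)))

/-- The fitted values of the noise. -/
theorem fitted_noise_le (hs : Scale T k₀ J l B a) (hr : RegularDesign X k₀ J l B)
    (hn : SmallNoise X e k₀ J m σ d) (hD : 0 ≤ σ * T * d) :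
    (X *ᵥ coef X e) ⬝ᵥ (X *ᵥ coef X e) ≤ σ * T * d / l := by
  have hX := hr.isUnit_det hs
  have hT := hs.T_pos
  have hl := hs.l_pos
  have hT1 : 1 ≤ T := by exact_mod_cast hT
  have h1 := hn.first T hT1 le_rfl
  rw [blk_univ, score_univ] at h1
  have h2 := fitted_dotProduct_fitted hX e
  have h3 := dotProduct_sq_le (coef X e) (Xᵀ *ᵥ e)
  have h4 := hr.le_univ hs (coef X e)
  rw [← h2] at h3
  set N := (X *ᵥ coef X e) ⬝ᵥ (X *ᵥ coef X e)
  set w := coef X e ⬝ᵥ coef X e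
  have hN : 0 ≤ N := dotProduct_self_nonneg' _
  have hw : 0 ≤ w := dotProduct_self_nonneg' _
  rcases hN.eq_or_lt with hN0 | hN0
  · rw [← hN0]; positivity
  · rw [le_div_iff₀ hl]
    -- Since `N = coef ⬝ᵥ X'e`, Cauchy–Schwarz gives `N² ≤ w ‖X'e‖²`, and the lower bound `l T w ≤
    -- N` trades `w` for `N`.
    have h5 : N ^ 2 * l ≤ σ * T * d * N := by
      calc N ^ 2 * l ≤ w * (σ * T * d * T) * l := by
            gcongr
            exact h3.trans (mul_le_mul_of_nonneg_left h1 hw)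
        _ = σ * T * d * (l * T * w) := by ring
        _ ≤ σ * T * d * N := mul_le_mul_of_nonneg_left h4 hD
    have : N * (N * l) ≤ N * (σ * T * d) := by linarith
    exact le_of_mul_le_mul_left this hN0

/-- The noise over a block at an end of the sample, in terms of the energy of the block. -/
theorem score_end_le {I I' : Finset (Fin T)} {j : ℕ} (hl : 0 < l) (hl1 : l ≤ 1)
    (hD : 0 ≤ σ * T * d) (hsub : j < J → I ⊆ I')
    (hle : J ≤ j → ∀ v, l * j * (v ⬝ᵥ v) ≤ energy X I v)
    (hsc : score X I e ⬝ᵥ score X I e ≤ σ * T * d * j)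
    (hI' : ∑ t ∈ I', e t ^ 2 ≤ σ * T * d) (y : Fin p → ℝ) :
    (y ⬝ᵥ score X I e) ^ 2 ≤ σ * T * d / l * energy X I y := by
  have hE := energy_nonneg X I y
  -- No eigenvalue bound is available for blocks shorter than `J`. There Cauchy–Schwarz against the
  -- squared errors of at most `J` periods replaces it.
  rcases lt_or_ge j J with hj | hj
  · rw [dotProduct_score]
    refine (sum_mul_sq_le_energy X I y e).trans ?_
    have h1 : ∑ t ∈ I, e t ^ 2 ≤ σ * T * d :=
      (Finset.sum_le_sum_of_subset_of_nonneg (hsub hj) fun _ _ _ => sq_nonneg _).trans hI'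
    have h2 : σ * T * d ≤ σ * T * d / l := by
      rw [le_div_iff₀ hl]
      exact mul_le_of_le_one_right hD hl1
    rw [mul_comm]
    exact mul_le_mul_of_nonneg_right (h1.trans h2) hE
  · calc (y ⬝ᵥ score X I e) ^ 2 ≤ (y ⬝ᵥ y) * (score X I e ⬝ᵥ score X I e) := dotProduct_sq_le _ _
      _ ≤ (y ⬝ᵥ y) * (σ * T * d * j) := mul_le_mul_of_nonneg_left hsc (dotProduct_self_nonneg' y)
      _ = σ * T * d / l * (l * j * (y ⬝ᵥ y)) := by field_simp
      _ ≤ _ := mul_le_mul_of_nonneg_left (hle hj y) (by positivity)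

/-- The noise at any date, relative to `Z_k'MZ_k`. -/
theorem noise_sq_le (hs : Scale T k₀ J l B a) (hr : RegularDesign X k₀ J l B)
    (hn : SmallNoise X e k₀ J m σ d) (hD : 0 ≤ σ * T * d) {k : ℕ} (hk1 : 1 ≤ k) (hkT : k < T)
    (v : Fin q → ℝ) :
    ((annihilator X *ᵥ (Zmat X R k *ᵥ v)) ⬝ᵥ e) ^ 2 ≤
      8 * B / l ^ 2 * (σ * T * d) * quad (ZMZ X R k k) v := by
  have hX := hr.isUnit_det hs
  have hl := hs.l_pos
  have hB : 0 < B := lt_of_lt_of_le one_pos hs.one_le_B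
  have hJ := hs.two_mul_J_le
  have hf := fitted_noise_le hs hr hn hD
  -- `l / B` is the energy ratio of a longer block at one end of the sample to the shorter block at
  -- the other end.
  have hτ : 0 < l / B := by positivity
  have hτ1 : l / B ≤ 1 := by
    rw [div_le_one hB]
    exact hs.l_le_one.trans hs.one_le_B
  have hDl : 0 ≤ σ * T * d / l := by positivity
  have hconst : 8 * (σ * T * d / l) / (l / B) = 8 * B / l ^ 2 * (σ * T * d) := by
    field_simp
  have hrel : ∀ {I : Finset (Fin T)} {i j : ℕ}, (i : ℝ) ≤ j →
      (∀ v, energy X I v ≤ B * i * (v ⬝ᵥ v)) → (∀ v, l * j * (v ⬝ᵥ v) ≤ energy X Iᶜ v) →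
      ∀ z, l / B * energy X I z ≤ energy X Iᶜ z := by
    intro I i j hij h1 h2 z
    calc l / B * energy X I z ≤ l / B * (B * i * (z ⬝ᵥ z)) := by gcongr; exact h1 z
      _ = l * i * (z ⬝ᵥ z) := by field_simp
      _ ≤ l * j * (z ⬝ᵥ z) := by
        have := dotProduct_self_nonneg' z
        gcongr
      _ ≤ _ := h2 z
  have hlast : blk T k T = blk T (T - (T - k)) T := by congr 1; omega
  rw [quad_ZMZ R hX, Zmat_mulVec, ← hconst]
  -- The shorter of the two blocks is used: for `2k ≤ T` the periods up to `k` replace those after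
  -- `k`, which only changes a sign after applying `M`.
  rcases le_or_gt (2 * k) T with hk | hk
  · have h := annihilator_masked_dotProduct_sq_le (X := X) (blk T 0 k) hτ hτ1 hDl
      (hrel (i := k) (j := T - k) (by exact_mod_cast (by omega : k ≤ T - k))
        (hr.first_le k hk1 hkT.le)
        (by rw [compl_blk_first, hlast]; exact hr.le_last (T - k) (by omega) (by omega)))
      e (R *ᵥ v)
      (score_end_le (I' := blk T 0 J) (j := k) hl hs.l_le_one hD
        (fun hkJ t ht => by rw [mem_blk] at ht ⊢; omega)
        (fun hkJ => hr.le_first k hkJ hkT.le) (hn.first k hk1 hkT.le) hn.head _) hf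
    rw [← compl_blk_first, annihilator_masked_compl _ hX]
    simpa only [neg_dotProduct, dotProduct_neg, neg_neg, neg_sq] using h
  · have hsub : T - k < J → blk T k T ⊆ blk T (T - J) T := by
      intro hkJ t ht
      rw [mem_blk] at ht ⊢
      omega
    refine annihilator_masked_dotProduct_sq_le (X := X) (blk T k T) hτ hτ1 hDl
      (hrel (i := T - k) (j := k) (by exact_mod_cast (by omega : T - k ≤ k))
        (by rw [hlast]; exact hr.last_le (T - k) (by omega) (by omega))
        (by rw [compl_blk_last]; exact hr.le_first k (by omega) hkT.le))
      e (R *ᵥ v)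
      (score_end_le (I' := blk T (T - J) T) (j := T - k) hl hs.l_le_one hD hsub
        (fun hkJ => by rw [hlast]; exact hr.le_last (T - k) hkJ (by omega))
        (by rw [hlast]; exact hn.last (T - k) (by omega) (by omega)) hn.tail _) hf

/-- Dates in the interior of the sample. -/
theorem le_quad_ZMZ (hs : Scale T k₀ J l B a) (hr : RegularDesign X k₀ J l B) {k : ℕ}
    (hkT : k ≤ T) (hk : a / 2 * T ≤ k) (hk' : a / 2 * T + k ≤ T) (v : Fin q → ℝ) :
    l * a / 4 * T * ((R *ᵥ v) ⬝ᵥ (R *ᵥ v)) ≤ quad (ZMZ X R k k) v := by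
  have hX := hr.isUnit_det hs
  have hl := hs.l_pos
  have hTk : ((T - k : ℕ) : ℝ) = T - k := Nat.cast_sub hkT
  have hJk : J ≤ k := by exact_mod_cast hs.J_le.trans hk
  have hJk' : J ≤ T - k := by
    have : (J : ℝ) ≤ ((T - k : ℕ) : ℝ) := by rw [hTk]; linarith [hs.J_le]
    exact_mod_cast this
  -- Both sides of `k` contain at least `a T / 2` periods, and `R v` is the sum of the errors `R v -
  -- w` and `w` on the two sides.
  obtain ⟨w, hw⟩ := annihilator_masked_dotProduct_self (X := X) (blk T k T) (R *ᵥ v)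
  rw [quad_ZMZ R hX, Zmat_mulVec, hw, compl_blk_last]
  have h1 := hr.le_first k hJk hkT w
  have h2 := hr.le_last (T - k) hJk' (Nat.sub_le _ _) (R *ᵥ v - w)
  rw [show T - (T - k) = k by omega, hTk] at h2
  have h3 := dotProduct_self_add_le (R *ᵥ v - w) w
  rw [sub_add_cancel] at h3
  have n1 := dotProduct_self_nonneg' w
  have n2 := dotProduct_self_nonneg' (R *ᵥ v - w)
  have h4 : l * (a / 2 * T) * (w ⬝ᵥ w) ≤ l * k * (w ⬝ᵥ w) := by gcongr
  have h5 : l * (a / 2 * T) * ((R *ᵥ v - w) ⬝ᵥ (R *ᵥ v - w)) ≤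
      l * (T - k) * ((R *ᵥ v - w) ⬝ᵥ (R *ᵥ v - w)) := by gcongr; linarith
  have h6 : 0 ≤ l * a / 4 * T := by have := hs.a_pos; positivity
  nlinarith [mul_le_mul_of_nonneg_left h3 h6]

/-- The squared distance between the breaks at `k₀` and at `k`. -/
theorem le_break_distance (hs : Scale T k₀ J l B a) (hr : RegularDesign X k₀ J l B) {k h : ℕ}
    (hkT : k < T) (hJh : J ≤ h) (hk : k + h = k₀ ∨ k₀ + h = k) (c u : Fin q → ℝ)
    (w : Fin p → ℝ) :
    l * a / 2 * h * ((R *ᵥ c) ⬝ᵥ (R *ᵥ c)) ≤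
      (Zmat X R k₀ *ᵥ c - Zmat X R k *ᵥ u - X *ᵥ w) ⬝ᵥ
        (Zmat X R k₀ *ᵥ c - Zmat X R k *ᵥ u - X *ᵥ w) := by
  have hl := hs.l_pos
  have ha := hs.a_pos
  have ha1 := hs.a_le_one
  have hT := hs.T_pos
  have hJa : (J : ℝ) ≤ a * T := by
    have := hs.J_le
    nlinarith [mul_pos ha hT]
  have hk₀ := hs.k₀_le
  have hTk₀ : ((T - k₀ : ℕ) : ℝ) = T - k₀ := Nat.cast_sub hk₀
  have hJk₀ : J ≤ k₀ := by exact_mod_cast hJa.trans hs.le_k₀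
  have hJk₀' : J ≤ T - k₀ := by
    have : (J : ℝ) ≤ ((T - k₀ : ℕ) : ℝ) := by rw [hTk₀]; linarith [hs.k₀_add_le]
    exact_mod_cast this
  have hhT : (h : ℝ) ≤ T := by exact_mod_cast (by omega : h ≤ T)
  have haT : a * h ≤ a * T := by gcongr
  have hah : a * h ≤ h := mul_le_of_le_one_left (by positivity) ha1
  -- The residual follows one coefficient vector on the `h` periods between the dates and another on
  -- the far side of `k₀`. Up to sign they add to `R c`, so they cannot both be small. The far side
  -- has at least `a T ≥ a h` periods.
  have key : ∀ (i : ℝ) (y z : Fin p → ℝ) {E₁ E₂ : ℝ}, a * h ≤ i → y + z = R *ᵥ c →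
      l * h * (y ⬝ᵥ y) ≤ E₁ → l * i * (z ⬝ᵥ z) ≤ E₂ →
      l * a / 2 * h * ((R *ᵥ c) ⬝ᵥ (R *ᵥ c)) ≤ E₁ + E₂ := by
    intro i y z E₁ E₂ hi hyz h1 h2
    have h3 := dotProduct_self_add_le y z
    rw [hyz] at h3
    have n1 := dotProduct_self_nonneg' y
    have n2 := dotProduct_self_nonneg' z
    have h4 : l * (a * h) * (y ⬝ᵥ y) ≤ l * h * (y ⬝ᵥ y) := by gcongr
    have h5 : l * (a * h) * (z ⬝ᵥ z) ≤ l * i * (z ⬝ᵥ z) := by gcongr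
    have h6 : 0 ≤ l * a / 2 * h := by positivity
    nlinarith [mul_le_mul_of_nonneg_left h3 h6]
  rw [Zmat_mulVec, Zmat_mulVec]
  rcases hk with hk | hk
  -- For `k < k₀` the residual is `-x_t'(R u + w)` between the dates and `x_t'(R c - R u - w)` after
  -- `k₀`.
  · have hd : Disjoint (blk T k k₀) (blk T k₀ T) := by
      rw [Finset.disjoint_left]
      intro t h1 h2
      rw [mem_blk] at h1 h2
      omega
    refine le_trans ?_ (sum_sq_add_sum_sq_le hd _)
    have h1 := hr.le_before h hJh (by omega) (R *ᵥ u + w)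
    have h2 := hr.le_after (T - k₀) hJk₀' le_rfl (R *ᵥ c - R *ᵥ u - w)
    rw [show k₀ - h = k by omega] at h1
    rw [show k₀ + (T - k₀) = T by omega, hTk₀] at h2
    refine key _ _ _ (by linarith [hs.k₀_add_le]) (by abel) (h1.trans (le_of_eq ?_))
      (h2.trans (le_of_eq ?_))
    · refine Finset.sum_congr rfl fun t ht => ?_
      rw [mem_blk] at ht
      have m1 : t ∉ blk T k₀ T := by rw [mem_blk]; omega
      have m2 : t ∈ blk T k T := by rw [mem_blk]; omega
      simp only [Pi.sub_apply, masked, m1, m2, if_true, if_false, mulVec, dotProduct_add]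
      ring
    · refine Finset.sum_congr rfl fun t ht => ?_
      have m2 : t ∈ blk T k T := by rw [mem_blk] at ht ⊢; omega
      simp only [Pi.sub_apply, masked, ht, m2, if_true, mulVec, dotProduct_sub]
  -- For `k > k₀` the residual is `x_t'(R c - w)` between the dates and `-x_t'w` up to `k₀`.
  · have hd : Disjoint (blk T k₀ k) (blk T 0 k₀) := by
      rw [Finset.disjoint_left]
      intro t h1 h2
      rw [mem_blk] at h1 h2
      omega
    refine le_trans ?_ (sum_sq_add_sum_sq_le hd _)
    have h1 := hr.le_after h hJh (by omega) (R *ᵥ c - w)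
    have h2 := hr.le_before k₀ hJk₀ le_rfl w
    rw [hk] at h1
    rw [Nat.sub_self] at h2
    refine key _ _ _ (by linarith [hs.le_k₀]) (by abel) (h1.trans (le_of_eq ?_))
      (h2.trans (le_of_eq ?_))
    · refine Finset.sum_congr rfl fun t ht => ?_
      rw [mem_blk] at ht
      have m1 : t ∈ blk T k₀ T := by rw [mem_blk]; omega
      have m2 : t ∉ blk T k T := by rw [mem_blk]; omega
      simp only [Pi.sub_apply, masked, m1, m2, if_true, if_false, mulVec, dotProduct_sub]
      ring
    · refine Finset.sum_congr rfl fun t ht => ?_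
      rw [mem_blk] at ht
      have m1 : t ∉ blk T k₀ T := by rw [mem_blk]; omega
      have m2 : t ∉ blk T k T := by rw [mem_blk]; omega
      simp only [Pi.sub_apply, masked, m1, m2, if_false, mulVec]
      ring

end FiniteSample

/-- Young's inequality for the cross term, from `quad W (θ b - f) ≥ 0`. The free `θ` is needed
because `b` is much larger than both `f` and the gain. -/
theorem quad_add_le {q : ℕ} {W : Matrix (Fin q) (Fin q) ℝ} (hW : ∀ v, 0 ≤ quad W v) {θ : ℝ}
    (hθ : 0 < θ) (b f : Fin q → ℝ) :
    quad W (b + f) ≤ quad W b + θ * quad W b + (1 + θ⁻¹) * quad W f := by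
  have h := hW (θ • b - f)
  have h1 : quad W (θ • b - f) =
      θ ^ 2 * quad W b - θ * (b ⬝ᵥ (W *ᵥ f) + f ⬝ᵥ (W *ᵥ b)) + quad W f := by
    simp only [quad, mulVec_sub, mulVec_smul, sub_dotProduct, dotProduct_sub, smul_dotProduct,
      dotProduct_smul, smul_eq_mul]
    ring
  have h2 : quad W (b + f) = quad W b + (b ⬝ᵥ (W *ᵥ f) + f ⬝ᵥ (W *ᵥ b)) + quad W f := by
    simp only [quad, mulVec_add, add_dotProduct, dotProduct_add]
    ring
  rw [h1] at h
  have h3 : b ⬝ᵥ (W *ᵥ f) + f ⬝ᵥ (W *ᵥ b) ≤ θ * quad W b + θ⁻¹ * quad W f := by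
    refine le_of_mul_le_mul_left ?_ hθ
    have : θ * (θ * quad W b + θ⁻¹ * quad W f) = θ ^ 2 * quad W b + quad W f := by
      field_simp
    rw [this]
    linarith
  rw [h2]
  linarith

/-! ### The estimation error at `k₀` and the residual noise at other dates. -/

section FiniteSample

variable {T p q k₀ J m : ℕ} {X : Matrix (Fin T) (Fin p) ℝ} (R : Matrix (Fin p) (Fin q) ℝ)
  {l B a σ d : ℝ} {e : Fin T → ℝ}

theorem Scale.one_le_k₀ (hs : Scale T k₀ J l B a) : 1 ≤ k₀ := by
  have h := (mul_pos hs.a_pos hs.T_pos).trans_le hs.le_k₀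
  exact_mod_cast h

theorem Scale.k₀_lt (hs : Scale T k₀ J l B a) : k₀ < T := by
  have h : (k₀ : ℝ) < T := by linarith [mul_pos hs.a_pos hs.T_pos, hs.k₀_add_le]
  exact_mod_cast h

theorem le_quad_ZMZ_break (hs : Scale T k₀ J l B a) (hr : RegularDesign X k₀ J l B)
    (v : Fin q → ℝ) :
    l * a / 4 * T * ((R *ᵥ v) ⬝ᵥ (R *ᵥ v)) ≤ quad (ZMZ X R k₀ k₀) v := by
  have h := mul_pos hs.a_pos hs.T_pos
  exact le_quad_ZMZ R hs hr hs.k₀_le (by linarith [hs.le_k₀]) (by linarith [hs.k₀_add_le]) v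

theorem isUnit_det_ZMZ_break (hs : Scale T k₀ J l B a) (hr : RegularDesign X k₀ J l B) {r : ℝ}
    (hr0 : 0 < r) (hR : ∀ v, r * (v ⬝ᵥ v) ≤ (R *ᵥ v) ⬝ᵥ (R *ᵥ v)) :
    IsUnit (ZMZ X R k₀ k₀).det := by
  rw [isUnit_iff_ne_zero]
  intro h0
  obtain ⟨v, hv, hXv⟩ := Matrix.exists_mulVec_eq_zero_iff.2 h0
  have h := le_quad_ZMZ_break R hs hr v
  rw [quad, hXv, dotProduct_zero] at h
  have hc : 0 < l * a / 4 * T := by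
    have := hs.l_pos
    have := hs.a_pos
    have := hs.T_pos
    positivity
  have hvv : v ⬝ᵥ v ≤ 0 := by
    by_contra hcon
    push Not at hcon
    have h1 := (mul_pos hr0 hcon).trans_le (hR v)
    linarith [mul_pos hc h1]
  exact hv (dotProduct_self_eq_zero.1 (le_antisymm hvv (dotProduct_self_nonneg' v)))

theorem Zmat_break_dotProduct_self_le (hs : Scale T k₀ J l B a) (hr : RegularDesign X k₀ J l B)
    (c : Fin q → ℝ) :
    (Zmat X R k₀ *ᵥ c) ⬝ᵥ (Zmat X R k₀ *ᵥ c) ≤ B * T * ((R *ᵥ c) ⬝ᵥ (R *ᵥ c)) := by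
  have hB := hs.one_le_B
  have hlt := hs.k₀_lt
  rw [Zmat_mulVec, masked_dotProduct_self]
  have h := hr.after_le (T - k₀) (by omega) le_rfl (R *ᵥ c)
  rw [show k₀ + (T - k₀) = T by omega] at h
  refine h.trans ?_
  have h1 : ((T - k₀ : ℕ) : ℝ) ≤ T := by exact_mod_cast Nat.sub_le _ _
  have := dotProduct_self_nonneg' (R *ᵥ c)
  gcongr

/-- The estimation error of the break magnitude at the true date. -/
theorem quad_break_error_le (hs : Scale T k₀ J l B a) (hr : RegularDesign X k₀ J l B)
    (hn : SmallNoise X e k₀ J m σ d) (hD : 0 ≤ σ * T * d) {u : Fin q → ℝ}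
    (hu : ZMZ X R k₀ k₀ *ᵥ u = (Zmat X R k₀)ᵀ *ᵥ (annihilator X *ᵥ e)) :
    quad (ZMZ X R k₀ k₀) u ≤ 8 * B / l ^ 2 * (σ * T * d) := by
  have hX := hr.isUnit_det hs
  have hB := hs.one_le_B
  have hl := hs.l_pos
  have hC : 0 ≤ 8 * B / l ^ 2 * (σ * T * d) := mul_nonneg (by positivity) hD
  refine quad_le_of_dotProduct_sq_le R hX k₀ hC
    (z := (Zmat X R k₀)ᵀ *ᵥ (annihilator X *ᵥ e)) (by rw [quad, hu]) ?_
  have h := noise_sq_le R hs hr hn hD hs.one_le_k₀ hs.k₀_lt u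
  rwa [← dotProduct_mulVec_transpose, annihilator_transpose, ← dotProduct_mulVec_transpose] at h

/-- The noise bound `8 B / l² · σ T d` is divided by the curvature `l a T / 4` of `Z_0'MZ_0`; the
factor `T` cancels. -/
theorem break_error_le (hs : Scale T k₀ J l B a) (hr : RegularDesign X k₀ J l B)
    (hn : SmallNoise X e k₀ J m σ d) (hσd : 0 ≤ σ * d) {u : Fin q → ℝ}
    (hu : ZMZ X R k₀ k₀ *ᵥ u = (Zmat X R k₀)ᵀ *ᵥ (annihilator X *ᵥ e)) :
    (R *ᵥ u) ⬝ᵥ (R *ᵥ u) ≤ 32 * B / (l ^ 3 * a) * (σ * d) := by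
  have hT := hs.T_pos
  have hl := hs.l_pos
  have ha := hs.a_pos
  have hD : 0 ≤ σ * T * d := by
    have := mul_nonneg hσd hT.le
    linarith
  have h1 := (le_quad_ZMZ_break R hs hr u).trans (quad_break_error_le R hs hr hn hD hu)
  have hc : 0 < l * a / 4 * T := by positivity
  refine le_of_mul_le_mul_left (h1.trans (le_of_eq ?_)) hc
  field_simp
  ring

/-- The regression coefficients of the residual noise. -/
theorem coef_residual_le (hs : Scale T k₀ J l B a) (hr : RegularDesign X k₀ J l B)
    (hn : SmallNoise X e k₀ J m σ d) (hσd : 0 ≤ σ * d) (u : Fin q → ℝ) :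
    coef X (e - Zmat X R k₀ *ᵥ u) ⬝ᵥ coef X (e - Zmat X R k₀ *ᵥ u) ≤
      2 / l ^ 2 * (σ * d) + 2 * B / l * ((R *ᵥ u) ⬝ᵥ (R *ᵥ u)) := by
  have hT := hs.T_pos
  have hl := hs.l_pos
  have hX := hr.isUnit_det hs
  have hlT : 0 < l * T := by positivity
  have hD : 0 ≤ σ * T * d := by
    have := mul_nonneg hσd hT.le
    linarith
  have h1 := (hr.le_univ hs (coef X e)).trans (fitted_noise_le hs hr hn hD)
  have h2 := ((hr.le_univ hs (coef X (Zmat X R k₀ *ᵥ u))).trans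
    (fitted_dotProduct_self_le hX _)).trans (Zmat_break_dotProduct_self_le R hs hr u)
  have h3 : coef X e ⬝ᵥ coef X e ≤ 1 / l ^ 2 * (σ * d) := by
    refine le_of_mul_le_mul_left (h1.trans (le_of_eq ?_)) hlT
    field_simp
  have h4 : coef X (Zmat X R k₀ *ᵥ u) ⬝ᵥ coef X (Zmat X R k₀ *ᵥ u) ≤
      B / l * ((R *ᵥ u) ⬝ᵥ (R *ᵥ u)) := by
    refine le_of_mul_le_mul_left (h2.trans (le_of_eq ?_)) hlT
    field_simp
  rw [coef_sub]
  refine (dotProduct_self_sub_le _ _).trans ?_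
  calc _ ≤ 2 * (1 / l ^ 2 * (σ * d)) + 2 * (B / l * ((R *ᵥ u) ⬝ᵥ (R *ᵥ u))) := by gcongr
    _ = _ := by ring

/-- The residual noise, summed over the block between `k₀` and `k`. -/
theorem residual_block_le {I : Finset (Fin T)} {h : ℕ} {N : ℝ}
    (hE : ∀ v, energy X I v ≤ B * h * (v ⬝ᵥ v))
    (hsc : score X I e ⬝ᵥ score X I e ≤ σ * (h : ℝ) ^ 2 * d) {y : Fin p → ℝ} (hy : y ⬝ᵥ y ≤ N)
    (hB : 0 ≤ B) {g : Fin T → ℝ} (hg : ∀ t ∈ I, g t = e t - X t ⬝ᵥ y) (v : Fin p → ℝ) :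
    (∑ t ∈ I, (X t ⬝ᵥ v) * g t) ^ 2 ≤
      (2 * (σ * d) + 2 * B ^ 2 * N) * (h : ℝ) ^ 2 * (v ⬝ᵥ v) := by
  have hvv := dotProduct_self_nonneg' v
  have h0 : ∑ t ∈ I, (X t ⬝ᵥ v) * g t =
      v ⬝ᵥ score X I e - ∑ t ∈ I, (X t ⬝ᵥ v) * (X t ⬝ᵥ y) := by
    rw [dotProduct_score, ← Finset.sum_sub_distrib]
    exact Finset.sum_congr rfl fun t ht => by rw [hg t ht]; ring
  have h1 : (v ⬝ᵥ score X I e) ^ 2 ≤ (v ⬝ᵥ v) * (σ * (h : ℝ) ^ 2 * d) :=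
    (dotProduct_sq_le _ _).trans (mul_le_mul_of_nonneg_left hsc hvv)
  have h2 : (∑ t ∈ I, (X t ⬝ᵥ v) * (X t ⬝ᵥ y)) ^ 2 ≤ (B * h * (v ⬝ᵥ v)) * (B * h * N) := by
    refine (Finset.sum_mul_sq_le_sq_mul_sq I _ _).trans ?_
    refine mul_le_mul (hE v) ((hE y).trans ?_) (energy_nonneg X I y) (by positivity)
    gcongr
  rw [h0]
  nlinarith [sq_nonneg (v ⬝ᵥ score X I e + ∑ t ∈ I, (X t ⬝ᵥ v) * (X t ⬝ᵥ y))]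

/-- The effect of the noise on the criterion at `k`, once the part that is due to the estimation
error at the true date is taken out. -/
theorem residual_noise_sq_le (hs : Scale T k₀ J l B a) (hr : RegularDesign X k₀ J l B)
    (hn : SmallNoise X e k₀ J m σ d) (hσd : 0 ≤ σ * d) {u : Fin q → ℝ}
    (hu : ZMZ X R k₀ k₀ *ᵥ u = (Zmat X R k₀)ᵀ *ᵥ (annihilator X *ᵥ e)) {k h : ℕ}
    (hk1 : 1 ≤ k) (hkT : k < T) (hmh : m ≤ h) (hh : 1 ≤ h) (hk : k + h = k₀ ∨ k₀ + h = k)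
    (v : Fin q → ℝ) :
    (v ⬝ᵥ ((Zmat X R k)ᵀ *ᵥ (annihilator X *ᵥ (e - Zmat X R k₀ *ᵥ u)))) ^ 2 ≤
      ((2 + 2 * B ^ 2 * (4 / l ^ 2 + (4 * B / l + 2) * (32 * B / (l ^ 3 * a)))) * (4 / (l * a)) +
        128 * B / (l ^ 2 * a ^ 2)) * (σ * d) * ((h : ℝ) ^ 2 / T) * quad (ZMZ X R k k) v := by
  have hT := hs.T_pos
  have hl := hs.l_pos
  have ha := hs.a_pos
  have hB : 0 < B := lt_of_lt_of_le one_pos hs.one_le_B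
  have hX := hr.isUnit_det hs
  have hk₀T := hs.k₀_lt
  have hD : 0 ≤ σ * T * d := by
    have := mul_nonneg hσd hT.le
    linarith
  set Q := quad (ZMZ X R k k) v with hQ
  have hQ0 : 0 ≤ Q := quad_ZMZ_nonneg R hX k v
  set A := (2 + 2 * B ^ 2 * (4 / l ^ 2 + (4 * B / l + 2) * (32 * B / (l ^ 3 * a)))) *
    (4 / (l * a)) with hA
  have hA0 : 0 ≤ A := by positivity
  have hF0 : 0 ≤ 128 * B / (l ^ 2 * a ^ 2) := by positivity
  -- For interior dates `Z_k'MZ_k` is of order `T` and the block sums are used; otherwise `h ≥ a T /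
  -- 2`.
  by_cases hfar : a / 2 * T ≤ k ∧ a / 2 * T + k ≤ T
  · have hquad := le_quad_ZMZ R hs hr hkT.le hfar.1 hfar.2 v
    rw [← hQ] at hquad
    set n := (R *ᵥ v) ⬝ᵥ (R *ᵥ v) with hnn
    set N := (4 / l ^ 2 + (4 * B / l + 2) * (32 * B / (l ^ 3 * a))) * (σ * d) with hN
    have hnu := break_error_le R hs hr hn hσd hu
    have hw := coef_residual_le R hs hr hn hσd u
    set w := coef X (e - Zmat X R k₀ *ᵥ u) with hwdef
    have hnu0 := dotProduct_self_nonneg' (R *ᵥ u)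
    have hw0 := dotProduct_self_nonneg' w
    have hNle : 2 * (w ⬝ᵥ w) + 2 * ((R *ᵥ u) ⬝ᵥ (R *ᵥ u)) ≤ N := by
      calc 2 * (w ⬝ᵥ w) + 2 * ((R *ᵥ u) ⬝ᵥ (R *ᵥ u))
          ≤ 2 * (2 / l ^ 2 * (σ * d) + 2 * B / l * ((R *ᵥ u) ⬝ᵥ (R *ᵥ u))) +
            2 * ((R *ᵥ u) ⬝ᵥ (R *ᵥ u)) := by gcongr
        _ = 4 / l ^ 2 * (σ * d) + (4 * B / l + 2) * ((R *ᵥ u) ⬝ᵥ (R *ᵥ u)) := by ring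
        _ ≤ 4 / l ^ 2 * (σ * d) + (4 * B / l + 2) * (32 * B / (l ^ 3 * a) * (σ * d)) := by
          gcongr
        _ = N := by rw [hN]; ring
    have hN1 : (w + R *ᵥ u) ⬝ᵥ (w + R *ᵥ u) ≤ N := (dotProduct_self_add_le _ _).trans hNle
    have hN2 : w ⬝ᵥ w ≤ N := by linarith
    set g := annihilator X *ᵥ (e - Zmat X R k₀ *ᵥ u) with hg
    have hgt : ∀ t, g t = e t - masked (blk T k₀ T) (X *ᵥ (R *ᵥ u)) t - X t ⬝ᵥ w := by
      intro t
      rw [hg, annihilator_mulVec, Zmat_mulVec, ← Zmat_mulVec, ← hwdef, Zmat_mulVec]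
      rfl
    -- The normal equations at `k₀`: the residual `g` is orthogonal to the columns of `Z₀`.
    have horth : masked (blk T k₀ T) (X *ᵥ (R *ᵥ v)) ⬝ᵥ g = 0 := by
      rw [← Zmat_mulVec, ← dotProduct_mulVec_transpose, hg, mulVec_sub, mulVec_sub, ← hu]
      simp only [ZMZ, mulVec_mulVec, Matrix.mul_assoc, sub_self, dotProduct_zero]
    have hbound : (v ⬝ᵥ ((Zmat X R k)ᵀ *ᵥ g)) ^ 2 ≤
        (2 * (σ * d) + 2 * B ^ 2 * N) * (h : ℝ) ^ 2 * n := by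
      rw [dotProduct_mulVec_transpose, Zmat_mulVec, masked_dotProduct]
      rw [masked_dotProduct] at horth
      rcases hk with hk | hk
      -- By `horth` the periods after `k₀` drop out. On the remaining block the break is inactive
      -- and `g_t = e_t - x_t'w`.
      · have hsplit : ∑ t ∈ blk T k T, (X t ⬝ᵥ (R *ᵥ v)) * g t =
            ∑ t ∈ blk T k k₀, (X t ⬝ᵥ (R *ᵥ v)) * g t +
              ∑ t ∈ blk T k₀ T, (X t ⬝ᵥ (R *ᵥ v)) * g t := by
          rw [← Finset.sum_union]
          · congr 1
            ext t
            simp only [Finset.mem_union, mem_blk]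
            omega
          · rw [Finset.disjoint_left]
            intro t h1 h2
            rw [mem_blk] at h1 h2
            omega
        have hblk : blk T k k₀ = blk T (k₀ - h) k₀ := by congr 1; omega
        rw [hsplit, horth, add_zero, hblk]
        refine residual_block_le (hr.before_le h hh (by omega)) (hn.before h hmh (by omega)) hN2
          hB.le (fun t ht => ?_) _
        have m1 : t ∉ blk T k₀ T := by rw [mem_blk] at ht ⊢; omega
        rw [hgt]
        simp [masked, m1]
      -- By `horth` the sum after `k` is minus the sum over `(k₀, k]`, where `g_t = e_t - x_t'(w + R
      -- u)`.
      · have hsplit : ∑ t ∈ blk T k₀ T, (X t ⬝ᵥ (R *ᵥ v)) * g t =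
            ∑ t ∈ blk T k₀ k, (X t ⬝ᵥ (R *ᵥ v)) * g t +
              ∑ t ∈ blk T k T, (X t ⬝ᵥ (R *ᵥ v)) * g t := by
          rw [← Finset.sum_union]
          · congr 1
            ext t
            simp only [Finset.mem_union, mem_blk]
            omega
          · rw [Finset.disjoint_left]
            intro t h1 h2
            rw [mem_blk] at h1 h2
            omega
        have hneg : ∑ t ∈ blk T k T, (X t ⬝ᵥ (R *ᵥ v)) * g t =
            -∑ t ∈ blk T k₀ (k₀ + h), (X t ⬝ᵥ (R *ᵥ v)) * g t := by
          rw [hk]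
          linarith
        rw [hneg, neg_sq]
        refine residual_block_le (hr.after_le h hh (by omega)) (hn.after h hmh (by omega)) hN1
          hB.le (fun t ht => ?_) _
        have m1 : t ∈ blk T k₀ T := by rw [mem_blk] at ht ⊢; omega
        rw [hgt]
        simp only [masked, m1, if_true, mulVec, dotProduct_add]
        ring
    refine hbound.trans ?_
    have hc : 0 < l * a / 4 * T := by positivity
    have hn' : n ≤ 4 / (l * a) * (Q / T) := by
      refine le_of_mul_le_mul_left (hquad.trans (le_of_eq ?_)) hc
      field_simp
    have hN0 : 0 ≤ N := hw0.trans hN2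
    calc (2 * (σ * d) + 2 * B ^ 2 * N) * (h : ℝ) ^ 2 * n
        ≤ (2 * (σ * d) + 2 * B ^ 2 * N) * (h : ℝ) ^ 2 * (4 / (l * a) * (Q / T)) := by gcongr
      _ = A * (σ * d) * ((h : ℝ) ^ 2 / T) * Q := by rw [hN, hA]; ring
      _ ≤ (A + 128 * B / (l ^ 2 * a ^ 2)) * (σ * d) * ((h : ℝ) ^ 2 / T) * Q := by
        gcongr
        linarith
  -- Here `k` is close to an end of the sample. Then `T` is at most `4 / a²` times `h² / T`, so the
  -- bounds of order `σ d T` are of the required form.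
  · have hhT : a / 2 * T ≤ h := by
      have h1 := hs.le_k₀
      have h2 := hs.k₀_add_le
      have haT := mul_pos ha hT
      by_contra hcon
      push Not at hcon
      refine hfar ?_
      rcases hk with hk | hk
      · have hk' : (k : ℝ) + h = k₀ := by exact_mod_cast hk
        have hh0 : (0 : ℝ) ≤ h := by positivity
        constructor <;> linarith
      · have hk' : (k₀ : ℝ) + h = k := by exact_mod_cast hk
        have hh0 : (0 : ℝ) ≤ h := by positivity
        constructor <;> linarith
    have h1 := noise_sq_le R hs hr hn hD hk1 hkT v
    have h2 := quad_break_error_le R hs hr hn hD hu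
    rw [← hQ] at h1
    set mk := annihilator X *ᵥ (Zmat X R k *ᵥ v) with hmk
    have h3 : v ⬝ᵥ ((Zmat X R k)ᵀ *ᵥ (annihilator X *ᵥ (e - Zmat X R k₀ *ᵥ u))) =
        mk ⬝ᵥ e - mk ⬝ᵥ (annihilator X *ᵥ (Zmat X R k₀ *ᵥ u)) := by
      rw [dotProduct_mulVec_transpose, mulVec_sub, dotProduct_sub, hmk,
        annihilator_dotProduct hX, ← dotProduct_mulVec_transpose (annihilator X),
        annihilator_transpose]
    have h4 : (mk ⬝ᵥ (annihilator X *ᵥ (Zmat X R k₀ *ᵥ u))) ^ 2 ≤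
        8 * B / l ^ 2 * (σ * T * d) * Q := by
      refine (dotProduct_sq_le _ _).trans ?_
      rw [hmk, ← quad_ZMZ R hX, ← quad_ZMZ R hX, ← hQ, mul_comm]
      gcongr
    rw [h3]
    have h5 : (mk ⬝ᵥ e - mk ⬝ᵥ (annihilator X *ᵥ (Zmat X R k₀ *ᵥ u))) ^ 2 ≤
        32 * B / l ^ 2 * (σ * d * T) * Q := by
      have := sq_nonneg (mk ⬝ᵥ e + mk ⬝ᵥ (annihilator X *ᵥ (Zmat X R k₀ *ᵥ u)))
      have e1 : 32 * B / l ^ 2 * (σ * d * T) * Q = 4 * (8 * B / l ^ 2 * (σ * T * d) * Q) := by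
        ring
      rw [e1]
      nlinarith
    refine h5.trans ?_
    have h6 : (T : ℝ) ≤ 4 / a ^ 2 * ((h : ℝ) ^ 2 / T) := by
      rw [div_mul_div_comm, le_div_iff₀ (by positivity)]
      have : (a / 2 * T) ^ 2 ≤ (h : ℝ) ^ 2 := by gcongr
      nlinarith
    calc 32 * B / l ^ 2 * (σ * d * T) * Q
        ≤ 32 * B / l ^ 2 * (σ * d * (4 / a ^ 2 * ((h : ℝ) ^ 2 / T))) * Q := by gcongr
      _ = 128 * B / (l ^ 2 * a ^ 2) * (σ * d) * ((h : ℝ) ^ 2 / T) * Q := by ring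
      _ ≤ (A + 128 * B / (l ^ 2 * a ^ 2)) * (σ * d) * ((h : ℝ) ^ 2 / T) * Q := by
        gcongr
        linarith

end FiniteSample

set_option maxHeartbeats 1000000 in
/-- On a regular design with small noise, the criterion at a date far from the break is below its
value at the break. -/
theorem objective_lt_of_regular {l B a r κ K : ℝ} (hr0 : 0 < r) (hκ : 0 < κ) (hK : 0 < K)
    (hl : 0 < l) (ha : 0 < a) (hB : 1 ≤ B) : ∃ σ : ℝ, 0 < σ ∧
    ∀ {T p q k₀ J m : ℕ} {X : Matrix (Fin T) (Fin p) ℝ} (R : Matrix (Fin p) (Fin q) ℝ)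
      {e : Fin T → ℝ} (β : Fin p → ℝ) (dl : Fin q → ℝ) (Y : Fin T → ℝ)
      (W : ℕ → Matrix (Fin q) (Fin q) ℝ),
      (∀ v, r * (v ⬝ᵥ v) ≤ (R *ᵥ v) ⬝ᵥ (R *ᵥ v)) →
      Scale T k₀ J l B a → RegularDesign X k₀ J l B → SmallNoise X e k₀ J m σ (dl ⬝ᵥ dl) →
      0 < dl ⬝ᵥ dl → J ≤ m → Y = X *ᵥ β + Zmat X R k₀ *ᵥ dl + e →
      (∀ k, 1 ≤ k → k < T → ∀ v, 0 ≤ quad (W k) v ∧ quad (W k) v ≤ K * (v ⬝ᵥ v)) →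
      ∀ k h : ℕ, Admissible X R k → NormIneq X R W k₀ κ k → m ≤ h →
        (k + h = k₀ ∨ k₀ + h = k) → objective X R Y W k < objective X R Y W k₀ := by
  have hB0 : 0 < B := by linarith
  set C := (2 + 2 * B ^ 2 * (4 / l ^ 2 + (4 * B / l + 2) * (32 * B / (l ^ 3 * a)))) *
    (4 / (l * a)) + 128 * B / (l ^ 2 * a ^ 2) with hC
  have hC0 : 0 < C := by positivity
  set E := 32 * B / (l ^ 3 * a) with hE
  have hE0 : 0 < E := by positivity
  -- With `θ = τ h / T`, the bound `K B T n` on the weighted square of `b` costs exactly `κ l a h n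
  -- / 8`.
  set τ := κ * l * a / (8 * K * B) with hτ
  have hτ0 : 0 < τ := by positivity
  -- The first entry keeps the estimated break comparable to the true one (`r d ≤ 4 n`). The second
  -- makes the weighted noise cost at most `κ l a h n / 8`. The two costs together are half the
  -- guaranteed gain `κ l a h n / 2`.
  set σ := min (r / (4 * E)) (κ * l * a * r / (32 * K * C * (1 + τ⁻¹))) with hσ
  have hσ0 : 0 < σ := by rw [hσ]; positivity
  have hσE : 4 * (E * σ) ≤ r := by
    have h := min_le_left (r / (4 * E)) (κ * l * a * r / (32 * K * C * (1 + τ⁻¹)))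
    rw [← hσ, le_div_iff₀ (by positivity)] at h
    linarith
  have hσC : 4 * K * C * (1 + τ⁻¹) * σ ≤ κ * l * a / 8 * r := by
    have h := min_le_right (r / (4 * E)) (κ * l * a * r / (32 * K * C * (1 + τ⁻¹)))
    rw [← hσ, le_div_iff₀ (by positivity)] at h
    linarith
  refine ⟨σ, hσ0, ?_⟩
  intro T p q k₀ J m X R e β dl Y W hR hs hr hn hd hJm hY hW k h hk hineq hmh hkh
  obtain ⟨hk1, hkT, hdet⟩ := hk
  have hX := hr.isUnit_det hs
  have hdet₀ := isUnit_det_ZMZ_break R hs hr hr0 hR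
  have hT := hs.T_pos
  set d := dl ⬝ᵥ dl with hddef
  have hσd : 0 ≤ σ * d := by positivity
  have hh : 1 ≤ h := hs.one_le_J.trans (hJm.trans hmh)
  have hh0 : (0 : ℝ) < h := by exact_mod_cast hh
  have hhT : (h : ℝ) ≤ T := by
    have := hs.k₀_le
    exact_mod_cast (by omega : h ≤ T)
  -- The expansion is around the estimate at `k₀`, so that the criterion there equals the signal
  -- term exactly.
  set c := deltaHat X R Y k₀ with hc
  set u := c - dl with hu
  have hMY : annihilator X *ᵥ Y =
      annihilator X *ᵥ (Zmat X R k₀ *ᵥ dl) + annihilator X *ᵥ e := by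
    rw [hY, mulVec_add, mulVec_add, annihilator_mulVec_mulVec hX, zero_add]
  have hu' : ZMZ X R k₀ k₀ *ᵥ u = (Zmat X R k₀)ᵀ *ᵥ (annihilator X *ᵥ e) := by
    rw [hu, mulVec_sub, hc, deltaHat, mulVec_mulVec, mul_nonsing_inv _ hdet₀, one_mulVec, hMY,
      mulVec_add, sub_eq_iff_eq_add, add_comm]
    congr 1
    simp only [ZMZ, mulVec_mulVec, Matrix.mul_assoc]
  have hz : (Zmat X R k)ᵀ *ᵥ (annihilator X *ᵥ Y) = ZMZ X R k k₀ *ᵥ c +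
      (Zmat X R k)ᵀ *ᵥ (annihilator X *ᵥ (e - Zmat X R k₀ *ᵥ u)) := by
    have h1 : ZMZ X R k k₀ *ᵥ c = (Zmat X R k)ᵀ *ᵥ (annihilator X *ᵥ (Zmat X R k₀ *ᵥ c)) := by
      simp only [ZMZ, mulVec_mulVec, Matrix.mul_assoc]
    rw [h1, ← mulVec_add, ← mulVec_add, hMY, hu, mulVec_sub (Zmat X R k₀), ← mulVec_add]
    congr 2
    abel
  set z := (Zmat X R k)ᵀ *ᵥ (annihilator X *ᵥ (e - Zmat X R k₀ *ᵥ u)) with hzdef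
  set b := (rootZMZ X R k)⁻¹ *ᵥ (ZMZ X R k k₀ *ᵥ c) with hb
  set f := (rootZMZ X R k)⁻¹ *ᵥ z with hf
  have hobj : objective X R Y W k = quad (W k) (b + f) := by
    rw [objective_eq R hX k hdet, hz, mulVec_add]
  have hobj₀ : objective X R Y W k₀ = quad (W k₀) (rootZMZ X R k₀ *ᵥ c) := rfl
  set n := (R *ᵥ c) ⬝ᵥ (R *ᵥ c) with hn'
  -- the size of the estimated break
  have hdn : r * d ≤ 4 * n := by
    have h1 := break_error_le R hs hr hn hσd hu'
    have h2 := dotProduct_self_sub_le (R *ᵥ c) (R *ᵥ u)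
    rw [← mulVec_sub, show c - u = dl by rw [hu]; abel] at h2
    have h3 := hR dl
    have h4 := mul_le_mul_of_nonneg_right hσE hd.le
    rw [← hE] at h1
    nlinarith
  have hn0 : 0 < n := by nlinarith [mul_pos hr0 hd]
  -- the squared norm of the noise term
  have hff : f ⬝ᵥ f ≤ C * (σ * d) * ((h : ℝ) ^ 2 / T) :=
    rootZMZ_inv_dotProduct_self_le R hX k hdet (by positivity) z fun v =>
      residual_noise_sq_le R hs hr hn hσd hu' hk1 hkT hmh hh hkh v
  have hff' : f ⬝ᵥ f ≤ 4 * C * (σ / r) * n * ((h : ℝ) ^ 2 / T) := by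
    refine hff.trans ?_
    have h1 : d ≤ 4 * n / r := by
      rw [le_div_iff₀ hr0]
      linarith
    calc C * (σ * d) * ((h : ℝ) ^ 2 / T) ≤ C * (σ * (4 * n / r)) * ((h : ℝ) ^ 2 / T) := by gcongr
      _ = _ := by ring
  -- the norms of the signal
  obtain ⟨u₁, w₁, hgap⟩ := quad_rootZMZ_sub R hX k hdet k₀ c
  have hgap' := le_break_distance R hs hr hkT (hJm.trans hmh) hkh c u₁ w₁
  rw [← hgap, ← hb, ← hn'] at hgap'
  have hroot : quad 1 (rootZMZ X R k₀ *ᵥ c) ≤ B * T * n := by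
    rw [quad_one_rootZMZ R hX, quad_ZMZ R hX]
    exact (annihilator_dotProduct_self_le hX _).trans (Zmat_break_dotProduct_self_le R hs hr c)
  have hbb : b ⬝ᵥ b ≤ B * T * n := by
    have h1 : quad 1 b = b ⬝ᵥ b := by rw [quad, one_mulVec]
    have h2 : 0 ≤ l * a / 2 * h * n := by positivity
    rw [← h1]
    linarith
  have hineq' := hineq c
  rw [← hb] at hineq'
  have hθ : 0 < τ * h / T := by positivity
  have hadd := quad_add_le (fun v => (hW k hk1 hkT v).1) hθ b f
  have hWb := (hW k hk1 hkT b).2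
  have hWf := (hW k hk1 hkT f).2
  have h1 : τ * h / T * quad (W k) b ≤ κ * l * a / 8 * h * n := by
    calc τ * h / T * quad (W k) b ≤ τ * h / T * (K * (B * T * n)) := by
          gcongr
          exact hWb.trans (by gcongr)
      _ = κ * l * a / 8 * h * n := by
          rw [hτ]
          field_simp
  have h2 : (1 + (τ * h / T)⁻¹) * quad (W k) f ≤ κ * l * a / 8 * h * n := by
    have h3 : 1 + (τ * h / T)⁻¹ ≤ (1 + τ⁻¹) * (T / h) := by
      have h4 : (1 : ℝ) ≤ T / h := by rwa [one_le_div hh0]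
      have h5 : (τ * h / T)⁻¹ = τ⁻¹ * (T / h) := by field_simp
      rw [h5]
      linarith
    calc (1 + (τ * h / T)⁻¹) * quad (W k) f
        ≤ (1 + τ⁻¹) * (T / h) * (K * (4 * C * (σ / r) * n * ((h : ℝ) ^ 2 / T))) := by
          gcongr
          · exact (hW k hk1 hkT f).1
          · exact hWf.trans (by gcongr)
      _ = 4 * K * C * (1 + τ⁻¹) * σ / r * (h * n) := by
          field_simp
      _ ≤ κ * l * a / 8 * r / r * (h * n) := by gcongr
      _ = κ * l * a / 8 * h * n := by
          field_simp
  have h3 := mul_le_mul_of_nonneg_left hgap' hκ.le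
  have h4 : 0 < κ * l * a * h * n := by positivity
  rw [hobj, hobj₀]
  nlinarith

/-! ### Spectra, operator norms and second moment matrices -/

theorem dotProduct_self_eq_norm_sq {n : ℕ} (v : EuclideanSpace ℝ (Fin n)) :
    v.ofLp ⬝ᵥ v.ofLp = ‖v‖ ^ 2 := by
  rw [EuclideanSpace.real_norm_sq_eq]
  simp only [dotProduct, sq]

theorem quad_le_norm_mul {n : ℕ} (W : Matrix (Fin n) (Fin n) ℝ) (v : Fin n → ℝ) :
    quad W v ≤ ‖W‖ * (v ⬝ᵥ v) := by
  have h1 := l2_opNorm_mulVec W (WithLp.toLp 2 v)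
  have h2 := real_inner_le_norm (WithLp.toLp 2 v : EuclideanSpace ℝ (Fin n))
    (toEuclideanCLM (𝕜 := ℝ) W (WithLp.toLp 2 v))
  rw [inner_toEuclideanCLM] at h2
  have h3 : ‖toEuclideanCLM (𝕜 := ℝ) W (WithLp.toLp 2 v)‖ ≤
      ‖W‖ * ‖(WithLp.toLp 2 v : EuclideanSpace ℝ (Fin n))‖ := h1
  have h4 := dotProduct_self_eq_norm_sq (WithLp.toLp 2 v : EuclideanSpace ℝ (Fin n))
  change v ⬝ᵥ v = _ at h4
  calc quad W v ≤ _ := h2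
    _ ≤ ‖(WithLp.toLp 2 v : EuclideanSpace ℝ (Fin n))‖ *
        (‖W‖ * ‖(WithLp.toLp 2 v : EuclideanSpace ℝ (Fin n))‖) := by gcongr
    _ = ‖W‖ * (v ⬝ᵥ v) := by rw [h4]; ring

theorem le_quad_of_le_spectrum {n : ℕ} {G : Matrix (Fin n) (Fin n) ℝ} (hG : G.IsHermitian) {l : ℝ}
    (h : ∀ e ∈ spectrum ℝ G, l ≤ e) (v : Fin n → ℝ) : l * (v ⬝ᵥ v) ≤ quad G v := by
  have h1 : algebraMap ℝ _ l ≤ G := (algebraMap_le_iff_le_spectrum (R := ℝ) (a := G) hG).2 h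
  have h2 := (Matrix.le_iff.1 h1).dotProduct_mulVec_nonneg v
  rw [star_trivial, sub_mulVec, dotProduct_sub, Algebra.algebraMap_eq_smul_one, smul_mulVec,
    one_mulVec, dotProduct_smul, smul_eq_mul] at h2
  rw [quad]
  linarith

theorem quad_nonneg_of_posDef {n : ℕ} {W : Matrix (Fin n) (Fin n) ℝ} (hW : W.PosDef)
    (v : Fin n → ℝ) : 0 ≤ quad W v := by
  have h := hW.posSemidef.dotProduct_mulVec_nonneg v
  rwa [star_trivial] at h

theorem sum_blk_eq_sum_Ioc {M : Type*} [AddCommMonoid M] {T a b : ℕ} (hb : b ≤ T) (F : ℕ → M) :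
    ∑ t ∈ blk T a b, F ((t : ℕ) + 1) = ∑ t ∈ Finset.Ioc a b, F t := by
  refine Finset.sum_bij' (fun t _ => (t : ℕ) + 1)
    (fun t ht => ⟨t - 1, by rw [Finset.mem_Ioc] at ht; omega⟩) ?_ ?_ ?_ ?_ ?_
  · intro t ht
    rw [mem_blk] at ht
    exact Finset.mem_Ioc.2 ⟨ht.1, ht.2⟩
  · intro t ht
    rw [Finset.mem_Ioc] at ht
    rw [mem_blk]
    constructor <;> dsimp only <;> omega
  · intro t _
    ext
    simp
  · intro t ht
    rw [Finset.mem_Ioc] at ht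
    dsimp only
    omega
  · intro t _
    rfl

/-! ### Second moment matrices as block energies. -/

section Gram

variable {S : Type*} {p : ℕ} (x : ℕ → ℕ → S → Fin p → ℝ) (T a j : ℕ) (s : S)

theorem energy_design {T a b : ℕ} (hb : b ≤ T) (v : Fin p → ℝ) :
    energy (design x T s) (blk T a b) v = ∑ t ∈ Finset.Ioc a b, (x T t s ⬝ᵥ v) ^ 2 := by
  rw [← sum_blk_eq_sum_Ioc hb]
  rfl

theorem gram_isHermitian : (gram x T a j s).IsHermitian := by
  rw [Matrix.IsHermitian, conjTranspose_eq_transpose_of_trivial, gram, transpose_smul,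
    transpose_sum]
  congr 1
  refine Finset.sum_congr rfl fun t _ => ?_
  ext i k
  simp [vecMulVec_apply, mul_comm]

theorem quad_gram (v : Fin p → ℝ) :
    quad (gram x T a j s) v = (j : ℝ)⁻¹ * ∑ t ∈ Finset.Ioc a (a + j), (x T t s ⬝ᵥ v) ^ 2 := by
  rw [quad, gram, smul_mulVec, dotProduct_smul, smul_eq_mul, sum_mulVec, dotProduct_sum]
  congr 1
  refine Finset.sum_congr rfl fun t _ => ?_
  rw [vecMulVec_mulVec, dotProduct_smul, dotProduct_comm v, sq]
  simp

theorem le_energy_of_gram {T a j : ℕ} (haj : a + j ≤ T) {l : ℝ} (hj : 1 ≤ j)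
    (h : ¬ ∃ e ∈ spectrum ℝ (gram x T a j s), e < l) (v : Fin p → ℝ) :
    l * j * (v ⬝ᵥ v) ≤ energy (design x T s) (blk T a (a + j)) v := by
  push Not at h
  have h1 := le_quad_of_le_spectrum (gram_isHermitian x T a j s) h v
  rw [quad_gram, ← energy_design x s haj] at h1
  have hj0 : (0 : ℝ) < j := by exact_mod_cast hj
  rw [inv_mul_eq_div, le_div_iff₀ hj0] at h1
  linarith

theorem sum_sq_le_of_norm_gram_le {a j : ℕ} {B : ℝ} (hj : 1 ≤ j)
    (h : ¬ B < ‖gram x T a j s‖) (v : Fin p → ℝ) :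
    ∑ t ∈ Finset.Ioc a (a + j), (x T t s ⬝ᵥ v) ^ 2 ≤ B * j * (v ⬝ᵥ v) := by
  push Not at h
  have h1 := (quad_le_norm_mul (gram x T a j s) v).trans
    (mul_le_mul_of_nonneg_right h (dotProduct_self_nonneg' v))
  rw [quad_gram] at h1
  have hj0 : (0 : ℝ) < j := by exact_mod_cast hj
  rw [inv_mul_eq_div, div_le_iff₀ hj0] at h1
  linarith

end Gram

/-- A matrix of full column rank is bounded below. -/
theorem exists_le_of_rank_eq {p q : ℕ} {R : Matrix (Fin p) (Fin q) ℝ} (hR : R.rank = q) :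
    ∃ r : ℝ, 0 < r ∧ ∀ v, r * (v ⬝ᵥ v) ≤ (R *ᵥ v) ⬝ᵥ (R *ᵥ v) := by
  have hker : R.mulVecLin.ker = ⊥ := by
    have h := LinearMap.finrank_range_add_finrank_ker R.mulVecLin
    rw [Module.finrank_fin_fun] at h
    have h' : Module.finrank ℝ R.mulVecLin.range = q := hR
    exact Submodule.finrank_eq_zero.1 (by omega)
  have hker' : (toEuclideanLin R).ker = ⊥ := by
    rw [LinearMap.ker_eq_bot'] at hker ⊢
    intro v hv
    have h1 : R *ᵥ v.ofLp = 0 := by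
      have := congrArg WithLp.ofLp hv
      simpa using this
    have h2 := hker v.ofLp h1
    ext i
    exact congrFun h2 i
  obtain ⟨K, hK, hanti⟩ := (toEuclideanLin R).exists_antilipschitzWith hker'
  have hK0 : (0 : ℝ) < K := hK
  refine ⟨((K : ℝ) ^ 2)⁻¹, by positivity, fun v => ?_⟩
  have h1 := hanti.le_mul_norm_sub (WithLp.toLp 2 v) 0
  rw [map_zero, add_zero, add_zero, norm_neg, norm_neg] at h1
  have h2 := dotProduct_self_eq_norm_sq (WithLp.toLp 2 v : EuclideanSpace ℝ (Fin q))
  have h3 := dotProduct_self_eq_norm_sq (toEuclideanLin R (WithLp.toLp 2 v))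
  have h4 : (toEuclideanLin R (WithLp.toLp 2 v)).ofLp = R *ᵥ v := by simp
  rw [h4] at h3
  change v ⬝ᵥ v = _ at h2
  rw [inv_mul_le_iff₀ (by positivity), h2, h3, ← mul_pow]
  gcongr

/-! ### Uniform boundedness of the weights -/

/-- This extends a sequence defined along a subsequence to all of `ℕ`: the assumption on the weights
concerns full sequences of dates. -/
theorem tendsto_ite_range {α : Type*} {l : Filter α} {θ : ℕ → ℕ} (hθ : StrictMono θ)
    {f g : ℕ → α} (hf : Tendsto (fun n => f (θ n)) atTop l) (hg : Tendsto g atTop l)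
    [DecidablePred fun T => ∃ n, θ n = T] :
    Tendsto (fun T => if ∃ n, θ n = T then f T else g T) atTop l := by
  intro s hs
  obtain ⟨N, hN⟩ := eventually_atTop.1 (hf hs)
  obtain ⟨M, hM⟩ := eventually_atTop.1 (hg hs)
  refine mem_map.2 (mem_atTop_sets.2 ⟨max (θ N) M, fun T hT => ?_⟩)
  change (if ∃ n, θ n = T then f T else g T) ∈ s
  split_ifs with h
  · obtain ⟨n, rfl⟩ := h
    exact hN n (hθ.le_iff_le.1 ((le_max_left _ _).trans hT))
  · exact hM T ((le_max_right _ _).trans hT)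

theorem exists_date_tendsto {ρ : ℝ} (hρ : ρ ∈ Set.Icc (0 : ℝ) 1) : ∃ k : ℕ → ℕ,
    (∀ T, 2 ≤ T → 1 ≤ k T ∧ k T < T) ∧
      Tendsto (fun T : ℕ => (k T : ℝ) / (T : ℝ)) atTop (𝓝 ρ) := by
  refine ⟨fun T => max 1 (min (T - 1) ⌊ρ * T⌋₊), fun T hT => ⟨le_max_left _ _, ?_⟩, ?_⟩
  · have : min (T - 1) ⌊ρ * T⌋₊ ≤ T - 1 := min_le_left _ _
    exact max_lt (by omega) (by omega)
  · have hinv : Tendsto (fun T : ℕ => (T : ℝ)⁻¹) atTop (𝓝 0) :=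
      tendsto_inv_atTop_zero.comp tendsto_natCast_atTop_atTop
    have hlow : Tendsto (fun T : ℕ => ρ - (T : ℝ)⁻¹) atTop (𝓝 ρ) := by
      simpa using tendsto_const_nhds.sub hinv
    have hupp : Tendsto (fun T : ℕ => ρ + (T : ℝ)⁻¹) atTop (𝓝 ρ) := by
      simpa using tendsto_const_nhds.add hinv
    refine tendsto_of_tendsto_of_tendsto_of_le_of_le' hlow hupp ?_ ?_
    · filter_upwards [eventually_ge_atTop 1] with T hT
      have hT0 : (0 : ℝ) < T := by exact_mod_cast hT
      rw [le_div_iff₀ hT0, sub_mul, inv_mul_cancel₀ hT0.ne']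
      have h1 : ρ * T - 1 ≤ ⌊ρ * T⌋₊ := (Nat.sub_one_lt_floor _).le
      have h2 : ρ * T - 1 ≤ ((T - 1 : ℕ) : ℝ) := by
        rw [Nat.cast_sub hT, Nat.cast_one]
        have := mul_le_of_le_one_left hT0.le hρ.2
        linarith
      have h3 : ρ * T - 1 ≤ ((min (T - 1) ⌊ρ * T⌋₊ : ℕ) : ℝ) := by
        rw [Nat.cast_min]
        exact le_min h2 h1
      refine h3.trans ?_
      exact_mod_cast le_max_right _ _
    · filter_upwards [eventually_ge_atTop 1] with T hT
      have hT0 : (0 : ℝ) < T := by exact_mod_cast hT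
      rw [div_le_iff₀ hT0, add_mul, inv_mul_cancel₀ hT0.ne']
      have hρT : 0 ≤ ρ * T := mul_nonneg hρ.1 hT0.le
      have h1 : (⌊ρ * T⌋₊ : ℝ) ≤ ρ * T := Nat.floor_le hρT
      have h2 : ((min (T - 1) ⌊ρ * T⌋₊ : ℕ) : ℝ) ≤ ⌊ρ * T⌋₊ := by
        exact_mod_cast min_le_right _ _
      rw [Nat.cast_max, Nat.cast_one]
      exact max_le (by linarith) (by linarith)

/-- Weights that converge along all sequences of dates are bounded. -/
theorem exists_norm_weight_le {q : ℕ} {W : ℕ → ℕ → Matrix (Fin q) (Fin q) ℝ}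
    {Wbar : ℝ → Matrix (Fin q) (Fin q) ℝ}
    (h : ∀ ρ ∈ Set.Icc (0 : ℝ) 1, ∀ k : ℕ → ℕ, (∀ᶠ T in atTop, 1 ≤ k T ∧ k T < T) →
      Tendsto (fun T : ℕ => (k T : ℝ) / (T : ℝ)) atTop (𝓝 ρ) →
      Tendsto (fun T => W T (k T)) atTop (𝓝 (Wbar ρ))) :
    ∃ K : ℝ, 0 < K ∧ ∀ᶠ T in atTop, ∀ k, 1 ≤ k → k < T → ‖W T k‖ ≤ K := by
  classical
  by_contra hcon
  push Not at hcon
  have hfreq : ∀ n : ℕ, ∃ᶠ T in atTop, ∃ k, 1 ≤ k ∧ k < T ∧ (n : ℝ) < ‖W T k‖ := by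
    intro n
    refine (hcon (n + 1) (by positivity)).mono fun T hT => ?_
    obtain ⟨k, h1, h2, h3⟩ := hT
    exact ⟨k, h1, h2, by linarith⟩
  -- If no bound existed, dates `κ n` in rows `φ n` would have weights of norm above `n`. By
  -- compactness `κ n / φ n` converges along `ψ`; filling the other rows with `k₁` gives a sequence
  -- of dates to which `h` applies, and a convergent sequence is bounded.
  obtain ⟨φ, hφ, hφW⟩ := extraction_forall_of_frequently hfreq
  choose κ hκ1 hκT hκW using hφW
  have hmem : ∀ n, (κ n : ℝ) / (φ n : ℝ) ∈ Set.Icc (0 : ℝ) 1 := fun n =>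
    ⟨by positivity, div_le_one_of_le₀ (by exact_mod_cast (hκT n).le) (by positivity)⟩
  obtain ⟨ρ, hρ, ψ, hψ, hlim⟩ := isCompact_Icc.tendsto_subseq hmem
  obtain ⟨k₁, hk₁, hk₁lim⟩ := exists_date_tendsto hρ
  have hθ : StrictMono (φ ∘ ψ) := hφ.comp hψ
  let idx : ℕ → ℕ := Function.invFun (φ ∘ ψ)
  have hidx : ∀ n, idx ((φ ∘ ψ) n) = n := Function.leftInverse_invFun hθ.injective
  let k : ℕ → ℕ := fun T => if ∃ n, (φ ∘ ψ) n = T then κ (ψ (idx T)) else k₁ T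
  have hkθ : ∀ n, k ((φ ∘ ψ) n) = κ (ψ n) := by
    intro n
    have hex : ∃ i, (φ ∘ ψ) i = (φ ∘ ψ) n := ⟨n, rfl⟩
    simp only [k, hex, if_true, hidx]
  have hk : ∀ᶠ T in atTop, 1 ≤ k T ∧ k T < T := by
    filter_upwards [eventually_ge_atTop 2] with T hT
    by_cases hex : ∃ n, (φ ∘ ψ) n = T
    · obtain ⟨n, rfl⟩ := hex
      rw [hkθ]
      exact ⟨hκ1 _, hκT _⟩
    · simp only [k, hex, if_false]
      exact hk₁ T hT
  have hklim : Tendsto (fun T : ℕ => (k T : ℝ) / (T : ℝ)) atTop (𝓝 ρ) := by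
    have := tendsto_ite_range hθ (f := fun T => (κ (ψ (idx T)) : ℝ) / (T : ℝ))
      (g := fun T => (k₁ T : ℝ) / (T : ℝ)) (l := 𝓝 ρ) (by
        simp only [hidx]
        exact hlim) hk₁lim
    refine this.congr fun T => ?_
    simp only [k]
    split_ifs <;> rfl
  have hW := ((h ρ hρ k hk hklim).comp hθ.tendsto_atTop).norm
  obtain ⟨M, hM⟩ := hW.bddAbove_range
  obtain ⟨n, hn⟩ := exists_nat_gt M
  have h1 : ‖W ((φ ∘ ψ) n) (k ((φ ∘ ψ) n))‖ ≤ M := hM ⟨n, rfl⟩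
  rw [hkθ] at h1
  have h2 := hκW (ψ n)
  have h3 : (n : ℝ) ≤ ψ n := by exact_mod_cast hψ.id_le n
  have h4 : ‖W ((φ ∘ ψ) n) (κ (ψ n))‖ = ‖W (φ (ψ n)) (κ (ψ n))‖ := rfl
  linarith

/-! ### Sums of regressors times errors -/

section MaximalBound

variable {S : Type*} [MeasurableSpace S] {P : Measure S} {p : ℕ}

/-- A maximal inequality, uniform in the row of the array, for the coordinates of the random
vectors `V T j`, `j ≤ n T`. -/
def MaximalBound (P : Measure S) (n : ℕ → ℕ) (V : ℕ → ℕ → S → Fin p → ℝ) : Prop :=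
  ∃ K : ℝ, 0 ≤ K ∧ ∀ᶠ T in atTop, ∀ i, ∀ n' ≤ n T, ∀ x : ℝ, 0 < x →
    P {s | ∃ j ≤ n', x ≤ |V T j s i|} ≤ ENNReal.ofReal (K * n' / x ^ 2)

/-- Pigeonhole over coordinates. The factor `p + 1` in place of `p` allows division by it when `p =
0`. -/
theorem exists_le_abs_of_lt_dotProduct_self {v : Fin p → ℝ} {c : ℝ}
    (h : (p + 1) * c ^ 2 < v ⬝ᵥ v) : ∃ i, c ≤ |v i| := by
  by_contra hcon
  push Not at hcon
  have h1 : v ⬝ᵥ v ≤ ∑ _i : Fin p, c ^ 2 := by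
    refine Finset.sum_le_sum fun i _ => ?_
    rw [← sq, ← sq_abs]
    have := (hcon i).le
    gcongr
  rw [Finset.sum_const, Finset.card_univ, Fintype.card_fin, nsmul_eq_mul] at h1
  nlinarith [sq_nonneg c]

theorem MaximalBound.weighted {n : ℕ → ℕ} {V : ℕ → ℕ → S → Fin p → ℝ}
    (h : MaximalBound P n V) {ν : ℝ} (hν : 0 < ν) : ∃ K : ℝ, 0 ≤ K ∧ ∀ᶠ T in atTop,
      ∀ m : ℕ, 1 ≤ m → ∀ x : ℝ, 0 < x →
        P {s | ∃ j, m ≤ j ∧ j ≤ n T ∧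
          (p + 1) * (x * (j : ℝ) ^ (1 / 2 + ν)) ^ 2 < V T j s ⬝ᵥ V T j s} ≤
          ENNReal.ofReal (K * (m : ℝ) ^ (-(2 * ν)) / x ^ 2) := by
  obtain ⟨K, hK, hV⟩ := h
  obtain ⟨C, hC, hmax⟩ := measure_weighted_max_le P hν
  refine ⟨p * (C * K), by positivity, hV.mono fun T hT m hm x hx => ?_⟩
  have hcover : {s | ∃ j, m ≤ j ∧ j ≤ n T ∧
      (p + 1) * (x * (j : ℝ) ^ (1 / 2 + ν)) ^ 2 < V T j s ⬝ᵥ V T j s} ⊆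
      ⋃ i : Fin p, {s | ∃ j, m ≤ j ∧ j ≤ n T ∧ x * (j : ℝ) ^ (1 / 2 + ν) ≤ |V T j s i|} := by
    rintro s ⟨j, h1, h2, h3⟩
    obtain ⟨i, hi⟩ := exists_le_abs_of_lt_dotProduct_self h3
    exact Set.mem_iUnion.2 ⟨i, j, h1, h2, hi⟩
  calc _ ≤ ∑ i : Fin p,
        P {s | ∃ j, m ≤ j ∧ j ≤ n T ∧ x * (j : ℝ) ^ (1 / 2 + ν) ≤ |V T j s i|} :=
        (measure_mono hcover).trans (measure_iUnion_fintype_le _ _)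
    _ ≤ ∑ _i : Fin p, ENNReal.ofReal (C * K * (m : ℝ) ^ (-(2 * ν)) / x ^ 2) :=
        Finset.sum_le_sum fun i _ =>
          hmax (fun j s => |V T j s i|) (n T) K hK (hT i) m hm x hx
    _ = ENNReal.ofReal (p * (C * K) * (m : ℝ) ^ (-(2 * ν)) / x ^ 2) := by
        rw [Finset.sum_const, Finset.card_univ, Fintype.card_fin, nsmul_eq_mul,
          ← ENNReal.ofReal_natCast p, ← ENNReal.ofReal_mul (by positivity)]
        congr 1
        ring

/-- The weight with `ν = 1/2` is `j` itself. Starting at `m ≥ C / d` gives a failure probability of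
order `m⁻¹ / (σ d) ≤ 1 / (σ C)`: the source of the rate `‖δ_T‖⁻²`. -/
theorem MaximalBound.near {n : ℕ → ℕ} {V : ℕ → ℕ → S → Fin p → ℝ} (h : MaximalBound P n V)
    {d : ℕ → ℝ} (hd : ∀ᶠ T in atTop, 0 < d T) {σ η : ℝ} (hσ : 0 < σ) (hη : 0 < η) :
    ∃ C₀ : ℝ, 0 < C₀ ∧ ∀ C, C₀ ≤ C → ∀ᶠ T in atTop,
      P {s | ∃ j, ⌈C / d T⌉₊ ≤ j ∧ j ≤ n T ∧ σ * (j : ℝ) ^ 2 * d T < V T j s ⬝ᵥ V T j s} ≤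
        ENNReal.ofReal η := by
  obtain ⟨K, hK, hV⟩ := h.weighted (ν := 1 / 2) (by norm_num)
  refine ⟨(K * (p + 1) + 1) / (σ * η), by positivity, fun C hC => ?_⟩
  filter_upwards [hV, hd] with T hT hdT
  have hC0 : 0 < C := lt_of_lt_of_le (by positivity) hC
  have hm : 1 ≤ ⌈C / d T⌉₊ := Nat.one_le_ceil_iff.2 (by positivity)
  have hx : 0 < Real.sqrt (σ * d T / (p + 1)) := Real.sqrt_pos.2 (by positivity)
  have hx2 : Real.sqrt (σ * d T / (p + 1)) ^ 2 = σ * d T / (p + 1) :=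
    Real.sq_sqrt (by positivity)
  have h1 := hT _ hm _ hx
  refine (measure_mono ?_).trans (h1.trans (ENNReal.ofReal_le_ofReal ?_))
  · rintro s ⟨j, h1, h2, h3⟩
    refine ⟨j, h1, h2, lt_of_le_of_lt (le_of_eq ?_) h3⟩
    rw [mul_pow, hx2, show (1 / 2 + 1 / 2 : ℝ) = 1 by norm_num, Real.rpow_one]
    field_simp
  · rw [hx2, show (-(2 * (1 / 2)) : ℝ) = -1 by norm_num, Real.rpow_neg_one]
    have hceil : C / d T ≤ (⌈C / d T⌉₊ : ℝ) := Nat.le_ceil _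
    have hinv : ((⌈C / d T⌉₊ : ℕ) : ℝ)⁻¹ ≤ (C / d T)⁻¹ := by gcongr
    rw [div_le_iff₀ (by positivity)] at hC
    calc K * ((⌈C / d T⌉₊ : ℕ) : ℝ)⁻¹ / (σ * d T / (p + 1))
        ≤ K * (C / d T)⁻¹ / (σ * d T / (p + 1)) := by gcongr
      _ = K * (p + 1) / (C * σ) := by field_simp
      _ ≤ η := by
        rw [div_le_iff₀ (by positivity)]
        linarith

/-- With `ν = γ`, `j^(1+2γ) ≤ j T^(2γ)` for `j ≤ T`, and the failure probability is of order `1 / (σ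
T^(1-2γ) d)`, which tends to zero. Here the lower bound on the break magnitude enters. -/
theorem MaximalBound.far {n : ℕ → ℕ} {V : ℕ → ℕ → S → Fin p → ℝ} (h : MaximalBound P n V)
    (hn : ∀ T, n T ≤ T) {d : ℕ → ℝ} (hd : ∀ᶠ T in atTop, 0 < d T) {γ : ℝ} (hγ : 0 < γ)
    (hlim : Tendsto (fun T : ℕ => (T : ℝ) ^ (1 - 2 * γ) * d T) atTop atTop) {σ η : ℝ}
    (hσ : 0 < σ) (hη : 0 < η) : ∀ᶠ T in atTop,
      P {s | ∃ j, 1 ≤ j ∧ j ≤ n T ∧ σ * T * d T * j < V T j s ⬝ᵥ V T j s} ≤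
        ENNReal.ofReal η := by
  obtain ⟨K, hK, hV⟩ := h.weighted hγ
  filter_upwards [hV, hd, hlim.eventually_ge_atTop (K * (p + 1) / (σ * η)),
    eventually_ge_atTop 1] with T hT hdT hbig hT1
  have hT0 : (0 : ℝ) < T := by exact_mod_cast hT1
  have hx : 0 < Real.sqrt (σ * ((T : ℝ) ^ (1 - 2 * γ) * d T) / (p + 1)) :=
    Real.sqrt_pos.2 (by positivity)
  have hx2 : Real.sqrt (σ * ((T : ℝ) ^ (1 - 2 * γ) * d T) / (p + 1)) ^ 2 =
      σ * ((T : ℝ) ^ (1 - 2 * γ) * d T) / (p + 1) := Real.sq_sqrt (by positivity)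
  have h1 := hT 1 le_rfl _ hx
  refine (measure_mono ?_).trans (h1.trans (ENNReal.ofReal_le_ofReal ?_))
  · rintro s ⟨j, h1, h2, h3⟩
    refine ⟨j, h1, h2, lt_of_le_of_lt ?_ h3⟩
    have hj0 : (0 : ℝ) < j := by exact_mod_cast h1
    have hjT : (j : ℝ) ≤ T := by exact_mod_cast h2.trans (hn T)
    have hpow : ((j : ℝ) ^ (1 / 2 + γ)) ^ 2 = j * (j : ℝ) ^ (2 * γ) := by
      rw [← Real.rpow_natCast, ← Real.rpow_mul hj0.le]
      have : (1 / 2 + γ) * ((2 : ℕ) : ℝ) = 1 + 2 * γ := by push_cast; ring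
      rw [this, Real.rpow_add hj0, Real.rpow_one]
    have hTpow : (T : ℝ) ^ (1 - 2 * γ) * (T : ℝ) ^ (2 * γ) = T := by
      rw [← Real.rpow_add hT0, sub_add_cancel, Real.rpow_one]
    rw [mul_pow, hx2, hpow]
    calc (p + 1) * (σ * ((T : ℝ) ^ (1 - 2 * γ) * d T) / (p + 1) * (j * (j : ℝ) ^ (2 * γ)))
        = σ * d T * j * ((T : ℝ) ^ (1 - 2 * γ) * (j : ℝ) ^ (2 * γ)) := by field_simp
      _ ≤ σ * d T * j * ((T : ℝ) ^ (1 - 2 * γ) * (T : ℝ) ^ (2 * γ)) := by gcongr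
      _ = σ * T * d T * j := by rw [hTpow]; ring
  · rw [hx2, Nat.cast_one, Real.one_rpow, mul_one]
    rw [div_le_iff₀ (by positivity)] at hbig
    rw [div_div_eq_mul_div, div_le_iff₀ (by positivity)]
    linarith

end MaximalBound

/-! ### Moments -/

section Moments

variable {S : Type*} [MeasurableSpace S] {P : Measure S} [IsProbabilityMeasure P]

theorem BoundedMoment.pow_four {γ : ℝ} (hγ : 0 < γ) {u : ℕ → ℕ → S → ℝ}
    (h : BoundedMoment P (4 + γ) u) : ∃ K : ℝ, 0 ≤ K ∧ ∀ T t, 1 ≤ t → t ≤ T →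
      ∫⁻ s, ENNReal.ofReal (u T t s ^ 4) ∂P ≤ ENNReal.ofReal K := by
  obtain ⟨K, hK⟩ := h
  refine ⟨1 + max K 0, by positivity, fun T t h1 h2 => ?_⟩
  have hpt : ∀ s, ENNReal.ofReal (u T t s ^ 4) ≤ 1 + ENNReal.ofReal (|u T t s| ^ (4 + γ)) := by
    intro s
    rw [← ENNReal.ofReal_one, ← ENNReal.ofReal_add zero_le_one (by positivity)]
    refine ENNReal.ofReal_le_ofReal ?_
    have h4 : u T t s ^ 4 = |u T t s| ^ (4 : ℝ) := by
      rw [show (4 : ℝ) = ((4 : ℕ) : ℝ) by norm_num, Real.rpow_natCast, Even.pow_abs (by decide)]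
    rw [h4]
    rcases le_total |u T t s| 1 with hu | hu
    · have := Real.rpow_le_one (abs_nonneg (u T t s)) hu (by norm_num : (0 : ℝ) ≤ 4)
      have h0 : 0 ≤ |u T t s| ^ (4 + γ) := by positivity
      linarith
    · have := Real.rpow_le_rpow_of_exponent_le hu (by linarith : (4 : ℝ) ≤ 4 + γ)
      linarith
  calc ∫⁻ s, ENNReal.ofReal (u T t s ^ 4) ∂P
      ≤ ∫⁻ s, (1 + ENNReal.ofReal (|u T t s| ^ (4 + γ))) ∂P := lintegral_mono hpt
    _ = 1 + ∫⁻ s, ENNReal.ofReal (|u T t s| ^ (4 + γ)) ∂P := by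
        rw [lintegral_add_left measurable_const]
        simp
    _ ≤ 1 + ENNReal.ofReal K := by gcongr; exact hK T t h1 h2
    _ ≤ ENNReal.ofReal (1 + max K 0) := by
        rw [ENNReal.ofReal_add zero_le_one (le_max_right _ _), ENNReal.ofReal_one]
        gcongr
        exact le_max_left _ _

omit [IsProbabilityMeasure P] in
theorem memLp_two_of_lintegral_le {f : S → ℝ} (hf : AEStronglyMeasurable f P) {K : ℝ}
    (hK : 0 ≤ K) (h : ∫⁻ s, ENNReal.ofReal (f s ^ 2) ∂P ≤ ENNReal.ofReal K) :
    MemLp f 2 P ∧ ∫ s, f s ^ 2 ∂P ≤ K := by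
  constructor
  · rw [memLp_two_iff_integrable_sq hf]
    refine ⟨hf.pow 2, ?_⟩
    rw [hasFiniteIntegral_iff_ofReal (ae_of_all _ fun s => sq_nonneg _)]
    exact h.trans_lt ENNReal.ofReal_lt_top
  · rw [integral_eq_lintegral_of_nonneg_ae (ae_of_all _ fun s => sq_nonneg _) (hf.pow 2)]
    exact ENNReal.toReal_le_of_le_ofReal hK h

theorem BoundedMoment.sq {γ : ℝ} (hγ : 0 < γ) {u : ℕ → ℕ → S → ℝ}
    (h : BoundedMoment P (4 + γ) u) (hu : ∀ T t, Measurable (u T t)) :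
    ∃ K : ℝ, 0 ≤ K ∧ ∀ T t, 1 ≤ t → t ≤ T →
      MemLp (u T t) 2 P ∧ ∫ s, u T t s ^ 2 ∂P ≤ K := by
  obtain ⟨K, hK0, hK⟩ := h.pow_four hγ
  refine ⟨1 + K, by positivity, fun T t h1 h2 =>
    memLp_two_of_lintegral_le (hu T t).aestronglyMeasurable (by positivity) ?_⟩
  calc ∫⁻ s, ENNReal.ofReal (u T t s ^ 2) ∂P
      ≤ ∫⁻ s, (1 + ENNReal.ofReal (u T t s ^ 4)) ∂P := by
        refine lintegral_mono fun s => ?_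
        rw [← ENNReal.ofReal_one, ← ENNReal.ofReal_add zero_le_one (by positivity)]
        refine ENNReal.ofReal_le_ofReal ?_
        nlinarith [sq_nonneg (u T t s ^ 2 - 1), sq_nonneg (u T t s)]
    _ = 1 + ∫⁻ s, ENNReal.ofReal (u T t s ^ 4) ∂P := by
        rw [lintegral_add_left measurable_const]
        simp
    _ ≤ 1 + ENNReal.ofReal K := by gcongr; exact hK T t h1 h2
    _ = ENNReal.ofReal (1 + K) := by
        rw [ENNReal.ofReal_add zero_le_one hK0, ENNReal.ofReal_one]

theorem BoundedMoment.mul_sq {γ γ' : ℝ} (hγ : 0 < γ) (hγ' : 0 < γ') {u v : ℕ → ℕ → S → ℝ}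
    (hu : BoundedMoment P (4 + γ) u) (hv : BoundedMoment P (4 + γ') v)
    (hum : ∀ T t, Measurable (u T t)) (hvm : ∀ T t, Measurable (v T t)) :
    ∃ K : ℝ, 0 ≤ K ∧ ∀ T t, 1 ≤ t → t ≤ T →
      MemLp (fun s => u T t s * v T t s) 2 P ∧ ∫ s, (u T t s * v T t s) ^ 2 ∂P ≤ K := by
  obtain ⟨K, hK0, hK⟩ := hu.pow_four hγ
  obtain ⟨L, hL0, hL⟩ := hv.pow_four hγ'
  refine ⟨K + L, by positivity, fun T t h1 h2 =>
    memLp_two_of_lintegral_le ((hum T t).mul (hvm T t)).aestronglyMeasurable (by positivity) ?_⟩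
  calc ∫⁻ s, ENNReal.ofReal ((u T t s * v T t s) ^ 2) ∂P
      ≤ ∫⁻ s, (ENNReal.ofReal (u T t s ^ 4) + ENNReal.ofReal (v T t s ^ 4)) ∂P := by
        refine lintegral_mono fun s => ?_
        rw [← ENNReal.ofReal_add (by positivity) (by positivity)]
        refine ENNReal.ofReal_le_ofReal ?_
        have e1 : (u T t s * v T t s) ^ 2 = u T t s ^ 2 * v T t s ^ 2 := mul_pow _ _ _
        have e2 : u T t s ^ 4 = (u T t s ^ 2) ^ 2 := by ring
        have e3 : v T t s ^ 4 = (v T t s ^ 2) ^ 2 := by ring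
        rw [e1, e2, e3]
        nlinarith [sq_nonneg (u T t s ^ 2 - v T t s ^ 2), sq_nonneg (u T t s ^ 2),
          sq_nonneg (v T t s ^ 2)]
    _ = ∫⁻ s, ENNReal.ofReal (u T t s ^ 4) ∂P + ∫⁻ s, ENNReal.ofReal (v T t s ^ 4) ∂P :=
        lintegral_add_left ((hum T t).pow_const 4).ennreal_ofReal _
    _ ≤ ENNReal.ofReal K + ENNReal.ofReal L := add_le_add (hK T t h1 h2) (hL T t h1 h2)
    _ = ENNReal.ofReal (K + L) := (ENNReal.ofReal_add hK0 hL0).symm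

variable {p : ℕ} {x : ℕ → ℕ → S → Fin p → ℝ} {ε : ℕ → ℕ → S → ℝ}

/-- The squares of a nonrandom regressor have bounded averages over each of the blocks. -/
theorem Nonrandom.sum_sq_le {n : ℕ → ℕ} {b : ℕ → ℕ → ℕ}
    (hG : WellConditioned P n (fun T j => gram x T (b T j) j))
    (hb : ∀ T j, j ≤ n T → b T j + j ≤ T) {i : Fin p} {c : ℕ → ℕ → ℝ}
    (hc : ∀ T t, 1 ≤ t → t ≤ T → ∀ᵐ s ∂P, x T t s i = c T t) :
    ∃ B : ℝ, 0 ≤ B ∧ ∀ᶠ T in atTop, ∀ j, 1 ≤ j → j ≤ n T →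
      ∑ t ∈ Finset.Ioc (b T j) (b T j + j), c T t ^ 2 ≤ B * j := by
  -- Any probability below one serves: the good event then contains an outcome at which the
  -- regressor takes its nonrandom values, and the bound read off there is deterministic.
  obtain ⟨B, hB⟩ := hG.bounded (1 / 2) (by norm_num)
  refine ⟨max B 0, le_max_right _ _, hB.mono fun T hT j hj1 hjn => ?_⟩
  set bad : Set S := {s | ∃ j, 1 ≤ j ∧ j ≤ n T ∧ B < ‖gram x T (b T j) j s‖} with hbad
  have hall : ∀ᵐ s ∂P, ∀ t ∈ Finset.Icc 1 T, x T t s i = c T t := by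
    rw [Filter.eventually_all_finset]
    intro t ht
    rw [Finset.mem_Icc] at ht
    exact hc T t ht.1 ht.2
  have hex : ∃ s, s ∉ bad ∧ ∀ t ∈ Finset.Icc 1 T, x T t s i = c T t := by
    by_contra hcon
    push Not at hcon
    have hsub : ∀ᵐ s ∂P, s ∈ bad := by
      filter_upwards [hall] with s hs
      by_contra hsb
      obtain ⟨t, ht, hne⟩ := hcon s hsb
      exact hne (hs t ht)
    have h1 : P bad = 1 := by
      have := measure_congr (μ := P) (s := bad) (t := Set.univ)
        (eventuallyEq_univ.2 hsub)
      rw [this, measure_univ]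
    rw [h1, ← ENNReal.ofReal_one, ENNReal.ofReal_le_ofReal_iff (by norm_num)] at hT
    norm_num at hT
  obtain ⟨s, hsb, hs⟩ := hex
  have hnorm : ¬ B < ‖gram x T (b T j) j s‖ := fun hlt => hsb ⟨j, hj1, hjn, hlt⟩
  have h2 := sum_sq_le_of_norm_gram_le x T s hj1 hnorm (Pi.single i 1)
  rw [dotProduct_single_one, Pi.single_eq_same, mul_one] at h2
  calc ∑ t ∈ Finset.Ioc (b T j) (b T j + j), c T t ^ 2
      = ∑ t ∈ Finset.Ioc (b T j) (b T j + j), (x T t s ⬝ᵥ Pi.single i 1) ^ 2 := by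
        refine Finset.sum_congr rfl fun t ht => ?_
        rw [Finset.mem_Ioc] at ht
        have := hb T j hjn
        rw [dotProduct_single_one, hs t (Finset.mem_Icc.2 ⟨by omega, by omega⟩)]
    _ ≤ B * j := h2
    _ ≤ max B 0 * j := by gcongr; exact le_max_left _ _

theorem memLp_regressor_mul_error (hx : ∀ T t, Measurable (x T t))
    (hε : ∀ T t, Measurable (ε T t))
    (hxmom : ∃ γ : ℝ, 0 < γ ∧ ∀ i, Nonrandom P (fun T t s => x T t s i) ∨
      BoundedMoment P (4 + γ) (fun T t s => x T t s i))
    (hεmom : ∃ γ : ℝ, 0 < γ ∧ BoundedMoment P (4 + γ) ε) (i : Fin p) {T t : ℕ} (h1 : 1 ≤ t)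
    (h2 : t ≤ T) : MemLp (fun s => x T t s i * ε T t s) 2 P := by
  obtain ⟨γ, hγ, hxm⟩ := hxmom
  obtain ⟨γ', hγ', hεm⟩ := hεmom
  rcases hxm i with ⟨c, hc⟩ | hb
  · obtain ⟨K, -, hK⟩ := hεm.sq hγ' hε
    refine ((hK T t h1 h2).1.const_mul (c T t)).ae_eq ?_
    filter_upwards [hc T t h1 h2] with s hs
    rw [hs]
  · obtain ⟨K, -, hK⟩ := hb.mul_sq hγ hγ' hεm
      (fun T t => (measurable_pi_apply i).comp (hx T t)) hε
    exact (hK T t h1 h2).1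

/-- Kolmogorov's inequality needs only sums of variances. A random coordinate has them bounded term
by term through fourth moments. A nonrandom coordinate need not be bounded, but its squares have
bounded block averages. -/
theorem sum_integral_sq_le (hx : ∀ T t, Measurable (x T t))
    (hε : ∀ T t, Measurable (ε T t))
    (hxmom : ∃ γ : ℝ, 0 < γ ∧ ∀ i, Nonrandom P (fun T t s => x T t s i) ∨
      BoundedMoment P (4 + γ) (fun T t s => x T t s i))
    (hεmom : ∃ γ : ℝ, 0 < γ ∧ BoundedMoment P (4 + γ) ε) {n : ℕ → ℕ} {b : ℕ → ℕ → ℕ}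
    (hG : WellConditioned P n (fun T j => gram x T (b T j) j))
    (hb : ∀ T j, j ≤ n T → b T j + j ≤ T) :
    ∃ K : ℝ, 0 ≤ K ∧ ∀ᶠ T in atTop, ∀ i : Fin p, ∀ j ≤ n T,
      ∑ t ∈ Finset.Ioc (b T j) (b T j + j), ∫ s, (x T t s i * ε T t s) ^ 2 ∂P ≤ K * j := by
  obtain ⟨γ, hγ, hxm⟩ := hxmom
  obtain ⟨γ', hγ', hεm⟩ := hεmom
  have hcoord : ∀ i : Fin p, ∃ K : ℝ, 0 ≤ K ∧ ∀ᶠ T in atTop, ∀ j ≤ n T,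
      ∑ t ∈ Finset.Ioc (b T j) (b T j + j), ∫ s, (x T t s i * ε T t s) ^ 2 ∂P ≤ K * j := by
    intro i
    rcases hxm i with ⟨c, hc⟩ | hbm
    · obtain ⟨K, hK0, hK⟩ := hεm.sq hγ' hε
      obtain ⟨B, hB0, hB⟩ := Nonrandom.sum_sq_le hG hb hc
      refine ⟨B * K, by positivity, hB.mono fun T hT j hjn => ?_⟩
      rcases Nat.eq_zero_or_pos j with rfl | hj
      · simp
      calc ∑ t ∈ Finset.Ioc (b T j) (b T j + j), ∫ s, (x T t s i * ε T t s) ^ 2 ∂P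
          ≤ ∑ t ∈ Finset.Ioc (b T j) (b T j + j), c T t ^ 2 * K := by
            refine Finset.sum_le_sum fun t ht => ?_
            rw [Finset.mem_Ioc] at ht
            have hbT := hb T j hjn
            have ht1 : 1 ≤ t := by omega
            have htT : t ≤ T := by omega
            have : ∫ s, (x T t s i * ε T t s) ^ 2 ∂P = c T t ^ 2 * ∫ s, ε T t s ^ 2 ∂P := by
              rw [← integral_const_mul]
              refine integral_congr_ae ?_
              filter_upwards [hc T t ht1 htT] with s hs
              rw [hs, mul_pow]
            rw [this]
            exact mul_le_mul_of_nonneg_left (hK T t ht1 htT).2 (sq_nonneg _)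
        _ = (∑ t ∈ Finset.Ioc (b T j) (b T j + j), c T t ^ 2) * K := by rw [Finset.sum_mul]
        _ ≤ B * j * K := mul_le_mul_of_nonneg_right (hT j hj hjn) hK0
        _ = B * K * j := by ring
    · obtain ⟨K, hK0, hK⟩ := hbm.mul_sq hγ hγ' hεm
        (fun T t => (measurable_pi_apply i).comp (hx T t)) hε
      refine ⟨K, hK0, Eventually.of_forall fun T j hjn => ?_⟩
      have hbT := hb T j hjn
      calc ∑ t ∈ Finset.Ioc (b T j) (b T j + j), ∫ s, (x T t s i * ε T t s) ^ 2 ∂P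
          ≤ ∑ _t ∈ Finset.Ioc (b T j) (b T j + j), K := by
            refine Finset.sum_le_sum fun t ht => ?_
            rw [Finset.mem_Ioc] at ht
            exact (hK T t (by omega) (by omega)).2
        _ = K * j := by
            rw [Finset.sum_const, Nat.card_Ioc, nsmul_eq_mul, Nat.add_sub_cancel_left, mul_comm]
  choose K hK0 hK using hcoord
  refine ⟨∑ i, K i, Finset.sum_nonneg fun i _ => hK0 i, ?_⟩
  filter_upwards [eventually_all.2 hK] with T hT i j hjn
  refine (hT i j hjn).trans ?_
  gcongr
  exact Finset.single_le_sum (f := K) (fun i _ => hK0 i) (Finset.mem_univ i)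

end Moments

/-! ### Maximal inequalities for the array -/

section Array

variable {S : Type*} [m0 : MeasurableSpace S] {P : Measure S} [IsProbabilityMeasure P]
  {p : ℕ} {x : ℕ → ℕ → S → Fin p → ℝ} {ε : ℕ → ℕ → S → ℝ}

omit [IsProbabilityMeasure P] in
theorem past_le (hx : ∀ T t, Measurable (x T t)) (hε : ∀ T t, Measurable (ε T t)) (T t : ℕ) :
    past ε x T t ≤ m0 :=
  sup_le (iSup₂_le fun s _ => (hε T s).comap_le) (iSup₂_le fun s _ => (hx T s).comap_le)

omit m0 in
theorem past_mono (T : ℕ) : Monotone (past ε x T) := by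
  intro t t' htt'
  refine sup_le_sup ?_ ?_
  · refine iSup₂_le fun s hs => le_iSup₂_of_le s ?_ le_rfl
    rw [Finset.mem_Ico] at hs ⊢
    omega
  · refine iSup₂_le fun s hs => le_iSup₂_of_le s ?_ le_rfl
    rw [Finset.mem_Icc] at hs ⊢
    omega

omit m0 in
theorem measurable_regressor_past {T t t' : ℕ} (h1 : 1 ≤ t) (h2 : t ≤ t') :
    Measurable[past ε x T t'] (x T t) :=
  measurable_iff_comap_le.2
    (le_sup_of_le_right (le_iSup₂_of_le t (Finset.mem_Icc.2 ⟨h1, h2⟩) le_rfl))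

omit m0 in
theorem measurable_error_past {T t t' : ℕ} (h1 : 1 ≤ t) (h2 : t < t') :
    Measurable[past ε x T t'] (ε T t) :=
  measurable_iff_comap_le.2
    (le_sup_of_le_left (le_iSup₂_of_le t (Finset.mem_Ico.2 ⟨h1, h2⟩) le_rfl))

/-- The `i`-th coordinate of `x_t ε_t`, extended by zero beyond the sample. -/
noncomputable def shock (x : ℕ → ℕ → S → Fin p → ℝ) (ε : ℕ → ℕ → S → ℝ) (T : ℕ) (i : Fin p)
    (t : ℕ) : S → ℝ :=
  if 1 ≤ t ∧ t ≤ T then fun s => x T t s i * ε T t s else 0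

omit m0 in
theorem shock_of_mem {T t : ℕ} (h1 : 1 ≤ t) (h2 : t ≤ T) (i : Fin p) :
    shock x ε T i t = fun s => x T t s i * ε T t s :=
  if_pos ⟨h1, h2⟩

omit m0 in
theorem sum_shock {T a b : ℕ} (hb : b ≤ T) (i : Fin p) (s : S) :
    ∑ t ∈ Finset.Ioc a b, shock x ε T i t s = ∑ t ∈ Finset.Ioc a b, x T t s i * ε T t s := by
  refine Finset.sum_congr rfl fun t ht => ?_
  rw [Finset.mem_Ioc] at ht
  rw [shock_of_mem (by omega) (by omega)]

omit [IsProbabilityMeasure P] in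
theorem sum_integral_shock_sq {T a b : ℕ} (hb : b ≤ T) (i : Fin p) :
    ∑ t ∈ Finset.Ioc a b, ∫ s, shock x ε T i t s ^ 2 ∂P =
      ∑ t ∈ Finset.Ioc a b, ∫ s, (x T t s i * ε T t s) ^ 2 ∂P := by
  refine Finset.sum_congr rfl fun t ht => ?_
  rw [Finset.mem_Ioc] at ht
  rw [shock_of_mem (by omega) (by omega)]

omit m0 in
theorem stronglyMeasurable_shock (T : ℕ) (i : Fin p) (t : ℕ) :
    StronglyMeasurable[past ε x T (t + 1)] (shock x ε T i t) := by
  unfold shock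
  split_ifs with h
  · exact (((measurable_pi_apply i).comp (measurable_regressor_past h.1 (Nat.le_succ t))).mul
      (measurable_error_past h.1 (Nat.lt_succ_self t))).stronglyMeasurable
  · exact stronglyMeasurable_zero

omit [IsProbabilityMeasure P] in
theorem memLp_shock
    (hL2 : ∀ (i : Fin p) {T t : ℕ}, 1 ≤ t → t ≤ T → MemLp (fun s => x T t s i * ε T t s) 2 P)
    (T : ℕ) (i : Fin p) (t : ℕ) : MemLp (shock x ε T i t) 2 P := by
  unfold shock
  split_ifs with h
  · exact hL2 i h.1 h.2
  · exact MemLp.zero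

theorem condExp_shock
    (hL2 : ∀ (i : Fin p) {T t : ℕ}, 1 ≤ t → t ≤ T → MemLp (fun s => x T t s i * ε T t s) 2 P)
    (hεL2 : ∀ {T t : ℕ}, 1 ≤ t → t ≤ T → MemLp (ε T t) 2 P)
    (hmds : ∀ T t, 1 ≤ t → t ≤ T → P[ε T t | past ε x T t] =ᵐ[P] 0)
    (T : ℕ) (i : Fin p) (t : ℕ) : P[shock x ε T i t | past ε x T t] =ᵐ[P] 0 := by
  unfold shock
  split_ifs with h
  -- `past ε x T t` contains `x_t` but not `ε_t`, so the regressor can be taken out of the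
  -- conditional expectation.
  · have hmeas : StronglyMeasurable[past ε x T t] (fun s => x T t s i) :=
      ((measurable_pi_apply i).comp (measurable_regressor_past h.1 le_rfl)).stronglyMeasurable
    have h1 := condExp_mul_of_stronglyMeasurable_left (μ := P) hmeas
      ((hL2 i h.1 h.2).integrable (by norm_num)) ((hεL2 h.1 h.2).integrable (by norm_num))
    filter_upwards [h1, hmds T t h.1 h.2] with s hs1 hs2
    refine hs1.trans ?_
    rw [Pi.mul_apply, hs2]
    simp
  · rw [condExp_zero]

variable (hx : ∀ T t, Measurable (x T t)) (hε : ∀ T t, Measurable (ε T t))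
  (hxmom : ∃ γ : ℝ, 0 < γ ∧ ∀ i, Nonrandom P (fun T t s => x T t s i) ∨
    BoundedMoment P (4 + γ) (fun T t s => x T t s i))
  (hmds : ∀ T t, 1 ≤ t → t ≤ T → P[ε T t | past ε x T t] =ᵐ[P] 0)
  (hεmom : ∃ γ : ℝ, 0 < γ ∧ BoundedMoment P (4 + γ) ε)

include hx hε hxmom hmds hεmom

theorem maximalBound_forward {n a : ℕ → ℕ}
    (hG : WellConditioned P n (fun T j => gram x T (a T) j)) (ha : ∀ T, n T + a T ≤ T) :
    MaximalBound P n fun T j s i => ∑ t ∈ Finset.Ioc (a T) (a T + j), x T t s i * ε T t s := by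
  have hL2 : ∀ (i : Fin p) {T t : ℕ}, 1 ≤ t → t ≤ T →
      MemLp (fun s => x T t s i * ε T t s) 2 P := fun i T t h1 h2 =>
    memLp_regressor_mul_error hx hε hxmom hεmom i h1 h2
  have hεL2 : ∀ {T t : ℕ}, 1 ≤ t → t ≤ T → MemLp (ε T t) 2 P := by
    obtain ⟨γ, hγ, hm⟩ := hεmom
    obtain ⟨K, -, hK⟩ := hm.sq hγ hε
    exact fun h1 h2 => (hK _ _ h1 h2).1
  obtain ⟨K, hK0, hK⟩ := sum_integral_sq_le hx hε hxmom hεmom hG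
    (fun T j hj => by have := ha T; omega)
  refine ⟨K, hK0, hK.mono fun T hT i n' hn' y hy => ?_⟩
  have h := measure_forwardSum_le (P := P) (past ε x T) (past_le hx hε T) (past_mono T)
    (stronglyMeasurable_shock T i) (memLp_shock hL2 T i) (condExp_shock hL2 hεL2 hmds T i)
    (a T) n' hy
  have haT := ha T
  rw [sum_integral_shock_sq (by omega)] at h
  refine (measure_mono ?_).trans (h.trans (ENNReal.ofReal_le_ofReal ?_))
  · rintro s ⟨j, hj, hjy⟩
    exact ⟨j, hj, by rwa [sum_shock (by omega)]⟩
  · gcongr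
    exact hT i n' hn'

theorem maximalBound_backward {n c : ℕ → ℕ}
    (hG : WellConditioned P n (fun T j => gram x T (c T - j) j)) (hc : ∀ T, n T ≤ c T)
    (hcT : ∀ T, c T ≤ T) :
    MaximalBound P n fun T j s i => ∑ t ∈ Finset.Ioc (c T - j) (c T), x T t s i * ε T t s := by
  have hL2 : ∀ (i : Fin p) {T t : ℕ}, 1 ≤ t → t ≤ T →
      MemLp (fun s => x T t s i * ε T t s) 2 P := fun i T t h1 h2 =>
    memLp_regressor_mul_error hx hε hxmom hεmom i h1 h2
  have hεL2 : ∀ {T t : ℕ}, 1 ≤ t → t ≤ T → MemLp (ε T t) 2 P := by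
    obtain ⟨γ, hγ, hm⟩ := hεmom
    obtain ⟨K, -, hK⟩ := hm.sq hγ hε
    exact fun h1 h2 => (hK _ _ h1 h2).1
  obtain ⟨K, hK0, hK⟩ := sum_integral_sq_le hx hε hxmom hεmom hG
    (fun T j hj => by have := hc T; have := hcT T; omega)
  refine ⟨4 * K, by positivity, hK.mono fun T hT i n' hn' y hy => ?_⟩
  have h := measure_backwardSum_le (P := P) (past ε x T) (past_le hx hε T) (past_mono T)
    (stronglyMeasurable_shock T i) (memLp_shock hL2 T i) (condExp_shock hL2 hεL2 hmds T i)
    (c T) n' (hn'.trans (hc T)) hy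
  rw [sum_integral_shock_sq (hcT T)] at h
  refine (measure_mono ?_).trans (h.trans (ENNReal.ofReal_le_ofReal ?_))
  · rintro s ⟨j, hj, hjy⟩
    exact ⟨j, hj, by rwa [sum_shock (hcT T)]⟩
  · have h1 := hT i n' hn'
    rw [Nat.sub_add_cancel (hn'.trans (hc T))] at h1
    rw [mul_assoc]
    gcongr

omit hx hxmom hmds in
/-- The sum of a bounded number of squared errors is negligible. -/
theorem measure_sum_error_sq_le {a b : ℕ → ℕ} {J : ℕ} (hab : ∀ T, b T ≤ a T + J)
    (hb : ∀ T, b T ≤ T) {f : ℕ → ℝ} (hf : Tendsto f atTop atTop) {η : ℝ} (hη : 0 < η) :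
    ∀ᶠ T in atTop, P {s | f T < ∑ t ∈ Finset.Ioc (a T) (b T), ε T t s ^ 2} ≤
      ENNReal.ofReal η := by
  obtain ⟨γ, hγ, hm⟩ := hεmom
  obtain ⟨K, hK0, hK⟩ := hm.sq hγ hε
  filter_upwards [hf.eventually_ge_atTop (J * K / η), hf.eventually_gt_atTop 0] with T hT hT0
  have hint : ∀ t ∈ Finset.Ioc (a T) (b T), Integrable (fun s => ε T t s ^ 2) P := by
    intro t ht
    rw [Finset.mem_Ioc] at ht
    have := hb T
    exact (hK T t (by omega) (by omega)).1.integrable_sq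
  have hmarkov := mul_meas_ge_le_integral_of_nonneg (μ := P)
    (f := fun s => ∑ t ∈ Finset.Ioc (a T) (b T), ε T t s ^ 2)
    (ae_of_all _ fun s => Finset.sum_nonneg fun _ _ => sq_nonneg _)
    (integrable_finsetSum _ hint) (f T)
  rw [integral_finsetSum _ hint] at hmarkov
  have hsum : ∑ t ∈ Finset.Ioc (a T) (b T), ∫ s, ε T t s ^ 2 ∂P ≤ J * K := by
    calc ∑ t ∈ Finset.Ioc (a T) (b T), ∫ s, ε T t s ^ 2 ∂P
        ≤ ∑ _t ∈ Finset.Ioc (a T) (b T), K := by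
          refine Finset.sum_le_sum fun t ht => ?_
          rw [Finset.mem_Ioc] at ht
          have := hb T
          exact (hK T t (by omega) (by omega)).2
      _ = (b T - a T : ℕ) * K := by rw [Finset.sum_const, Nat.card_Ioc, nsmul_eq_mul]
      _ ≤ J * K := by
        gcongr
        have := hab T
        omega
  have hreal : P.real {s | f T ≤ ∑ t ∈ Finset.Ioc (a T) (b T), ε T t s ^ 2} ≤ η := by
    rw [div_le_iff₀ hη] at hT
    refine le_of_mul_le_mul_left ?_ hT0
    exact hmarkov.trans (hsum.trans hT)
  calc P {s | f T < ∑ t ∈ Finset.Ioc (a T) (b T), ε T t s ^ 2}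
      ≤ P {s | f T ≤ ∑ t ∈ Finset.Ioc (a T) (b T), ε T t s ^ 2} :=
        measure_mono (Set.ofPred_subset_ofPred.2 fun s hs => le_of_lt hs)
    _ = ENNReal.ofReal (P.real {s | f T ≤ ∑ t ∈ Finset.Ioc (a T) (b T), ε T t s ^ 2}) :=
        (ENNReal.ofReal_toReal (measure_ne_top _ _)).symm
    _ ≤ ENNReal.ofReal η := ENNReal.ofReal_le_ofReal hreal

end Array

/-! ### The break date and the break magnitude -/

theorem BreakMagnitude.exists_rate {q : ℕ} {δ : ℕ → EuclideanSpace ℝ (Fin q)}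
    (h : BreakMagnitude δ) : ∃ γ : ℝ, 0 < γ ∧ γ < 1 / 2 ∧
      Tendsto (fun T : ℕ => (T : ℝ) ^ (1 - 2 * γ) * ‖δ T‖ ^ 2) atTop atTop := by
  have key : ∀ γ : ℝ, 0 < γ → γ < 1 / 2 →
      Tendsto (fun T : ℕ => (T : ℝ) ^ (1 / 2 - γ) * ‖δ T‖) atTop atTop →
      Tendsto (fun T : ℕ => (T : ℝ) ^ (1 - 2 * γ) * ‖δ T‖ ^ 2) atTop atTop := by
    intro γ _ _ hlim
    refine (hlim.atTop_mul_atTop₀ hlim).congr fun T => ?_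
    have h1 : (T : ℝ) ^ (1 - 2 * γ) = (T : ℝ) ^ (1 / 2 - γ) * (T : ℝ) ^ (1 / 2 - γ) := by
      rw [← Real.rpow_add_of_nonneg (Nat.cast_nonneg T) (by linarith) (by linarith)]
      congr 1
      ring
    rw [h1]
    ring
  rcases h with ⟨d, hd, hδ⟩ | ⟨-, γ, h0, h1, hlim⟩
  -- For a fixed break any exponent in `(0, 1/2)` would do.
  · refine ⟨1 / 4, by norm_num, by norm_num, key _ (by norm_num) (by norm_num) ?_⟩
    simp_rw [hδ]
    exact ((tendsto_rpow_atTop (by norm_num)).comp tendsto_natCast_atTop_atTop).atTop_mul_const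
      (norm_pos_iff.2 hd)
  · exact ⟨γ, h0, h1, key γ h0 h1 hlim⟩

theorem BreakMagnitude.exists_norm_sq_le {q : ℕ} {δ : ℕ → EuclideanSpace ℝ (Fin q)}
    (h : BreakMagnitude δ) : ∃ D : ℝ, 0 < D ∧ ∀ᶠ T in atTop, ‖δ T‖ ^ 2 ≤ D := by
  rcases h with ⟨d, hd, hδ⟩ | ⟨hlim, -⟩
  · have := norm_pos_iff.2 hd
    exact ⟨‖d‖ ^ 2, by positivity, Eventually.of_forall fun T => by rw [hδ]⟩
  · refine ⟨1, one_pos, ?_⟩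
    have h0 : Tendsto (fun T => ‖δ T‖ ^ 2) atTop (𝓝 0) := by
      simpa using hlim.norm.pow 2
    exact (h0.eventually (gt_mem_nhds one_pos)).mono fun T hT => hT.le

theorem BreakMagnitude.tendsto_mul {q : ℕ} {δ : ℕ → EuclideanSpace ℝ (Fin q)}
    (h : BreakMagnitude δ) : Tendsto (fun T : ℕ => (T : ℝ) * ‖δ T‖ ^ 2) atTop atTop := by
  obtain ⟨γ, h0, h1, hlim⟩ := h.exists_rate
  refine tendsto_atTop_mono' _ ?_ hlim
  filter_upwards [eventually_ge_atTop 1] with T hT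
  have hT1 : (1 : ℝ) ≤ T := by exact_mod_cast hT
  have h2 : (T : ℝ) ^ (1 - 2 * γ) ≤ (T : ℝ) ^ (1 : ℝ) :=
    Real.rpow_le_rpow_of_exponent_le hT1 (by linarith)
  rw [Real.rpow_one] at h2
  gcongr

theorem breakDate_le {ρ₀ : ℝ} (h1 : ρ₀ ≤ 1) (T : ℕ) : breakDate ρ₀ T ≤ T := by
  have h : ρ₀ * (T : ℝ) ≤ T := mul_le_of_le_one_left (Nat.cast_nonneg T) h1
  exact (Nat.floor_le_floor h).trans_eq (Nat.floor_natCast T)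

/-- The break fraction is at distance `α` from both ends; `α / 2` absorbs the rounding in `k₀ = [ρ₀
T]`. -/
theorem eventually_scale {α ρ₀ l B : ℝ} (hα : 0 < α ∧ α < 1 / 2)
    (hρ₀ : ρ₀ ∈ Set.Icc α (1 - α)) (hl : 0 < l) (hl1 : l ≤ 1) (hB : 1 ≤ B) {J : ℕ} (hJ : 1 ≤ J) :
    ∀ᶠ T in atTop, Scale T (breakDate ρ₀ T) J l B (α / 2) := by
  have hlim : Tendsto (fun T : ℕ => α / 4 * (T : ℝ)) atTop atTop :=
    tendsto_natCast_atTop_atTop.const_mul_atTop (by linarith [hα.1])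
  filter_upwards [hlim.eventually_ge_atTop (J : ℝ), hlim.eventually_ge_atTop 1,
    eventually_ge_atTop (2 * J)] with T hTJ hT1 hT2
  have hT0 : (0 : ℝ) ≤ T := Nat.cast_nonneg T
  have hle : (breakDate ρ₀ T : ℝ) ≤ ρ₀ * T :=
    Nat.floor_le (mul_nonneg (hα.1.le.trans hρ₀.1) hT0)
  have hgt : ρ₀ * T - 1 ≤ breakDate ρ₀ T := (Nat.sub_one_lt_floor _).le
  have h1 : α * T ≤ ρ₀ * T := mul_le_mul_of_nonneg_right hρ₀.1 hT0
  have h2 : ρ₀ * T ≤ (1 - α) * T := mul_le_mul_of_nonneg_right hρ₀.2 hT0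
  have h3 : 0 ≤ α * T := mul_nonneg hα.1.le hT0
  exact ⟨hl, hl1, hB, by linarith [hα.1], by linarith [hα.2], hJ, hT2, by linarith,
    breakDate_le (by linarith [hρ₀.2, hα.1]) T, by linarith, by linarith⟩

/-! ### Events of large probability -/

section Events

variable {S : Type*} [MeasurableSpace S] {P : Measure S} {p : ℕ}

theorem measure_le_add {A B C : Set S} {η₁ η₂ η : ℝ} (h : A ⊆ B ∪ C) (h₁ : 0 ≤ η₁) (h₂ : 0 ≤ η₂)
    (hη : η₁ + η₂ = η) (hB : P B ≤ ENNReal.ofReal η₁) (hC : P C ≤ ENNReal.ofReal η₂) :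
    P A ≤ ENNReal.ofReal η := by
  rw [← hη, ENNReal.ofReal_add h₁ h₂]
  exact (measure_mono h).trans ((measure_union_le B C).trans (add_le_add hB hC))

theorem measure_le_add₃ {A B C D : Set S} {η : ℝ} (h : A ⊆ B ∪ (C ∪ D)) (hη : 0 ≤ η)
    (hB : P B ≤ ENNReal.ofReal (η / 3)) (hC : P C ≤ ENNReal.ofReal (η / 3))
    (hD : P D ≤ ENNReal.ofReal (η / 3)) : P A ≤ ENNReal.ofReal η :=
  measure_le_add h (by positivity) (by positivity) (by ring) hB
    (measure_le_add (η := η / 3 + η / 3) subset_rfl (by positivity) (by positivity) rfl hC hD)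

/-- The bounds survive a smaller `l` and larger `B` and `J`, which lets the four families share
constants. -/
theorem WellConditioned.energy_bounds {x : ℕ → ℕ → S → Fin p → ℝ} {n : ℕ → ℕ} {b : ℕ → ℕ → ℕ}
    (hG : WellConditioned P n (fun T j => gram x T (b T j) j))
    (hb : ∀ T j, j ≤ n T → b T j + j ≤ T) {η : ℝ} (hη : 0 < η) :
    ∃ l₀ : ℝ, 0 < l₀ ∧ ∃ B₀ : ℝ, ∃ J₀ : ℕ, ∀ l, l ≤ l₀ → ∀ B, B₀ ≤ B → ∀ J, J₀ ≤ J → 1 ≤ J →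
      ∀ᶠ T in atTop, P {s | ¬ ((∀ j, J ≤ j → j ≤ n T → ∀ v,
          l * j * (v ⬝ᵥ v) ≤ energy (design x T s) (blk T (b T j) (b T j + j)) v) ∧
        ∀ j, 1 ≤ j → j ≤ n T → ∀ v,
          energy (design x T s) (blk T (b T j) (b T j + j)) v ≤ B * j * (v ⬝ᵥ v))} ≤
        ENNReal.ofReal η := by
  obtain ⟨l₀, hl₀, J₀, hev⟩ := hG.eigenvalue (η / 2) (by positivity)
  obtain ⟨B₀, hB₀⟩ := hG.bounded (η / 2) (by positivity)
  refine ⟨l₀, hl₀, B₀, J₀, fun l hl B hB J hJ hJ1 => ?_⟩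
  filter_upwards [hev, hB₀] with T h1 h2
  refine measure_le_add ?_ (by positivity) (by positivity) (add_halves η) h1 h2
  intro s hs
  by_contra hcon
  simp only [Set.mem_union, Set.mem_ofPred_eq, not_or] at hcon
  refine hs ⟨fun j hj hjn v => ?_, fun j hj hjn v => ?_⟩
  · have h3 := le_energy_of_gram x s (hb T j hjn) (l := l₀) (hJ1.trans hj)
      (fun hex => hcon.1 ⟨j, hJ.trans hj, hJ1.trans hj, hjn, hex⟩) v
    refine le_trans ?_ h3
    have := dotProduct_self_nonneg' v
    gcongr
  · rw [energy_design x s (hb T j hjn)]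
    refine (sum_sq_le_of_norm_gram_le x T s hj (fun hex => hcon.2 ⟨j, hj, hjn, hex⟩) v).trans ?_
    have := dotProduct_self_nonneg' v
    gcongr

theorem exists_regularDesign {x : ℕ → ℕ → S → Fin p → ℝ} {k₀ : ℕ → ℕ} (hk₀ : ∀ T, k₀ T ≤ T)
    (hfirst : WellConditioned P (fun T => T) (fun T j => gram x T 0 j))
    (hlast : WellConditioned P (fun T => T) (fun T j => gram x T (T - j) j))
    (hbefore : WellConditioned P k₀ (fun T j => gram x T (k₀ T - j) j))
    (hafter : WellConditioned P (fun T => T - k₀ T) (fun T j => gram x T (k₀ T) j))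
    {η : ℝ} (hη : 0 < η) : ∃ l B : ℝ, ∃ J₀ : ℕ, 0 < l ∧ l ≤ 1 ∧ 1 ≤ B ∧ 1 ≤ J₀ ∧
      ∀ J, J₀ ≤ J → ∀ᶠ T in atTop,
        P {s | ¬ RegularDesign (design x T s) (k₀ T) J l B} ≤ ENNReal.ofReal η := by
  have hη4 : 0 < η / 4 := by positivity
  obtain ⟨l₁, hl₁, B₁, J₁, h₁⟩ := WellConditioned.energy_bounds (b := fun _ _ => 0) hfirst
    (fun T j hj => by simpa using hj) hη4
  obtain ⟨l₂, hl₂, B₂, J₂, h₂⟩ := WellConditioned.energy_bounds (b := fun T j => T - j) hlast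
    (fun T j hj => by have : j ≤ T := hj; omega) hη4
  obtain ⟨l₃, hl₃, B₃, J₃, h₃⟩ := WellConditioned.energy_bounds (b := fun T j => k₀ T - j) hbefore
    (fun T j hj => by have := hk₀ T; omega) hη4
  obtain ⟨l₄, hl₄, B₄, J₄, h₄⟩ := WellConditioned.energy_bounds (b := fun T _ => k₀ T) hafter
    (fun T j hj => by have := hk₀ T; have : j ≤ T - k₀ T := hj; omega) hη4
  refine ⟨min 1 (min (min l₁ l₂) (min l₃ l₄)), max 1 (max (max B₁ B₂) (max B₃ B₄)),
    max 1 (max (max J₁ J₂) (max J₃ J₄)), by positivity, min_le_left _ _, le_max_left _ _,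
    le_max_left _ _, fun J hJ => ?_⟩
  simp only [max_le_iff] at hJ
  obtain ⟨hJ0, ⟨hJ₁, hJ₂⟩, hJ₃, hJ₄⟩ := hJ
  set l := min 1 (min (min l₁ l₂) (min l₃ l₄))
  set B := max 1 (max (max B₁ B₂) (max B₃ B₄))
  filter_upwards [h₁ l (by simp [l]) B (by simp [B]) J hJ₁ hJ0,
    h₂ l (by simp [l]) B (by simp [B]) J hJ₂ hJ0, h₃ l (by simp [l]) B (by simp [B]) J hJ₃ hJ0,
    h₄ l (by simp [l]) B (by simp [B]) J hJ₄ hJ0] with T e₁ e₂ e₃ e₄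
  refine measure_le_add (η₁ := η / 4 + η / 4) (η₂ := η / 4 + η / 4) ?_ (by positivity)
    (by positivity) (by ring)
    (measure_le_add subset_rfl (by positivity) (by positivity) rfl e₁ e₂)
    (measure_le_add subset_rfl (by positivity) (by positivity) rfl e₃ e₄)
  intro s hs
  by_contra hcon
  simp only [Set.mem_union, Set.mem_ofPred_eq, not_or, not_not] at hcon
  obtain ⟨⟨⟨a₁, b₁⟩, a₂, b₂⟩, ⟨a₃, b₃⟩, a₄, b₄⟩ := hcon
  refine hs ⟨fun j hj hjn v => ?_, fun j hj hjn v => ?_, fun j hj hjn v => ?_,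
    fun j hj hjn v => ?_, fun j hj hjn v => ?_, fun j hj hjn v => ?_, fun j hj hjn v => ?_,
    fun j hj hjn v => ?_⟩
  · simpa only [zero_add] using a₁ j hj hjn v
  · simpa only [Nat.sub_add_cancel hjn] using a₂ j hj hjn v
  · simpa only [Nat.sub_add_cancel hjn] using a₃ j hj hjn v
  · exact a₄ j hj hjn v
  · simpa only [zero_add] using b₁ j hj hjn v
  · simpa only [Nat.sub_add_cancel hjn] using b₂ j hj hjn v
  · simpa only [Nat.sub_add_cancel hjn] using b₃ j hj hjn v
  · exact b₄ j hj hjn v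

/-- The errors of row `T` of the array. -/
def errors (ε : ℕ → ℕ → S → ℝ) (T : ℕ) (s : S) : Fin T → ℝ := fun t => ε T ((t : ℕ) + 1) s

omit [MeasurableSpace S] in
theorem score_design {x : ℕ → ℕ → S → Fin p → ℝ} {ε : ℕ → ℕ → S → ℝ} {T a b : ℕ} (hb : b ≤ T)
    (s : S) : score (design x T s) (blk T a b) (errors ε T s) =
      fun i => ∑ t ∈ Finset.Ioc a b, x T t s i * ε T t s := by
  funext i
  rw [← sum_blk_eq_sum_Ioc hb (fun t => x T t s i * ε T t s), score, Finset.sum_apply]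
  refine Finset.sum_congr rfl fun t _ => ?_
  rw [Pi.smul_apply, smul_eq_mul, mul_comm]
  rfl

/-- Six events of probability `η / 6`. Only the two families of blocks adjacent to `k₀` restrict
`C`; the other four bounds hold for large `T` because `T d` and `T^(1-2γ) d` diverge. -/
theorem exists_smallNoise [IsProbabilityMeasure P] {x : ℕ → ℕ → S → Fin p → ℝ}
    {ε : ℕ → ℕ → S → ℝ} {k₀ : ℕ → ℕ} (hk₀ : ∀ T, k₀ T ≤ T)
    (hx : ∀ T t, Measurable (x T t)) (hε : ∀ T t, Measurable (ε T t))
    (hfirst : WellConditioned P (fun T => T) (fun T j => gram x T 0 j))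
    (hlast : WellConditioned P (fun T => T) (fun T j => gram x T (T - j) j))
    (hbefore : WellConditioned P k₀ (fun T j => gram x T (k₀ T - j) j))
    (hafter : WellConditioned P (fun T => T - k₀ T) (fun T j => gram x T (k₀ T) j))
    (hxmom : ∃ γ : ℝ, 0 < γ ∧ ∀ i, Nonrandom P (fun T t s => x T t s i) ∨
      BoundedMoment P (4 + γ) (fun T t s => x T t s i))
    (hmds : ∀ T t, 1 ≤ t → t ≤ T → P[ε T t | past ε x T t] =ᵐ[P] 0)
    (hεmom : ∃ γ : ℝ, 0 < γ ∧ BoundedMoment P (4 + γ) ε)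
    {d : ℕ → ℝ} (hd : ∀ᶠ T in atTop, 0 < d T) {γ : ℝ} (hγ : 0 < γ)
    (hrate : Tendsto (fun T : ℕ => (T : ℝ) ^ (1 - 2 * γ) * d T) atTop atTop)
    (hTd : Tendsto (fun T : ℕ => (T : ℝ) * d T) atTop atTop)
    (J : ℕ) {σ η : ℝ} (hσ : 0 < σ) (hη : 0 < η) :
    ∃ C₀ : ℝ, 0 < C₀ ∧ ∀ C, C₀ ≤ C → ∀ᶠ T in atTop,
      P {s | ¬ SmallNoise (design x T s) (errors ε T s) (k₀ T) J ⌈C / d T⌉₊ σ (d T)} ≤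
        ENNReal.ofReal η := by
  have m₁ := maximalBound_forward hx hε hxmom hmds hεmom (a := fun _ => 0) hfirst (by simp)
  have m₂ := maximalBound_backward hx hε hxmom hmds hεmom (c := fun T => T) hlast
    (fun _ => le_rfl) (fun _ => le_rfl)
  have m₃ := maximalBound_backward hx hε hxmom hmds hεmom hbefore (fun _ => le_rfl) hk₀
  have m₄ := maximalBound_forward hx hε hxmom hmds hεmom hafter
    (fun T => by have := hk₀ T; omega)
  have hη6 : 0 < η / 6 := by positivity
  have hσTd : Tendsto (fun T : ℕ => σ * T * d T) atTop atTop := by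
    refine (hTd.const_mul_atTop hσ).congr fun T => ?_
    ring
  obtain ⟨C₃, hC₃, h₃⟩ := m₃.near hd hσ hη6
  obtain ⟨C₄, hC₄, h₄⟩ := m₄.near hd hσ hη6
  refine ⟨max C₃ C₄, by positivity, fun C hC => ?_⟩
  rw [max_le_iff] at hC
  filter_upwards [m₁.far (fun _ => le_rfl) hd hγ hrate hσ hη6,
    m₂.far (fun _ => le_rfl) hd hγ hrate hσ hη6, h₃ C hC.1, h₄ C hC.2,
    measure_sum_error_sq_le hε hεmom (a := fun _ => 0) (b := fun T => min J T) (J := J)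
      (fun T => by simp) (fun T => min_le_right _ _) hσTd hη6,
    measure_sum_error_sq_le hε hεmom (a := fun T => T - J) (b := fun T => T) (J := J)
      (fun T => by omega) (fun T => le_rfl) hσTd hη6] with T e₁ e₂ e₃ e₄ e₅ e₆
  refine measure_le_add (η₁ := η / 6 + η / 6) (η₂ := (η / 6 + η / 6) + (η / 6 + η / 6)) ?_
    (by positivity) (by positivity) (by ring)
    (measure_le_add subset_rfl (by positivity) (by positivity) rfl e₁ e₂)
    (measure_le_add subset_rfl (by positivity) (by positivity) rfl
      (measure_le_add subset_rfl (by positivity) (by positivity) rfl e₃ e₄)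
      (measure_le_add subset_rfl (by positivity) (by positivity) rfl e₅ e₆))
  intro s hs
  by_contra hcon
  simp only [Set.mem_union, Set.mem_ofPred_eq, not_or, not_exists, not_and, not_lt] at hcon
  obtain ⟨⟨c₁, c₂⟩, ⟨c₃, c₄⟩, c₅, c₆⟩ := hcon
  have hkT := hk₀ T
  refine hs ⟨fun j hj hjn => ?_, fun j hj hjn => ?_, fun j hj hjn => ?_, fun j hj hjn => ?_,
    ?_, ?_⟩
  · rw [score_design hjn]
    simpa only [zero_add] using c₁ j hj hjn
  · rw [score_design le_rfl]
    exact c₂ j hj hjn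
  · rw [score_design hkT]
    exact c₃ j hj hjn
  · rw [score_design (by omega)]
    exact c₄ j hj hjn
  · have hblk : blk T 0 J = blk T 0 (min J T) := by
      ext t
      simp only [mem_blk]
      omega
    rw [hblk]
    exact (sum_blk_eq_sum_Ioc (min_le_right _ _) (fun t => ε T t s ^ 2)).le.trans c₅
  · exact (sum_blk_eq_sum_Ioc le_rfl (fun t => ε T t s ^ 2)).le.trans c₆

end Events

theorem response_eq {S : Type*} {p q : ℕ} {R : Matrix (Fin p) (Fin q) ℝ} {β : Fin p → ℝ}
    {dl : Fin q → ℝ} {x : ℕ → ℕ → S → Fin p → ℝ} {ε y : ℕ → ℕ → S → ℝ} {T k₀ : ℕ} {s : S}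
    (hy : ∀ t, 1 ≤ t → t ≤ T → y T t s = x T t s ⬝ᵥ β +
      (if k₀ < t then (Rᵀ *ᵥ x T t s) ⬝ᵥ dl else 0) + ε T t s) :
    response y T s = design x T s *ᵥ β + Zmat (design x T s) R k₀ *ᵥ dl + errors ε T s := by
  funext t
  have hdot : (Rᵀ *ᵥ x T (t + 1) s) ⬝ᵥ dl = x T (t + 1) s ⬝ᵥ (R *ᵥ dl) := by
    rw [dotProduct_comm, dotProduct_mulVec_transpose, dotProduct_comm]
  have hmem : t ∈ blk T k₀ T ↔ k₀ < (t : ℕ) + 1 := by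
    rw [mem_blk]
    exact and_iff_left t.2
  rw [response, hy _ (by omega) t.2, hdot, Pi.add_apply, Pi.add_apply, Zmat_mulVec]
  simp only [masked, hmem]
  rfl

/-! ### From the rate for the date to the rate for the fraction -/

section Rates

variable {S : Type*} [MeasurableSpace S] {P : Measure S} {ρ₀ : ℝ} {khat : ℕ → S → ℕ} {d : ℕ → ℝ}

theorem abs_div_sub_le {ρ : ℝ} (hρ : 0 ≤ ρ) {T k : ℕ} (hT : 1 ≤ T) :
    |(k : ℝ) / T - ρ| ≤ (T : ℝ)⁻¹ * (|(k : ℝ) - breakDate ρ T| + 1) := by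
  have hT0 : (0 : ℝ) < T := by exact_mod_cast hT
  have hle : (breakDate ρ T : ℝ) ≤ ρ * T := Nat.floor_le (mul_nonneg hρ hT0.le)
  have hgt : ρ * T - 1 ≤ breakDate ρ T := (Nat.sub_one_lt_floor _).le
  have h1 : (k : ℝ) / T - ρ = (T : ℝ)⁻¹ * ((k - breakDate ρ T) + (breakDate ρ T - ρ * T)) := by
    field_simp
    ring
  rw [h1, abs_mul, abs_of_pos (inv_pos.2 hT0)]
  gcongr
  refine (abs_add_le _ _).trans ?_
  gcongr
  rw [abs_le]
  constructor <;> linarith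

/-- Rounding `ρ₀ T` adds at most one period to the error in the date, and `1 ≤ D / d` absorbs it
into the rate. -/
theorem isBigOp_fraction (hρ₀ : 0 ≤ ρ₀) (hd : ∀ᶠ T in atTop, 0 < d T) {D : ℝ} (hD : 0 < D)
    (hdD : ∀ᶠ T in atTop, d T ≤ D)
    (h : IsBigOp P (fun T s => (khat T s : ℝ) - breakDate ρ₀ T) fun T => (d T)⁻¹) :
    IsBigOp P (fun T s => (khat T s : ℝ) / T - ρ₀) fun T => (T : ℝ)⁻¹ * (d T)⁻¹ := by
  intro η hη
  obtain ⟨C, hC, hev⟩ := h η hη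
  refine ⟨C + D, by positivity, ?_⟩
  filter_upwards [hev, hd, hdD, eventually_ge_atTop 1] with T hT hd0 hdD hT1
  refine (measure_mono ?_).trans hT
  refine Set.ofPred_subset_ofPred.2 fun s hs => ?_
  have hT0 : (0 : ℝ) < T := by exact_mod_cast hT1
  have h1 := hs.trans_le (abs_div_sub_le (k := khat T s) hρ₀ hT1)
  have h2 : (C + D) * ((T : ℝ)⁻¹ * (d T)⁻¹) = (T : ℝ)⁻¹ * ((C + D) * (d T)⁻¹) := by ring
  rw [h2] at h1
  have h3 := lt_of_mul_lt_mul_left h1 (inv_pos.2 hT0).le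
  have h4 : 1 ≤ D * (d T)⁻¹ := by rwa [← div_eq_mul_inv, one_le_div hd0]
  linarith

theorem tendstoInMeasure_of_isBigOp {U : ℕ → S → ℝ} {c : ℝ} {r : ℕ → ℝ}
    (hr : Tendsto r atTop (𝓝 0)) (h : IsBigOp P (fun T s => U T s - c) r) :
    TendstoInMeasure P U atTop fun _ => c := by
  rw [tendstoInMeasure_iff_dist]
  intro a ha
  rw [ENNReal.tendsto_nhds_zero]
  intro η hη
  rcases eq_or_ne η ⊤ with rfl | htop
  · exact Eventually.of_forall fun _ => le_top
  obtain ⟨C, hC, hev⟩ := h η.toReal (ENNReal.toReal_pos hη.ne' htop)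
  have hCr : Tendsto (fun T => C * r T) atTop (𝓝 0) := by simpa using hr.const_mul C
  filter_upwards [hev, hCr.eventually (gt_mem_nhds ha)] with T hT hlt
  rw [ENNReal.ofReal_toReal htop] at hT
  refine (measure_mono ?_).trans hT
  refine Set.ofPred_subset_ofPred.2 fun s hs => ?_
  rw [Real.dist_eq] at hs
  exact hlt.trans_le hs

end Rates

end BreakPoint

theorem mainTheorem2 {S : Type*} [MeasurableSpace S] (P : Measure S) [IsProbabilityMeasure P]
    {p q : ℕ}
    -- the true break fraction
    (α ρ₀ : ℝ) (hα : 0 < α ∧ α < 1 / 2) (hρ₀ : ρ₀ ∈ Set.Icc α (1 - α))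
    -- the model: `y_t = x_t'β + 1{t > k₀} z_t'δ_T + ε_t` with `z_t = R'x_t`
    (R : Matrix (Fin p) (Fin q) ℝ) (hR : R.rank = q)
    (β : Fin p → ℝ) (δ : ℕ → EuclideanSpace ℝ (Fin q))
    (x : ℕ → ℕ → S → Fin p → ℝ) (ε y : ℕ → ℕ → S → ℝ)
    (hx : ∀ T t, Measurable (x T t)) (hε : ∀ T t, Measurable (ε T t))
    (hy : ∀ T t s, 1 ≤ t → t ≤ T →
      y T t s = x T t s ⬝ᵥ β +
        (if BreakPoint.breakDate ρ₀ T < t then (Rᵀ *ᵥ x T t s) ⬝ᵥ (δ T).ofLp else 0) + ε T t s)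
    -- the four families of second moment matrices of the regressors
    (hfirst : BreakPoint.WellConditioned P (fun T => T)
      (fun T j => BreakPoint.gram x T 0 j))
    (hlast : BreakPoint.WellConditioned P (fun T => T)
      (fun T j => BreakPoint.gram x T (T - j) j))
    (hbefore : BreakPoint.WellConditioned P (fun T => BreakPoint.breakDate ρ₀ T)
      (fun T j => BreakPoint.gram x T (BreakPoint.breakDate ρ₀ T - j) j))
    (hafter : BreakPoint.WellConditioned P (fun T => T - BreakPoint.breakDate ρ₀ T)
      (fun T j => BreakPoint.gram x T (BreakPoint.breakDate ρ₀ T) j))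
    -- moments of the random regressors
    (hxmom : ∃ γ : ℝ, 0 < γ ∧ ∀ i, BreakPoint.Nonrandom P (fun T t s => x T t s i) ∨
      BreakPoint.BoundedMoment P (4 + γ) (fun T t s => x T t s i))
    -- `X'X / T` converges in probability to a nonrandom positive definite matrix
    (hXX : ∃ V : Matrix (Fin p) (Fin p) ℝ, V.PosDef ∧
      ∀ i j, TendstoInMeasure P (fun T s => BreakPoint.gram x T 0 T s i j) atTop (fun _ => V i j))
    -- martingale difference errors with bounded moments
    (hmds : ∀ T t, 1 ≤ t → t ≤ T → P[ε T t | BreakPoint.past ε x T t] =ᵐ[P] 0)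
    (hεmom : ∃ γ : ℝ, 0 < γ ∧ BreakPoint.BoundedMoment P (4 + γ) ε)
    -- the nonrandom weights `Ω_k`, their limit, and the norm inequality
    (W : ℕ → ℕ → Matrix (Fin q) (Fin q) ℝ)
    (hW : ∀ T k, 1 ≤ k → k < T → (W T k).PosDef)
    (hWlim : ∃ Wbar : ℝ → Matrix (Fin q) (Fin q) ℝ,
      (∀ i j, DifferentiableOn ℝ (fun ρ => Wbar ρ i j) (Set.Icc 0 1)) ∧
      ∀ ρ ∈ Set.Icc (0 : ℝ) 1, ∀ k : ℕ → ℕ, (∀ᶠ T in atTop, 1 ≤ k T ∧ k T < T) →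
        Tendsto (fun T : ℕ => (k T : ℝ) / (T : ℝ)) atTop (𝓝 ρ) →
        Tendsto (fun T => W T (k T)) atTop (𝓝 (Wbar ρ)))
    (hWineq : ∀ η : ℝ, 0 < η → ∃ κ : ℝ, 0 < κ ∧ ∃ J : ℕ, ∀ᶠ T in atTop,
      P {s | ∃ k, BreakPoint.Admissible (BreakPoint.design x T s) R k ∧
        (J : ℤ) ≤ |(k : ℤ) - (BreakPoint.breakDate ρ₀ T : ℤ)| ∧
        ¬ BreakPoint.NormIneq (BreakPoint.design x T s) R (W T) (BreakPoint.breakDate ρ₀ T) κ k}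
        ≤ ENNReal.ofReal η)
    -- the break magnitude
    (hδ : BreakPoint.BreakMagnitude δ)
    -- the estimator of the break date
    (khat : ℕ → S → ℕ)
    (hkhat : ∀ T, ∀ᵐ s ∂P, (∃ k, BreakPoint.Admissible (BreakPoint.design x T s) R k) →
      BreakPoint.IsArgmax (BreakPoint.design x T s) R (BreakPoint.response y T s) (W T)
        (khat T s)) :
    BreakPoint.IsBigOp P (fun T s => (khat T s : ℝ) - (BreakPoint.breakDate ρ₀ T : ℝ))
        (fun T => (‖δ T‖ ^ 2)⁻¹) ∧
      BreakPoint.IsBigOp P (fun T s => (khat T s : ℝ) / (T : ℝ) - ρ₀)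
        (fun T => (T : ℝ)⁻¹ * (‖δ T‖ ^ 2)⁻¹) ∧
      TendstoInMeasure P (fun T s => (khat T s : ℝ) / (T : ℝ)) atTop (fun _ => ρ₀) := by

  have hα0 := hα.1
  have hρ0 : 0 ≤ ρ₀ := hα0.le.trans hρ₀.1
  have hρ1 : ρ₀ ≤ 1 := by linarith [hρ₀.2]
  have hk₀ : ∀ T, BreakPoint.breakDate ρ₀ T ≤ T := BreakPoint.breakDate_le hρ1
  obtain ⟨γ, hγ, -, hrate⟩ := hδ.exists_rate
  obtain ⟨D, hD, hdD⟩ := hδ.exists_norm_sq_le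
  have hTd := hδ.tendsto_mul
  have hd : ∀ᶠ T in atTop, 0 < ‖δ T‖ ^ 2 := by
    filter_upwards [hTd.eventually_gt_atTop 0] with T hT
    exact pos_of_mul_pos_right hT (Nat.cast_nonneg T)
  obtain ⟨r, hr0, hRr⟩ := BreakPoint.exists_le_of_rank_eq hR
  obtain ⟨Wbar, -, hWbar⟩ := hWlim
  obtain ⟨K, hK0, hK⟩ := BreakPoint.exists_norm_weight_le hWbar
  have hmain : BreakPoint.IsBigOp P
      (fun T s => (khat T s : ℝ) - (BreakPoint.breakDate ρ₀ T : ℝ))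
      (fun T => (‖δ T‖ ^ 2)⁻¹) := by
    intro η hη
    have hη3 : 0 < η / 3 := by positivity
    obtain ⟨κ, hκ, J₁, hineq⟩ := hWineq (η / 3) hη3
    obtain ⟨l, B, J₂, hl, hl1, hB, hJ₂, hreg⟩ :=
      BreakPoint.exists_regularDesign hk₀ hfirst hlast hbefore hafter hη3
    obtain ⟨σ, hσ, hcore⟩ := BreakPoint.objective_lt_of_regular (l := l) (B := B) (a := α / 2)
      hr0 hκ hK0 hl (by linarith) hB
    set J := max J₁ J₂ with hJ
    obtain ⟨C₀, hC₀, hnoise⟩ := BreakPoint.exists_smallNoise hk₀ hx hε hfirst hlast hbefore hafter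
      hxmom hmds hεmom hd hγ hrate hTd J hσ hη3
    -- As `d ≤ D`, the term `J * D` forces `J ≤ ⌈C / d⌉`: dates beyond this distance are far enough
    -- for the eigenvalue bounds and the norm inequality.
    refine ⟨max C₀ (J * D), lt_max_of_lt_left hC₀, ?_⟩
    set C := max C₀ (J * D) with hC
    filter_upwards [hineq, hreg J (le_max_right _ _), hnoise C (le_max_left _ _), hd, hdD, hK,
      BreakPoint.eventually_scale hα hρ₀ hl hl1 hB (hJ₂.trans (le_max_right J₁ J₂))]
      with T e₁ e₂ e₃ hd0 hdD hKT hscale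
    have hnull : P {s | ¬ ((∃ k, BreakPoint.Admissible (BreakPoint.design x T s) R k) →
        BreakPoint.IsArgmax (BreakPoint.design x T s) R (BreakPoint.response y T s) (W T)
          (khat T s))} = 0 := hkhat T
    have hJm : J ≤ ⌈C / ‖δ T‖ ^ 2⌉₊ := by
      have h1 : (J : ℝ) ≤ C / ‖δ T‖ ^ 2 := by
        rw [le_div_iff₀ hd0]
        exact (mul_le_mul_of_nonneg_left hdD (Nat.cast_nonneg J)).trans (le_max_right _ _)
      exact_mod_cast h1.trans (Nat.le_ceil _)
    -- Off the null set where `khat` is not a maximizer, a large error forces one of three failures: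
    -- of the norm inequality, of the design or of the noise bounds. Otherwise `k₀` is admissible
    -- and beats `khat`.
    have hcover : P ({s | C * (‖δ T‖ ^ 2)⁻¹ <
        |(khat T s : ℝ) - (BreakPoint.breakDate ρ₀ T : ℝ)|} ∩
        {s | ¬ ((∃ k, BreakPoint.Admissible (BreakPoint.design x T s) R k) →
          BreakPoint.IsArgmax (BreakPoint.design x T s) R (BreakPoint.response y T s) (W T)
            (khat T s))}ᶜ) ≤ ENNReal.ofReal η := by
      refine BreakPoint.measure_le_add₃ ?_ hη.le e₁ e₂ e₃
      rintro s ⟨hfar, hs⟩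
      by_contra hcon
      simp only [Set.mem_union, Set.mem_compl_iff, Set.mem_ofPred_eq, not_or, not_not] at hcon hs hfar
      obtain ⟨hni, hrd, hsn⟩ := hcon
      set k₀ := BreakPoint.breakDate ρ₀ T with hk₀def
      have hadm : BreakPoint.Admissible (BreakPoint.design x T s) R k₀ :=
        ⟨hscale.one_le_k₀, hscale.k₀_lt,
          BreakPoint.isUnit_det_ZMZ_break R hscale hrd hr0 hRr⟩
      obtain ⟨hkadm, hmax⟩ := hs ⟨k₀, hadm⟩
      set k := khat T s with hkdef
      obtain ⟨h, hh⟩ : ∃ h, k + h = k₀ ∨ k₀ + h = k := by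
        rcases le_total k k₀ with hle | hle
        · exact ⟨k₀ - k, Or.inl (by omega)⟩
        · exact ⟨k - k₀, Or.inr (by omega)⟩
      have habs : |(k : ℝ) - (k₀ : ℝ)| = h := by
        rcases hh with hh | hh
        · have : (k : ℝ) + h = k₀ := by exact_mod_cast hh
          rw [abs_sub_comm, abs_of_nonneg] <;> linarith [Nat.cast_nonneg (α := ℝ) h]
        · have : (k₀ : ℝ) + h = k := by exact_mod_cast hh
          rw [abs_of_nonneg] <;> linarith [Nat.cast_nonneg (α := ℝ) h]
      have hmh : ⌈C / ‖δ T‖ ^ 2⌉₊ ≤ h := by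
        rw [habs, ← div_eq_mul_inv] at hfar
        exact Nat.ceil_le.2 hfar.le
      have hJh : J₁ ≤ h := (le_max_left J₁ J₂).trans (hJm.trans hmh)
      have hnormineq : BreakPoint.NormIneq (BreakPoint.design x T s) R (W T) k₀ κ k := by
        by_contra hnot
        refine hni ⟨k, hkadm, ?_, hnot⟩
        rcases hh with hh | hh
        · rw [abs_sub_comm, abs_of_nonneg] <;> omega
        · rw [abs_of_nonneg] <;> omega
      have hdd := BreakPoint.dotProduct_self_eq_norm_sq (δ T)
      rw [← hdd] at hsn
      refine (hmax k₀ hadm).not_gt (hcore R β (δ T).ofLp (BreakPoint.response y T s) (W T) hRr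
        hscale hrd hsn (by rwa [hdd]) (by rwa [hdd])
        (BreakPoint.response_eq fun t h1 h2 => hy T t s h1 h2)
        (fun k h1 h2 v => ⟨BreakPoint.quad_nonneg_of_posDef (hW T k h1 h2) v, ?_⟩)
        k h hkadm hnormineq (by rwa [hdd]) hh)
      exact (BreakPoint.quad_le_norm_mul _ v).trans
        (mul_le_mul_of_nonneg_right (hKT k h1 h2) (BreakPoint.dotProduct_self_nonneg' v))
    exact (measure_inter_conull (by rwa [compl_compl])).symm.le.trans hcover
  have hfrac := BreakPoint.isBigOp_fraction hρ0 hd hD hdD hmain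
  refine ⟨hmain, hfrac, BreakPoint.tendstoInMeasure_of_isBigOp ?_ hfrac⟩
  exact (tendsto_inv_atTop_zero.comp hTd).congr fun T => mul_inv _ _
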